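/- \textbf{Proposition.} Let $n\ge 2$ and let $M(c)=(M^{2n+1},\phi,\xi,\eta,g)$ be a Sasakian space form, i.e. a normal contact metric manifold ($d\eta(X,Y)=g(X,\phi Y)$ and $N_\phi=-2\,d\eta\otimes\xi$, with $2\,d\eta(X,Y)=X\eta(Y)-Y\eta(X)-\eta([X,Y])$) whose $\phi$-sectional curvature is constant and equal to $c$, and let $c\neq 1$. Let $I\subset\mathbb R$ be an open interval and let $\gamma:I\to M(c)$ be a smooth Legendre curve ($\eta(\gamma')=0$), parametrized by arc length with $T=\gamma'$, which is a Frenet curve of osculating order $r$, $4\le r\le 2n+1$: there are smooth orthonormal fields $E_1=T,E_2,\dots,E_r$ along $\gamma$ and smooth functions $k_1,\dots,k_{r-1}>0$ with $\nabla_TE_1=k_1E_2$, $\nabla_TE_i=-k_{i-1}E_{i-1}+k_iE_{i+1}$ for $2\le i\le r-1$, and $\nabla_TE_r=-k_{r-1}E_{r-1}$. Put $f=g(\phi T,E_2)$ and assume that $f$ is not identically $0$, not identically $1$ and not identically $-1$. Let $\delta_1,\delta_2\in\mathbb R$ with $\delta_2\ne0$ and $\delta_1/\delta_2\neq 0$.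 The curve $\gamma$ is called interpolating sesqui-harmonic if for every compact interval $\Omega\subset I$ it is a critical point, with respect to smooth variations supported in $\Omega$, of $$E_{\delta_1,\delta_2}(\gamma)=\delta_1\int_\Omega\|d\gamma\|^2\,ds+\delta_2\int_\Omega\|\tau(\gamma)\|^2\,ds,\qquad \tau(\gamma)=\nabla_{\gamma'}\gamma'.$$ Then $\gamma$ is interpolating sesqui-harmonic if and only if $\phi T\in\operatorname{span}\{E_2,E_3,E_4\}$ along $\gamma$ and $$k_1=\text{constant}>0,\qquad k_1^2+k_2^2=\frac{c+3}{4}+\frac{3(c-1)}{4}f^2-\frac{\delta_1}{\delta_2},$$ $$k_2'=-\frac{3(c-1)}{4}\,f\,g(E_3,\phi T),\qquad k_2k_3=-\frac{3(c-1)}{4}\,f\,g(E_4,\phi T).$$ -/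

import Mathlib

open Set Bundle Manifold
open scoped ContDiff

noncomputable section

/-- The model space `ℝᵐ`. -/
abbrev Model (m : ℕ) : Type := EuclideanSpace ℝ (Fin m)

/-- Smooth Riemannian metrics on an `m`-dimensional manifold. -/
abbrev RMetric (m : ℕ) (M : Type*) [TopologicalSpace M] [ChartedSpace (Model m) M]
    [IsManifold (𝓡 m) ∞ M] : Type _ :=
  ContMDiffRiemannianMetric (𝓡 m) ∞ (Model m) (TangentSpace (𝓡 m) : M → Type _)

section Riemannian

variable {m : ℕ} {M : Type*} [TopologicalSpace M] [ChartedSpace (Model m) M]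
  [IsManifold (𝓡 m) ∞ M]

/-- The coordinate frame at `q` of the preferred chart around `p`: it sends `u = (u¹, …, uᵐ)` to
`∑ uⁱ ∂ᵢ`. -/
def coordFrame (p q : M) : Model m →L[ℝ] TangentSpace (𝓡 m) q :=
  (trivializationAt (Model m) (TangentSpace (𝓡 m)) p).symmL ℝ q

/-- The components at `q` of a tangent vector with respect to the coordinate frame of the preferred
chart around `p`. -/
def coordRep (p q : M) : TangentSpace (𝓡 m) q →L[ℝ] Model m :=
  (trivializationAt (Model m) (TangentSpace (𝓡 m)) p).continuousLinearMapAt ℝ q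

/-- The coordinates of `p` in the preferred chart around `p`. -/
def coordCenter (p : M) : Model m := extChartAt (𝓡 m) p p

/-- The point with coordinates `y` in the preferred chart around `p`. -/
def coordPoint (p : M) (y : Model m) : M := (extChartAt (𝓡 m) p).symm y

/-- The metric in coordinates: `metricCoord g p y u v = ∑ gᵢⱼ(y) uⁱ vʲ`. -/
def metricCoord (g : RMetric m M) (p : M) (y : Model m) : Model m →L[ℝ] Model m →L[ℝ] ℝ :=
  ((ContinuousLinearMap.precomp ℝ (coordFrame p (coordPoint p y))).comp
    (g.inner (coordPoint p y))).comp (coordFrame p (coordPoint p y))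

/-- The Christoffel symbols of the Levi-Civita connection in coordinates:
`christoffel g p y u v = ∑ Γᵏᵢⱼ(y) uⁱ vʲ ∂ₖ` is the vector `Γ` with
`g(Γ, w) = (D_u g(v, w) + D_v g(u, w) - D_w g(u, v)) / 2` for all `w`. -/
def christoffel (g : RMetric m M) (p : M) (y u v : Model m) : Model m :=
  (metricCoord g p y).inverse ((1 / 2 : ℝ) •
    (fderiv ℝ (metricCoord g p) y u v + fderiv ℝ (metricCoord g p) y v u
      - ((fderiv ℝ (metricCoord g p) y).flip u).flip v))

/-- The curvature tensor `R(u, v) w = ∇_u ∇_v w - ∇_v ∇_u w - ∇_[u, v] w` at `x`, computed in the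
preferred chart around `x`. -/
def curvature (g : RMetric m M) (x : M) (u v w : TangentSpace (𝓡 m) x) : TangentSpace (𝓡 m) x :=
  let y := coordCenter x
  let u' := coordRep x x u
  let v' := coordRep x x v
  let w' := coordRep x x w
  coordFrame x x
    (fderiv ℝ (fun z => christoffel g x z v' w') y u'
      - fderiv ℝ (fun z => christoffel g x z u' w') y v'
      + christoffel g x y u' (christoffel g x y v' w')
      - christoffel g x y v' (christoffel g x y u' w'))

/-- The velocity `γ'(s)` of a curve. -/
def velocity (γ : ℝ → M) (s : ℝ) : TangentSpace (𝓡 m) (γ s) :=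
  mfderiv 𝓘(ℝ, ℝ) (𝓡 m) γ s (1 : ℝ)

/-- The Levi-Civita covariant derivative `(∇_{γ'} V)(s)` of a vector field `V` along the curve `γ`,
computed in the preferred chart around `γ s`. -/
def covDerivAlong (g : RMetric m M) (γ : ℝ → M) (V : ∀ s, TangentSpace (𝓡 m) (γ s)) (s : ℝ) :
    TangentSpace (𝓡 m) (γ s) :=
  coordFrame (γ s) (γ s)
    (deriv (fun t => coordRep (γ s) (γ t) (V t)) s
      + christoffel g (γ s) (coordCenter (γ s))
          (coordRep (γ s) (γ s) (velocity γ s)) (coordRep (γ s) (γ s) (V s)))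

/-- `V` is a smooth vector field along `γ` on `J`. -/
def SmoothAlong (J : Set ℝ) (γ : ℝ → M) (V : ∀ s, TangentSpace (𝓡 m) (γ s)) : Prop :=
  ContMDiffOn 𝓘(ℝ, ℝ) (𝓡 m).tangent ∞
    (fun s => (⟨γ s, V s⟩ : TangentBundle (𝓡 m) M)) J

/-- The tension field `τ(γ) = ∇_{γ'} γ'` of a curve. -/
def tension (g : RMetric m M) (γ : ℝ → M) (s : ℝ) : TangentSpace (𝓡 m) (γ s) :=
  covDerivAlong g γ (velocity γ) s

/-- The functional `δ₁ ∫ ‖dγ‖² + δ₂ ∫ ‖τ(γ)‖²` over the compact interval `[a, b]`. -/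
def sesquiEnergy (g : RMetric m M) (δ₁ δ₂ a b : ℝ) (γ : ℝ → M) : ℝ :=
  δ₁ * (∫ s in a..b, g.inner (γ s) (velocity γ s) (velocity γ s))
    + δ₂ * (∫ s in a..b, g.inner (γ s) (tension g γ s) (tension g γ s))

/-- The curve `γ : J → M` is interpolating sesqui-harmonic: on every compact interval
`[a, b] ⊆ J` it is a critical point of `sesquiEnergy` with respect to the smooth variations
`Γ ε`, `|ε| < ε₀`, of `γ` that are supported in `[a, b]`. -/
def IsInterpolatingSesquiHarmonic (g : RMetric m M) (δ₁ δ₂ : ℝ) (J : Set ℝ) (γ : ℝ → M) : Prop :=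
  ∀ a b : ℝ, a < b → Icc a b ⊆ J → ∀ ε₀ : ℝ, 0 < ε₀ → ∀ Γ : ℝ → ℝ → M,
    ContMDiffOn 𝓘(ℝ, ℝ × ℝ) (𝓡 m) ∞ (fun q : ℝ × ℝ => Γ q.1 q.2) (Ioo (-ε₀) ε₀ ×ˢ J) →
    (∀ s ∈ J, Γ 0 s = γ s) →
    (∀ ε ∈ Ioo (-ε₀) ε₀, ∀ s ∈ J \ Icc a b, Γ ε s = γ s) →
    HasDerivAt (fun ε => sesquiEnergy g δ₁ δ₂ a b (Γ ε)) 0 0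

/-- `γ : J → M` is a smooth curve parametrized by arc length which is a Frenet curve of osculating
order `r` with Frenet frame `E 1, …, E r` and curvatures `k 1, …, k (r - 1)`. -/
structure IsFrenetCurve (g : RMetric m M) (J : Set ℝ) (γ : ℝ → M) (r : ℕ)
    (E : ℕ → ∀ s, TangentSpace (𝓡 m) (γ s)) (k : ℕ → ℝ → ℝ) : Prop where
  one_le : 1 ≤ r
  smooth : ContMDiffOn 𝓘(ℝ, ℝ) (𝓡 m) ∞ γ J
  smooth_frame : ∀ i, 1 ≤ i → i ≤ r → SmoothAlong J γ (E i)
  smooth_curvature : ∀ i, 1 ≤ i → i < r → ContDiffOn ℝ ∞ (k i) J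
  orthonormal : ∀ i j, 1 ≤ i → i ≤ r → 1 ≤ j → j ≤ r → ∀ s ∈ J,
    g.inner (γ s) (E i s) (E j s) = if i = j then 1 else 0
  curvature_pos : ∀ i, 1 ≤ i → i < r → ∀ s ∈ J, 0 < k i s
  frame_one : ∀ s ∈ J, E 1 s = velocity γ s
  frenet_first : 2 ≤ r → ∀ s ∈ J, covDerivAlong g γ (E 1) s = k 1 s • E 2 s
  frenet_middle : ∀ i, 2 ≤ i → i < r → ∀ s ∈ J,
    covDerivAlong g γ (E i) s = -k (i - 1) s • E (i - 1) s + k i s • E (i + 1) s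
  frenet_last : 2 ≤ r → ∀ s ∈ J, covDerivAlong g γ (E r) s = -k (r - 1) s • E (r - 1) s
  frenet_geodesic : r = 1 → ∀ s ∈ J, covDerivAlong g γ (E 1) s = 0

end Riemannian

/-- An almost contact metric structure `(φ, ξ, η, g)` on a manifold of dimension `2n + 1`. -/
structure AlmostContactMetric (n : ℕ) (M : Type*) [TopologicalSpace M]
    [ChartedSpace (Model (2 * n + 1)) M] [IsManifold (𝓡 (2 * n + 1)) ∞ M] where
  g : RMetric (2 * n + 1) M
  φ : ∀ x : M, TangentSpace (𝓡 (2 * n + 1)) x →L[ℝ] TangentSpace (𝓡 (2 * n + 1)) x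
  ξ : ∀ x : M, TangentSpace (𝓡 (2 * n + 1)) x
  η : ∀ x : M, TangentSpace (𝓡 (2 * n + 1)) x →L[ℝ] ℝ
  smooth_φ : ContMDiff (𝓡 (2 * n + 1))
    ((𝓡 (2 * n + 1)).prod 𝓘(ℝ, Model (2 * n + 1) →L[ℝ] Model (2 * n + 1))) ∞
    (fun x => TotalSpace.mk' (Model (2 * n + 1) →L[ℝ] Model (2 * n + 1))
      (E := fun x : M =>
        TangentSpace (𝓡 (2 * n + 1)) x →L[ℝ] TangentSpace (𝓡 (2 * n + 1)) x) x (φ x))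
  smooth_ξ : ContMDiff (𝓡 (2 * n + 1)) (𝓡 (2 * n + 1)).tangent ∞
    (fun x => (⟨x, ξ x⟩ : TangentBundle (𝓡 (2 * n + 1)) M))
  smooth_η : ContMDiff (𝓡 (2 * n + 1)) ((𝓡 (2 * n + 1)).prod 𝓘(ℝ, Model (2 * n + 1) →L[ℝ] ℝ)) ∞
    (fun x => TotalSpace.mk' (Model (2 * n + 1) →L[ℝ] ℝ)
      (E := fun x : M => TangentSpace (𝓡 (2 * n + 1)) x →L[ℝ] Bundle.Trivial M ℝ x) x (η x))
  φ_φ : ∀ x v, φ x (φ x v) = -v + η x v • ξ x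
  η_ξ : ∀ x, η x (ξ x) = 1
  compatible : ∀ x v w, g.inner x (φ x v) (φ x w) = g.inner x v w - η x v * η x w

namespace AlmostContactMetric

variable {n : ℕ} {M : Type*} [TopologicalSpace M] [ChartedSpace (Model (2 * n + 1)) M]
  [IsManifold (𝓡 (2 * n + 1)) ∞ M] (S : AlmostContactMetric n M)

/-- The one-form `η` in the coordinates of the preferred chart around `p`. -/
def ηCoord (p : M) (y : Model (2 * n + 1)) : Model (2 * n + 1) →L[ℝ] ℝ :=
  (S.η (coordPoint p y)).comp (coordFrame p (coordPoint p y))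

/-- The tensor field `φ` in the coordinates of the preferred chart around `p`. -/
def φCoord (p : M) (y : Model (2 * n + 1)) : Model (2 * n + 1) →L[ℝ] Model (2 * n + 1) :=
  (coordRep p (coordPoint p y)).comp
    ((S.φ (coordPoint p y)).comp (coordFrame p (coordPoint p y)))

/-- The exterior derivative `dη(X, Y) = (X η(Y) - Y η(X) - η([X, Y])) / 2`, computed on the vector
fields that are constant in the coordinates. -/
def dη (x : M) (u v : TangentSpace (𝓡 (2 * n + 1)) x) : ℝ :=
  (1 / 2 : ℝ) * (fderiv ℝ (S.ηCoord x) (coordCenter x) (coordRep x x u) (coordRep x x v)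
    - fderiv ℝ (S.ηCoord x) (coordCenter x) (coordRep x x v) (coordRep x x u))

/-- The Nijenhuis tensor `N(X, Y) = φ²[X, Y] + [φX, φY] - φ[φX, Y] - φ[X, φY]` of `φ`, computed on
the vector fields that are constant in the coordinates, for which `[X, Y] = 0`,
`[φX, φY] = (D_{φX} φ) Y - (D_{φY} φ) X`, `[φX, Y] = -(D_Y φ) X` and `[X, φY] = (D_X φ) Y`. -/
def nijenhuis (x : M) (u v : TangentSpace (𝓡 (2 * n + 1)) x) : TangentSpace (𝓡 (2 * n + 1)) x :=
  let y := coordCenter x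
  let X := coordRep x x u
  let Y := coordRep x x v
  let F := S.φCoord x
  coordFrame x x (fderiv ℝ F y (F y X) Y - fderiv ℝ F y (F y Y) X
    + F y (fderiv ℝ F y Y X) - F y (fderiv ℝ F y X Y))

/-- Contact metric structures: `dη(X, Y) = g(X, φY)`. -/
def IsContactMetric : Prop :=
  ∀ x u v, S.dη x u v = S.g.inner x u (S.φ x v)

/-- Normal structures: `N_φ = -2 dη ⊗ ξ`. -/
def IsNormal : Prop :=
  ∀ x u v, S.nijenhuis x u v = -(2 * S.dη x u v) • S.ξ x

/-- Sasakian structures are the normal contact metric structures. -/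
def IsSasakian : Prop := S.IsContactMetric ∧ S.IsNormal

/-- Sasakian space forms `M(c)`: the sectional curvature `g(R(X, φX)φX, X)` of every `φ`-section,
spanned by `X` and `φX` with `X` a unit vector orthogonal to `ξ`, is `c`. -/
def IsSasakianSpaceForm (c : ℝ) : Prop :=
  S.IsSasakian ∧ ∀ (x : M) (v : TangentSpace (𝓡 (2 * n + 1)) x),
    S.g.inner x v (S.ξ x) = 0 → S.g.inner x v v = 1 →
    S.g.inner x (curvature S.g x v (S.φ x v) (S.φ x v)) v = c

/-- `γ : J → M` is an integral curve of the distribution `η = 0`. -/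
def IsLegendre (J : Set ℝ) (γ : ℝ → M) : Prop :=
  ∀ s ∈ J, S.η (γ s) (velocity γ s) = 0

end AlmostContactMetric

end

/-! The first variation of the functional in direction `V` is `2 ∫ g(V, EL) ds`, where `EL = δ₂ (∇_T
∇_T τ + R(τ, T)T) - δ₁ τ`, so criticality on all compact intervals means `EL = 0` on `J`. On a
Sasakian space form, `R(Y, T)T = (c+3)/4 Y + 3(c-1)/4 g(Y, φT) φT` for a unit vector `T` orthogonal
to `ξ` and any `Y` orthogonal to `ξ` and `T`. This applies to `Y = τ = k₁ E₂`: differentiating `g(T,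
ξ) = 0` with `∇ξ = -φ` gives `η(E₂) = 0`.

By the Frenet equations `EL = 0` becomes a linear relation between `E₁, …, E₄` and `φT`. The
coefficient `k₁ k₂ k₃` of `E₄` is positive because `r ≥ 4`; pairing with `E₄` therefore forces the
coefficient of `φT` to be nonzero, and `φT`, which is orthogonal to `E₁`, lies in the span of `E₂,
E₃, E₄`. The `E₁` component reads `k₁ k₁' = 0`, so `k₁` is constant on the interval; the other three
components, divided by `k₁`, are the stated equations. All these steps can be reversed
(`combination_eq_zero_iff`).

The supporting theory has three layers. Local Riemannian geometry is done for metrics on open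
subsets of a vector space and moved between charts by naturality (`christoffelL_pullback`,
`coordRep_covDerivAlong`). The variational part is `hasDerivAt_sesquiEnergy` and
`isInterpolatingSesquiHarmonic_iff`.

For the curvature formula, the contact condition and normality determine `(∇_X φ)Y = g(X, Y)ξ -
η(Y)X` and `∇ξ = -φ` (`IsContactAlgebra.sasakian`). Ricci identities then give `R(X, Y)ξ` and the
commutator of `R(X, Y)` with `φ`. Constancy of the `φ`-sectional curvature fixes the rest
(`IsContactAlgebra.curvature_eq`), since a Kähler-type tensor with zero holomorphic sectional
curvature has zero sectional curvature. -/

noncomputable section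

set_option linter.unusedSectionVars false

/-! ### The Levi-Civita connection of a metric on an open set of a vector space -/

section Coordinates

/-- Identifying `H` with `ℝᵈ` turns an operator into the `d`-tuple of its values on a basis.
Smoothness of tensor fields is obtained from their components this way. -/
theorem contDiffAt_clm_apply_iff {G H K : Type*} [NormedAddCommGroup G] [NormedSpace ℝ G]
    [NormedAddCommGroup H] [NormedSpace ℝ H] [NormedAddCommGroup K] [NormedSpace ℝ K]
    [FiniteDimensional ℝ H] {n : WithTop ℕ∞} {f : G → H →L[ℝ] K} {x : G} :
    ContDiffAt ℝ n f x ↔ ∀ v, ContDiffAt ℝ n (fun z => f z v) x := by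
  refine ⟨fun h v => h.clm_apply contDiffAt_const, fun h => ?_⟩
  let d := Module.finrank ℝ H
  have hd : d = Module.finrank ℝ (Fin d → ℝ) := (Module.finrank_fin_fun ℝ).symm
  let e₁ := ContinuousLinearEquiv.ofFinrankEq hd
  let e₂ := (e₁.arrowCongr (1 : K ≃L[ℝ] K)).trans (ContinuousLinearEquiv.piRing (Fin d))
  rw [← Function.id_comp f, ← e₂.symm_comp_self]
  exact e₂.symm.contDiff.contDiffAt.comp x (contDiffAt_pi.mpr fun i => h _)

variable {F : Type*} [NormedAddCommGroup F] [NormedSpace ℝ F]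

instance normedAddCommGroupDual : NormedAddCommGroup (F →L[ℝ] ℝ) := inferInstance
instance normedAddCommGroupBilin : NormedAddCommGroup (F →L[ℝ] F →L[ℝ] ℝ) := inferInstance
instance normedSpaceBilin : NormedSpace ℝ (F →L[ℝ] F →L[ℝ] ℝ) := inferInstance
instance normedAddCommGroupEnd : NormedAddCommGroup (F →L[ℝ] F) := inferInstance
instance normedSpaceEnd : NormedSpace ℝ (F →L[ℝ] F) := inferInstance

/-- The one-form `w ↦ (D_u h(v, w) + D_v h(u, w) - D_w h(u, v)) / 2`. -/
def koszul (h : F → F →L[ℝ] F →L[ℝ] ℝ) (y u v : F) : F →L[ℝ] ℝ :=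
  (1 / 2 : ℝ) • (fderiv ℝ h y u v + fderiv ℝ h y v u - ((fderiv ℝ h y).flip u).flip v)

theorem koszul_apply (h : F → F →L[ℝ] F →L[ℝ] ℝ) (y u v w : F) :
    koszul h y u v w = (1 / 2 : ℝ) *
      (fderiv ℝ h y u v w + fderiv ℝ h y v u w - fderiv ℝ h y w u v) := by
  simp [koszul]

variable [FiniteDimensional ℝ F]

/-- The Christoffel symbols of a coordinate metric as a bilinear map. -/
def christoffelL (h : F → F →L[ℝ] F →L[ℝ] ℝ) (y : F) : F →L[ℝ] F →L[ℝ] F :=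
  LinearMap.toContinuousLinearMap
    { toFun := fun u => LinearMap.toContinuousLinearMap
        { toFun := fun v => (h y).inverse (koszul h y u v)
          map_add' := fun v v' => by
            rw [← map_add]; congr 1; ext w; simp only [koszul_apply, map_add,
              add_apply]; ring
          map_smul' := fun a v => by
            rw [← map_smul]; congr 1; ext w; simp only [koszul_apply, map_smul,
              smul_apply, RingHom.id_apply, smul_eq_mul]; ring }
      map_add' := fun u u' => by
        ext v
        simp only [LinearMap.coe_toContinuousLinearMap', LinearMap.coe_mk, AddHom.coe_mk,
          add_apply]
        rw [← map_add]; congr 1; ext w; simp only [koszul_apply, map_add,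
          add_apply]; ring
      map_smul' := fun a u => by
        ext v
        simp only [LinearMap.coe_toContinuousLinearMap', LinearMap.coe_mk, AddHom.coe_mk,
          smul_apply, RingHom.id_apply]
        rw [← map_smul]; congr 1; ext w; simp only [koszul_apply, map_smul,
          smul_apply, smul_eq_mul]; ring }

theorem christoffelL_apply (h : F → F →L[ℝ] F →L[ℝ] ℝ) (y u v : F) :
    christoffelL h y u v = (h y).inverse (koszul h y u v) := rfl

/-- The curvature tensor of a coordinate metric. -/
def curv (h : F → F →L[ℝ] F →L[ℝ] ℝ) (y u v w : F) : F :=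
  fderiv ℝ (christoffelL h) y u v w - fderiv ℝ (christoffelL h) y v u w
    + christoffelL h y u (christoffelL h y v w) - christoffelL h y v (christoffelL h y u w)

/-- `h` is a smooth Riemannian metric on the open set `U` of the coordinate space. -/
structure IsMetricOn (h : F → F →L[ℝ] F →L[ℝ] ℝ) (U : Set F) : Prop where
  isOpen : IsOpen U
  contDiffAt : ∀ y ∈ U, ContDiffAt ℝ ∞ h y
  symm : ∀ y ∈ U, ∀ u v, h y u v = h y v u
  pos : ∀ y ∈ U, ∀ u, u ≠ 0 → 0 < h y u u

theorem ContDiffAt.fderiv_infty {G H : Type*} [NormedAddCommGroup G] [NormedSpace ℝ G]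
    [NormedAddCommGroup H] [NormedSpace ℝ H] {f : G → H} {x : G} (hf : ContDiffAt ℝ ∞ f x) :
    ContDiffAt ℝ ∞ (fderiv ℝ f) x :=
  hf.fderiv_right (by simp)

theorem ContDiffAt.differentiableAt_infty {G H : Type*} [NormedAddCommGroup G] [NormedSpace ℝ G]
    [NormedAddCommGroup H] [NormedSpace ℝ H] {f : G → H} {x : G} (hf : ContDiffAt ℝ ∞ f x) :
    DifferentiableAt ℝ f x :=
  hf.differentiableAt (by simp)

theorem ContDiffAt.eventually_differentiableAt {G H : Type*} [NormedAddCommGroup G]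
    [NormedSpace ℝ G] [NormedAddCommGroup H] [NormedSpace ℝ H] {f : G → H} {x : G}
    (hf : ContDiffAt ℝ ∞ f x) : ∀ᶠ z in nhds x, DifferentiableAt ℝ f z := by
  filter_upwards [(hf.of_le (m := 1) (by simp)).eventually (by simp)] with z hz
  exact hz.differentiableAt (by simp)

theorem ContDiffAt.fderiv_fderiv_symm {G H : Type*} [NormedAddCommGroup G] [NormedSpace ℝ G]
    [NormedAddCommGroup H] [NormedSpace ℝ H] {f : G → H} {x : G} (hf : ContDiffAt ℝ ∞ f x)
    (u v : G) : fderiv ℝ (fderiv ℝ f) x u v = fderiv ℝ (fderiv ℝ f) x v u := by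
  have := (hf.of_le (m := 2) (WithTop.coe_le_coe.2 le_top : ((2 : ℕ∞) : WithTop ℕ∞) ≤ _)).isSymmSndFDerivAt (by simp)
  exact this u v

namespace IsMetricOn

variable {h : F → F →L[ℝ] F →L[ℝ] ℝ} {U : Set F} {y : F}

theorem isInvertible (H : IsMetricOn h U) (hy : y ∈ U) : (h y).IsInvertible := by
  have hinj : Function.Injective (h y) := by
    rw [injective_iff_map_eq_zero]
    intro u hu
    by_contra hne
    have := H.pos y hy u hne
    simp [hu] at this
  have hfin : Module.finrank ℝ F = Module.finrank ℝ (F →L[ℝ] ℝ) := by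
    rw [LinearMap.toContinuousLinearMap.symm.finrank_eq]
    exact (Subspace.dual_finrank_eq (K := ℝ) (V := F)).symm
  let e : F ≃ₗ[ℝ] (F →L[ℝ] ℝ) :=
    LinearEquiv.ofInjectiveOfFinrankEq (h y : F →ₗ[ℝ] (F →L[ℝ] ℝ)) hinj hfin
  refine ⟨e.toContinuousLinearEquiv, ?_⟩
  ext u v
  rfl

theorem eq_of_forall (H : IsMetricOn h U) (hy : y ∈ U) {a b : F}
    (hab : ∀ w, h y a w = h y b w) : a = b :=
  (H.isInvertible hy).injective (ContinuousLinearMap.ext hab)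

theorem christoffelL_spec (H : IsMetricOn h U) (hy : y ∈ U) (u v w : F) :
    h y (christoffelL h y u v) w = (1 / 2 : ℝ) *
      (fderiv ℝ h y u v w + fderiv ℝ h y v u w - fderiv ℝ h y w u v) := by
  rw [christoffelL_apply, (H.isInvertible hy).self_apply_inverse, koszul_apply]

theorem fderiv_symm (H : IsMetricOn h U) (hy : y ∈ U) (w u v : F) :
    fderiv ℝ h y w u v = fderiv ℝ h y w v u := by
  have hd := (H.contDiffAt y hy).differentiableAt_infty
  have h1 : ∀ a b : F, fderiv ℝ (fun z => h z a b) y w = fderiv ℝ h y w a b := by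
    intro a b
    have := (hd.hasFDerivAt.clm_apply (hasFDerivAt_const a y)).clm_apply (hasFDerivAt_const b y)
    rw [this.fderiv]; simp
  rw [← h1 u v, ← h1 v u]
  have : (fun z => h z u v) =ᶠ[nhds y] fun z => h z v u := by
    filter_upwards [H.isOpen.mem_nhds hy] with z hz using H.symm z hz u v
  rw [this.fderiv_eq]

theorem christoffelL_symm (H : IsMetricOn h U) (hy : y ∈ U) (u v : F) :
    christoffelL h y u v = christoffelL h y v u := by
  refine H.eq_of_forall hy fun w => ?_
  rw [H.christoffelL_spec hy, H.christoffelL_spec hy, H.fderiv_symm hy w u v]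
  ring

/-- Metric compatibility, `∇h = 0`: in the sum of the two Koszul expressions every term but `D_w
h(u, v)` cancels. -/
theorem fderiv_eq (H : IsMetricOn h U) (hy : y ∈ U) (w u v : F) :
    fderiv ℝ h y w u v = h y (christoffelL h y w u) v + h y u (christoffelL h y w v) := by
  rw [H.symm y hy u, H.christoffelL_spec hy, H.christoffelL_spec hy, H.fderiv_symm hy w v u,
    H.fderiv_symm hy u w v]
  ring

theorem contDiffAt_christoffelL (H : IsMetricOn h U) (hy : y ∈ U) :
    ContDiffAt ℝ ∞ (christoffelL h) y := by
  have h0 := H.contDiffAt y hy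
  have h1 := h0.fderiv_infty
  have happ : ∀ a b c : F, ContDiffAt ℝ ∞ (fun z => fderiv ℝ h z a b c) y := fun a b c =>
    ((h1.clm_apply contDiffAt_const).clm_apply contDiffAt_const).clm_apply contDiffAt_const
  have hk : ∀ u v, ContDiffAt ℝ ∞ (fun z => koszul h z u v) y := by
    intro u v
    refine contDiffAt_clm_apply_iff.2 fun w => ?_
    simp only [koszul_apply]
    exact contDiffAt_const.mul (((happ u v w).add (happ v u w)).sub (happ w u v))
  have hinv : ContDiffAt ℝ ∞ (fun z => (h z).inverse) y := by
    obtain ⟨e, he⟩ := H.isInvertible hy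
    have := contDiffAt_map_inverse (n := ∞) e
    rw [he] at this
    exact this.comp y h0
  refine contDiffAt_clm_apply_iff.2 fun u => contDiffAt_clm_apply_iff.2 fun v => ?_
  simp only [christoffelL_apply]
  exact hinv.clm_apply (hk u v)

end IsMetricOn

end Coordinates

/-! ### Symmetries of the curvature tensor -/

section Coordinates

variable {F : Type*} [NormedAddCommGroup F] [NormedSpace ℝ F] [FiniteDimensional ℝ F]

theorem fderiv_clm_apply₂ {G H K L : Type*} [NormedAddCommGroup G] [NormedSpace ℝ G]
    [NormedAddCommGroup H] [NormedSpace ℝ H] [NormedAddCommGroup K] [NormedSpace ℝ K]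
    [NormedAddCommGroup L] [NormedSpace ℝ L]
    {A : G → H →L[ℝ] K →L[ℝ] L} {X : G → H} {Z : G → K} {q : G}
    (hA : DifferentiableAt ℝ A q) (hX : DifferentiableAt ℝ X q) (hZ : DifferentiableAt ℝ Z q)
    (d : G) :
    fderiv ℝ (fun z => A z (X z) (Z z)) q d
      = fderiv ℝ A q d (X q) (Z q) + A q (fderiv ℝ X q d) (Z q) + A q (X q) (fderiv ℝ Z q d) := by
  have := (hA.hasFDerivAt.clm_apply hX.hasFDerivAt).clm_apply hZ.hasFDerivAt
  rw [this.fderiv]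
  simp
  abel

namespace IsMetricOn

variable {h : F → F →L[ℝ] F →L[ℝ] ℝ} {U : Set F} {y : F}

/-- Metric compatibility differentiated once more. Written through the Christoffel symbols, the
symmetry of `D²h` becomes a statement about curvature. -/
theorem fderiv_fderiv_eq (H : IsMetricOn h U) (hy : y ∈ U) (a b u v : F) :
    fderiv ℝ (fderiv ℝ h) y a b u v
      = h y (fderiv ℝ (christoffelL h) y a b u) v + h y u (fderiv ℝ (christoffelL h) y a b v)
        + (h y (christoffelL h y a (christoffelL h y b u)) v
          + h y (christoffelL h y b u) (christoffelL h y a v))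
        + (h y (christoffelL h y a u) (christoffelL h y b v)
          + h y u (christoffelL h y a (christoffelL h y b v))) := by
  have hh := (H.contDiffAt y hy).differentiableAt_infty
  have hD := (H.contDiffAt y hy).fderiv_infty.differentiableAt_infty
  have hC := (H.contDiffAt_christoffelL hy).differentiableAt_infty
  have hc : ∀ c d : F, DifferentiableAt ℝ (fun z => christoffelL h z c d) y := fun c d =>
    (hC.clm_apply (differentiableAt_const c)).clm_apply (differentiableAt_const d)
  have hc' : ∀ c d : F, fderiv ℝ (fun z => christoffelL h z c d) y a
      = fderiv ℝ (christoffelL h) y a c d := fun c d => by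
    rw [fderiv_clm_apply₂ hC (differentiableAt_const c) (differentiableAt_const d)]; simp
  have hl : fderiv ℝ (fun z => fderiv ℝ h z b u v) y a = fderiv ℝ (fderiv ℝ h) y a b u v := by
    rw [fderiv_clm_apply₂ (hD.clm_apply (differentiableAt_const b)) (differentiableAt_const u)
      (differentiableAt_const v), (hD.hasFDerivAt.clm_apply (hasFDerivAt_const b y)).fderiv]
    simp
  have he : (fun z => fderiv ℝ h z b u v) =ᶠ[nhds y]
      fun z => h z (christoffelL h z b u) v + h z u (christoffelL h z b v) := by
    filter_upwards [H.isOpen.mem_nhds hy] with z hz using H.fderiv_eq hz b u v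
  rw [← hl, he.fderiv_eq, fderiv_fun_add
    ((hh.clm_apply (hc b u)).clm_apply (differentiableAt_const v))
    ((hh.clm_apply (differentiableAt_const u)).clm_apply (hc b v)), add_apply,
    fderiv_clm_apply₂ hh (hc b u) (differentiableAt_const v),
    fderiv_clm_apply₂ hh (differentiableAt_const u) (hc b v), hc', hc',
    H.fderiv_eq hy a, H.fderiv_eq hy a]
  simp
  ring

/-- Antisymmetrizing `D²h` in `a, b` gives zero on one side and, on the other, `h(R(a, b)u, v) +
h(u, R(a, b)v)`; the mixed products of Christoffel symbols cancel. -/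
theorem curv_skew (H : IsMetricOn h U) (hy : y ∈ U) (a b u v : F) :
    h y (curv h y a b u) v = -h y u (curv h y a b v) := by
  have hs := (H.contDiffAt y hy).fderiv_fderiv_symm a b
  have := congrArg (fun L => L u v) hs
  simp only [H.fderiv_fderiv_eq hy] at this
  simp only [curv, map_add, map_sub, add_apply, sub_apply]
  linarith

theorem curv_antisymm (y a b u : F) : curv h y a b u = -curv h y b a u := by
  simp only [curv]; abel

theorem fderiv_christoffelL_symm (H : IsMetricOn h U) (hy : y ∈ U) (a u v : F) :
    fderiv ℝ (christoffelL h) y a u v = fderiv ℝ (christoffelL h) y a v u := by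
  have hC := (H.contDiffAt_christoffelL hy).differentiableAt_infty
  have hc' : ∀ c d : F, fderiv ℝ (fun z => christoffelL h z c d) y a
      = fderiv ℝ (christoffelL h) y a c d := fun c d => by
    rw [fderiv_clm_apply₂ hC (differentiableAt_const c) (differentiableAt_const d)]; simp
  rw [← hc' u v, ← hc' v u]
  have : (fun z => christoffelL h z u v) =ᶠ[nhds y] fun z => christoffelL h z v u := by
    filter_upwards [H.isOpen.mem_nhds hy] with z hz using H.christoffelL_symm hz u v
  rw [this.fderiv_eq]

theorem curv_bianchi (H : IsMetricOn h U) (hy : y ∈ U) (a b c : F) :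
    curv h y a b c + curv h y b c a + curv h y c a b = 0 := by
  simp only [curv, H.christoffelL_symm hy c, H.christoffelL_symm hy b a,
    H.fderiv_christoffelL_symm hy a c b,
    H.fderiv_christoffelL_symm hy b c a, H.fderiv_christoffelL_symm hy c b a]
  abel

theorem curv_pair_symm (H : IsMetricOn h U) (hy : y ∈ U) (a b c d : F) :
    h y (curv h y a b c) d = h y (curv h y c d a) b := by
  have B : ∀ a b c d, h y (curv h y a b c) d + h y (curv h y b c a) d
      + h y (curv h y c a b) d = 0 := by
    intro a b c d
    have := congrArg (fun z => h y z d) (H.curv_bianchi hy a b c)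
    simpa using this
  have S : ∀ a b c d, h y (curv h y a b c) d = -h y (curv h y a b d) c := by
    intro a b c d
    rw [H.curv_skew hy, H.symm y hy]
  have A : ∀ a b c d, h y (curv h y a b c) d = -h y (curv h y b a c) d := by
    intro a b c d
    rw [curv_antisymm]; simp
  -- The octahedron argument: the four Bianchi identities combine, modulo skewness in each pair, to
  -- the pair symmetry.
  linarith [B a b c d, B b c d a, B c d a b, B d a b c, S a b c d, S b c d a, S c d a b, S d a b c,
    S b c a d, S c a b d, S c d b a, S d b c a, S d a c b, S a c d b, S a b d c, S b d a c,
    A a b c d, A b c d a, A c d a b, A d a b c, A c a b d, A b d c a, A c a d b, A b d a c,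
    A a c b d, A d b a c, A a d c b]

end IsMetricOn

end Coordinates

/-! ### Change of coordinates and covariant derivatives along maps -/

section Coordinates

variable {F : Type*} [NormedAddCommGroup F] [NormedSpace ℝ F] [FiniteDimensional ℝ F]

/-- Differentiating `h' = ψ*h` produces terms in `D²ψ`; in the Koszul combination their symmetry
leaves a single one, paired with `Dψ w`. Surjectivity of `Dψ` makes such test vectors sufficient.
This is what allows derivatives defined in a chart that moves with the point to be computed in one
fixed chart. -/
theorem IsMetricOn.christoffelL_pullback {h h' : F → F →L[ℝ] F →L[ℝ] ℝ} {U U' : Set F}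
    (H : IsMetricOn h U) (H' : IsMetricOn h' U') {ψ : F → F} {y : F} (hy : y ∈ U')
    (hψy : ψ y ∈ U) (hψ : ContDiffAt ℝ ∞ ψ y)
    (hpull : ∀ᶠ z in nhds y, ∀ u v, h' z u v = h (ψ z) (fderiv ℝ ψ z u) (fderiv ℝ ψ z v))
    (hsurj : Function.Surjective (fderiv ℝ ψ y)) (u v : F) :
    fderiv ℝ ψ y (christoffelL h' y u v)
      = fderiv ℝ (fderiv ℝ ψ) y u v
        + christoffelL h (ψ y) (fderiv ℝ ψ y u) (fderiv ℝ ψ y v) := by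
  have hψd := hψ.differentiableAt_infty
  have hDψ := hψ.fderiv_infty.differentiableAt_infty
  have hh := (H.contDiffAt _ hψy).differentiableAt_infty
  have hh' := (H'.contDiffAt _ hy).differentiableAt_infty
  have hc : ∀ a w : F, fderiv ℝ (fun z => fderiv ℝ ψ z a) y w = fderiv ℝ (fderiv ℝ ψ) y w a := by
    intro a w
    rw [(hDψ.hasFDerivAt.clm_apply (hasFDerivAt_const a y)).fderiv]; simp
  have key : ∀ w a b, fderiv ℝ h' y w a b
      = fderiv ℝ h (ψ y) (fderiv ℝ ψ y w) (fderiv ℝ ψ y a) (fderiv ℝ ψ y b)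
        + h (ψ y) (fderiv ℝ (fderiv ℝ ψ) y w a) (fderiv ℝ ψ y b)
        + h (ψ y) (fderiv ℝ ψ y a) (fderiv ℝ (fderiv ℝ ψ) y w b) := by
    intro w a b
    have h1 : fderiv ℝ (fun z => h' z a b) y w = fderiv ℝ h' y w a b := by
      rw [fderiv_clm_apply₂ hh' (differentiableAt_const a) (differentiableAt_const b)]; simp
    have h2 : (fun z => h' z a b) =ᶠ[nhds y]
        fun z => (h ∘ ψ) z (fderiv ℝ ψ z a) (fderiv ℝ ψ z b) := by
      filter_upwards [hpull] with z hz using hz a b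
    rw [← h1, h2.fderiv_eq, fderiv_clm_apply₂ (hh.comp y hψd)
      (hDψ.clm_apply (differentiableAt_const a)) (hDψ.clm_apply (differentiableAt_const b)),
      hc, hc, fderiv_comp y hh hψd]
    rfl
  have hs := hψ.fderiv_fderiv_symm
  refine H.eq_of_forall hψy fun w => ?_
  obtain ⟨w, rfl⟩ := hsurj w
  have h0 : h (ψ y) (fderiv ℝ ψ y (christoffelL h' y u v)) (fderiv ℝ ψ y w)
      = h' y (christoffelL h' y u v) w := (hpull.self_of_nhds _ _).symm
  rw [h0, H'.christoffelL_spec hy, map_add, add_apply, H.christoffelL_spec hψy, key, key, key,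
    hs u w, hs v w, hs v u, H.symm _ hψy (fderiv ℝ ψ y u), H.symm _ hψy (fderiv ℝ ψ y v)]
  ring

variable {P : Type*} [NormedAddCommGroup P] [NormedSpace ℝ P]

/-- The covariant derivative in direction `d` of a vector field `X` along a map `Y`. -/
def covD (h : F → F →L[ℝ] F →L[ℝ] ℝ) (Y X : P → F) (d q : P) : F :=
  fderiv ℝ X q d + christoffelL h (Y q) (fderiv ℝ Y q d) (X q)

theorem covD_congr (h : F → F →L[ℝ] F →L[ℝ] ℝ) {Y Y' X X' : P → F} {q : P}
    (hY : Y =ᶠ[nhds q] Y') (hX : X =ᶠ[nhds q] X') (d : P) :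
    covD h Y X d q = covD h Y' X' d q := by
  simp only [covD, hY.fderiv_eq, hX.fderiv_eq, hY.self_of_nhds, hX.self_of_nhds]

theorem covD_covD_congr (h : F → F →L[ℝ] F →L[ℝ] ℝ) {Y Y' X X' : P → F} {q : P}
    (hY : Y =ᶠ[nhds q] Y') (hX : X =ᶠ[nhds q] X') (d : P) :
    covD h Y X d =ᶠ[nhds q] covD h Y' X' d := by
  filter_upwards [hY.eventuallyEq_nhds, hX.eventuallyEq_nhds] with z h1 h2
  exact covD_congr h h1 h2 d

theorem fderiv_apply_fderiv {X : P → F} {q : P} (hX : ContDiffAt ℝ ∞ X q) (a b : P) :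
    fderiv ℝ (fun z => fderiv ℝ X z b) q a = fderiv ℝ (fderiv ℝ X) q a b := by
  rw [(hX.fderiv_infty.differentiableAt_infty.hasFDerivAt.clm_apply
    (hasFDerivAt_const b q)).fderiv]
  simp

namespace IsMetricOn

variable {h : F → F →L[ℝ] F →L[ℝ] ℝ} {U : Set F} {Y X Z : P → F} {q : P}

theorem contDiffAt_covD (H : IsMetricOn h U) (hq : Y q ∈ U) (hY : ContDiffAt ℝ ∞ Y q)
    (hX : ContDiffAt ℝ ∞ X q) (d : P) : ContDiffAt ℝ ∞ (covD h Y X d) q := by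
  unfold covD
  exact (hX.fderiv_infty.clm_apply contDiffAt_const).add
    ((((H.contDiffAt_christoffelL hq).comp q hY).clm_apply
      (hY.fderiv_infty.clm_apply contDiffAt_const)).clm_apply hX)

theorem contDiffAt_apply₂ (H : IsMetricOn h U) (hq : Y q ∈ U) (hY : ContDiffAt ℝ ∞ Y q)
    (hX : ContDiffAt ℝ ∞ X q) (hZ : ContDiffAt ℝ ∞ Z q) :
    ContDiffAt ℝ ∞ (fun z => h (Y z) (X z) (Z z)) q :=
  (((H.contDiffAt _ hq).comp q hY).clm_apply hX).clm_apply hZ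

theorem fderiv_inner (H : IsMetricOn h U) (hq : Y q ∈ U) (hY : DifferentiableAt ℝ Y q)
    (hX : DifferentiableAt ℝ X q) (hZ : DifferentiableAt ℝ Z q) (d : P) :
    fderiv ℝ (fun z => h (Y z) (X z) (Z z)) q d
      = h (Y q) (covD h Y X d q) (Z q) + h (Y q) (X q) (covD h Y Z d q) := by
  have hh := (H.contDiffAt _ hq).differentiableAt_infty
  have := fderiv_clm_apply₂ (A := h ∘ Y) (hh.comp q hY) hX hZ d
  rw [fderiv_comp q hh hY] at this
  refine this.trans ?_
  simp only [Function.comp_apply, ContinuousLinearMap.comp_apply, covD, map_add, add_apply,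
    H.fderiv_eq hq]
  ring

/-- The second derivatives of `X` and `Y` are symmetric and drop out, and the constant directions
`a, b` commute, so there is no bracket term. It is used on `ℝ × ℝ` for variations, and with `Y` the
identity as the Ricci identity. -/
theorem covD_covD_sub (H : IsMetricOn h U) (hq : Y q ∈ U) (hY : ContDiffAt ℝ ∞ Y q)
    (hX : ContDiffAt ℝ ∞ X q) (a b : P) :
    covD h Y (covD h Y X b) a q - covD h Y (covD h Y X a) b q
      = curv h (Y q) (fderiv ℝ Y q a) (fderiv ℝ Y q b) (X q) := by
  have hC := (H.contDiffAt_christoffelL hq).differentiableAt_infty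
  have hYd := hY.differentiableAt_infty
  have hXd := hX.differentiableAt_infty
  have key : ∀ c d : P, fderiv ℝ (covD h Y X c) q d = fderiv ℝ (fderiv ℝ X) q d c
      + (fderiv ℝ (christoffelL h) (Y q) (fderiv ℝ Y q d) (fderiv ℝ Y q c) (X q)
        + christoffelL h (Y q) (fderiv ℝ (fderiv ℝ Y) q d c) (X q)
        + christoffelL h (Y q) (fderiv ℝ Y q c) (fderiv ℝ X q d)) := by
    intro c d
    have hYc : DifferentiableAt ℝ (fun z => fderiv ℝ Y z c) q :=
      hY.fderiv_infty.differentiableAt_infty.clm_apply (differentiableAt_const c)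
    have hXc : DifferentiableAt ℝ (fun z => fderiv ℝ X z c) q :=
      hX.fderiv_infty.differentiableAt_infty.clm_apply (differentiableAt_const c)
    have hCY : DifferentiableAt ℝ (fun z => christoffelL h (Y z)) q := hC.comp q hYd
    have h1 : fderiv ℝ (fun z => christoffelL h (Y z)) q
        = (fderiv ℝ (christoffelL h) (Y q)).comp (fderiv ℝ Y q) := fderiv_comp q hC hYd
    unfold covD
    rw [fderiv_fun_add hXc ((hCY.clm_apply hYc).clm_apply hXd), add_apply,
      fderiv_clm_apply₂ hCY hYc hXd, h1, fderiv_apply_fderiv hX, fderiv_apply_fderiv hY]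
    rfl
  have hu : ∀ c d : P, covD h Y (covD h Y X c) d q = fderiv ℝ (covD h Y X c) q d
      + christoffelL h (Y q) (fderiv ℝ Y q d) (covD h Y X c q) := fun _ _ => rfl
  rw [hu, hu, key, key, hX.fderiv_fderiv_symm a b, hY.fderiv_fderiv_symm a b]
  simp only [covD, curv, map_add]
  abel

/-- The term `D²ψ` coming from differentiating the field `Dψ X` is the same one that occurs in the
transformation law of the Christoffel symbols. -/
theorem covD_pullback {h' : F → F →L[ℝ] F →L[ℝ] ℝ} {U' : Set F}
    (H : IsMetricOn h U) (H' : IsMetricOn h' U') {ψ : F → F} (hy : Y q ∈ U')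
    (hψy : ψ (Y q) ∈ U) (hψ : ContDiffAt ℝ ∞ ψ (Y q))
    (hpull : ∀ᶠ z in nhds (Y q), ∀ u v, h' z u v = h (ψ z) (fderiv ℝ ψ z u) (fderiv ℝ ψ z v))
    (hsurj : Function.Surjective (fderiv ℝ ψ (Y q))) (hY : DifferentiableAt ℝ Y q)
    (hX : DifferentiableAt ℝ X q) (d : P) :
    covD h (fun z => ψ (Y z)) (fun z => fderiv ℝ ψ (Y z) (X z)) d q
      = fderiv ℝ ψ (Y q) (covD h' Y X d q) := by
  have hψd := hψ.differentiableAt_infty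
  have hDψ := hψ.fderiv_infty.differentiableAt_infty
  have h1 : fderiv ℝ (fun z => ψ (Y z)) q d = fderiv ℝ ψ (Y q) (fderiv ℝ Y q d) := by
    have := fderiv_comp q hψd hY
    exact congrArg (fun L => L d) this
  have h2 : fderiv ℝ (fun z => fderiv ℝ ψ (Y z) (X z)) q d
      = fderiv ℝ (fderiv ℝ ψ) (Y q) (fderiv ℝ Y q d) (X q)
        + fderiv ℝ ψ (Y q) (fderiv ℝ X q d) := by
    have := ((hDψ.hasFDerivAt.comp q hY.hasFDerivAt).clm_apply hX.hasFDerivAt)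
    have h3 := congrArg (fun L => L d) this.fderiv
    refine h3.trans ?_
    simp [add_comm]
  rw [covD, covD, h1, h2, map_add, H.christoffelL_pullback H' hy hψy hψ hpull hsurj]
  abel

end IsMetricOn

theorem fderiv_line {H : Type*} [NormedAddCommGroup H] [NormedSpace ℝ H] {Y : P → H} {p d : P}
    {t : ℝ} (hY : DifferentiableAt ℝ Y (p + t • d)) :
    fderiv ℝ (fun s : ℝ => Y (p + s • d)) t 1 = fderiv ℝ Y (p + t • d) d := by
  have hl : HasFDerivAt (fun s : ℝ => p + s • d)
      ((ContinuousLinearMap.id ℝ ℝ).smulRight d) t :=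
    ((hasFDerivAt_id t).smul_const d).const_add p
  have h1 := congrArg (fun L => L (1 : ℝ)) (hY.hasFDerivAt.comp t hl).fderiv
  exact h1.trans (by simp)

/-- Restricting to a line: covariant differentiation along a curve in the parameter space. -/
theorem covD_line {h : F → F →L[ℝ] F →L[ℝ] ℝ} {Y X : P → F} {p d : P} {t : ℝ}
    (hY : DifferentiableAt ℝ Y (p + t • d)) (hX : DifferentiableAt ℝ X (p + t • d)) :
    covD h (fun s : ℝ => Y (p + s • d)) (fun s : ℝ => X (p + s • d)) 1 t
      = covD h Y X d (p + t • d) := by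
  rw [covD, covD, fderiv_line hY, fderiv_line hX]

end Coordinates

/-! ### Charts, coordinate frames and the metric in coordinates -/

section Riemannian

variable {m : ℕ} {M : Type*} [TopologicalSpace M] [ChartedSpace (Model m) M]
  [IsManifold (𝓡 m) ∞ M]

/-- The domain of the preferred chart around `p`. -/
def chartDom (p : M) : Set M := (extChartAt (𝓡 m) p).source

theorem chartDom_eq (p : M) : chartDom (m := m) p = (chartAt (Model m) p).source :=
  extChartAt_source (𝓡 m) p

theorem isOpen_chartDom (p : M) : IsOpen (chartDom (m := m) p) := isOpen_extChartAt_source p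

theorem mem_chartDom (p : M) : p ∈ chartDom (m := m) p := mem_extChartAt_source p

/-- The coordinates of `q` in the preferred chart around `p`. -/
def coordOf (p q : M) : Model m := extChartAt (𝓡 m) p q

/-- The range of the preferred chart around `p`. -/
def chartRange (p : M) : Set (Model m) := (extChartAt (𝓡 m) p).target

theorem isOpen_chartRange (p : M) : IsOpen (chartRange (m := m) p) := isOpen_extChartAt_target p

theorem coordOf_mem {p q : M} (hq : q ∈ chartDom (m := m) p) :
    coordOf p q ∈ chartRange (m := m) p :=
  (extChartAt (𝓡 m) p).map_source hq

theorem coordPoint_mem {p : M} {y : Model m} (hy : y ∈ chartRange (m := m) p) :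
    coordPoint p y ∈ chartDom (m := m) p :=
  (extChartAt (𝓡 m) p).map_target hy

theorem coordPoint_coordOf {p q : M} (hq : q ∈ chartDom (m := m) p) :
    coordPoint p (coordOf (m := m) p q) = q :=
  (extChartAt (𝓡 m) p).left_inv hq

theorem coordOf_coordPoint {p : M} {y : Model m} (hy : y ∈ chartRange (m := m) p) :
    coordOf p (coordPoint p y) = y :=
  (extChartAt (𝓡 m) p).right_inv hy

theorem contMDiffAt_coordOf {p q : M} (hq : q ∈ chartDom (m := m) p) :
    ContMDiffAt (𝓡 m) 𝓘(ℝ, Model m) ∞ (coordOf (m := m) p) q :=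
  contMDiffAt_extChartAt' (by rwa [chartDom_eq] at hq)

theorem contMDiffAt_coordPoint {p : M} {y : Model m} (hy : y ∈ chartRange (m := m) p) :
    ContMDiffAt 𝓘(ℝ, Model m) (𝓡 m) ∞ (coordPoint p : Model m → M) y :=
  (contMDiffOn_extChartAt_symm p).contMDiffAt ((isOpen_chartRange p).mem_nhds hy)

/-- The coordinate change from the preferred chart around `p'` to the one around `p`. -/
def transition (p p' : M) (y : Model m) : Model m := coordOf p (coordPoint p' y)

theorem contDiffAt_transition {p p' : M} {y : Model m} (hy : y ∈ chartRange (m := m) p')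
    (hy' : coordPoint p' y ∈ chartDom (m := m) p) : ContDiffAt ℝ ∞ (transition p p') y :=
  contMDiffAt_iff_contDiffAt.1
    ((contMDiffAt_coordOf hy').comp y (contMDiffAt_coordPoint hy))

theorem coordRep_eq_change {p q : M} (hq : q ∈ chartDom (m := m) p) :
    (coordRep p q : Model m →L[ℝ] Model m) = tangentCoordChange (𝓡 m) q p q :=
  TangentBundle.continuousLinearMapAt_trivializationAt_eq_core (by rwa [chartDom_eq] at hq)

theorem coordRep_coordFrame {p q : M} (hq : q ∈ chartDom (m := m) p) (v : Model m) :
    coordRep p q (coordFrame p q v) = v :=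
  (trivializationAt (Model m) (TangentSpace (𝓡 m)) p).continuousLinearMapAt_symmL
    (by rwa [chartDom_eq] at hq) v

theorem coordFrame_coordRep {p q : M} (hq : q ∈ chartDom (m := m) p) (v : TangentSpace (𝓡 m) q) :
    coordFrame p q (coordRep p q v) = v :=
  (trivializationAt (Model m) (TangentSpace (𝓡 m)) p).symmL_continuousLinearMapAt
    (by rwa [chartDom_eq] at hq) v

theorem coordRep_change {p p' q : M} (hq : q ∈ chartDom (m := m) p)
    (hq' : q ∈ chartDom (m := m) p') (v : TangentSpace (𝓡 m) q) :
    coordRep p q v = fderiv ℝ (transition p p') (coordOf p' q) (coordRep p' q v) := by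
  have h1 := tangentCoordChange_comp (I := 𝓡 m) (w := q) (x := p') (y := p) (z := q)
    (v := v) ⟨⟨mem_extChartAt_source q, hq'⟩, hq⟩
  rw [← coordRep_eq_change hq, ← coordRep_eq_change hq', tangentCoordChange_def] at h1
  refine h1.symm.trans ?_
  simp only [modelWithCornersSelf_coe, range_id, fderivWithin_univ]
  rfl

theorem coordRep_coordFrame_change {p p' q : M} (hq : q ∈ chartDom (m := m) p)
    (hq' : q ∈ chartDom (m := m) p') (v : Model m) :
    coordRep p q (coordFrame p' q v) = fderiv ℝ (transition p p') (coordOf p' q) v := by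
  rw [coordRep_change hq hq', coordRep_coordFrame hq']

theorem surjective_fderiv_transition {p p' q : M} (hq : q ∈ chartDom (m := m) p)
    (hq' : q ∈ chartDom (m := m) p') :
    Function.Surjective (fderiv ℝ (transition p p') (coordOf (m := m) p' q)) := fun v =>
  ⟨coordRep p' q (coordFrame p q v), by rw [← coordRep_change hq hq', coordRep_coordFrame hq]⟩

theorem trivializationAt_snd {p q : M} (hq : q ∈ chartDom (m := m) p) (v : TangentSpace (𝓡 m) q) :
    (trivializationAt (Model m) (TangentSpace (𝓡 m)) p
      (⟨q, v⟩ : TangentBundle (𝓡 m) M)).2 = coordRep p q v := by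
  rw [coordRep, Trivialization.continuousLinearMapAt_apply,
    Trivialization.coe_linearMapAt_of_mem _ (by rwa [chartDom_eq] at hq)]

/-- Smoothness of a vector field along a map, in coordinates. -/
theorem contMDiffAt_along_iff {EN HN N : Type*} [NormedAddCommGroup EN] [NormedSpace ℝ EN]
    [TopologicalSpace HN] {J : ModelWithCorners ℝ EN HN} [TopologicalSpace N] [ChartedSpace HN N]
    {Y : N → M} {X : ∀ z, TangentSpace (𝓡 m) (Y z)} {p : M} {q : N}
    (hq : Y q ∈ chartDom (m := m) p) :
    ContMDiffAt J (𝓡 m).tangent ∞ (fun z => (⟨Y z, X z⟩ : TangentBundle (𝓡 m) M)) q ↔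
      ContMDiffAt J (𝓡 m) ∞ Y q ∧
        ContMDiffAt J 𝓘(ℝ, Model m) ∞ (fun z => (coordRep p (Y z) (X z) : Model m)) q := by
  rw [(trivializationAt (Model m) (TangentSpace (𝓡 m)) p).contMDiffAt_iff (by
    rw [Trivialization.mem_source]; rwa [chartDom_eq] at hq)]
  refine and_congr_right fun hY => ?_
  refine Filter.EventuallyEq.contMDiffAt_iff ?_
  filter_upwards [hY.continuousAt.preimage_mem_nhds ((isOpen_chartDom p).mem_nhds hq)] with z hz
  exact trivializationAt_snd hz _

theorem contMDiffAt_scalar_section {f : M → ℝ} {q : M}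
    (hf : ContMDiffAt (𝓡 m) ((𝓡 m).prod 𝓘(ℝ, ℝ)) ∞
      (fun x => TotalSpace.mk' ℝ (E := Bundle.Trivial M ℝ) x (f x)) q) :
    ContMDiffAt (𝓡 m) 𝓘(ℝ, ℝ) ∞ f q := by
  rw [contMDiffAt_totalSpace] at hf
  exact hf.2

theorem contMDiffAt_coordFrame {p q : M} (hq : q ∈ chartDom (m := m) p) (v : Model m) :
    ContMDiffAt (𝓡 m) (𝓡 m).tangent ∞
      (fun x => (⟨x, coordFrame p x v⟩ : TangentBundle (𝓡 m) M)) q := by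
  refine (contMDiffAt_along_iff hq).2 ⟨contMDiffAt_id, ?_⟩
  refine (contMDiffAt_const (c := v)).congr_of_eventuallyEq ?_
  filter_upwards [(isOpen_chartDom p).mem_nhds hq] with x hx
  exact coordRep_coordFrame hx v

theorem metricCoord_apply (g : RMetric m M) (p : M) (y u v : Model m) :
    metricCoord g p y u v = g.inner (coordPoint p y) (coordFrame p (coordPoint p y) u)
      (coordFrame p (coordPoint p y) v) := rfl

theorem inner_eq_metricCoord (g : RMetric m M) {p q : M} (hq : q ∈ chartDom (m := m) p)
    (v w : TangentSpace (𝓡 m) q) :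
    g.inner q v w = metricCoord g p (coordOf p q) (coordRep p q v) (coordRep p q w) := by
  rw [metricCoord_apply]
  -- Going to coordinates and back returns `q` only up to a propositional equality, on which the
  -- tangent space depends; the point is generalized so that the equality can be eliminated.
  have : ∀ q', q' = q → g.inner q v w = g.inner q' (coordFrame p q' (coordRep p q v))
      (coordFrame p q' (coordRep p q w)) := by
    rintro _ rfl
    rw [coordFrame_coordRep hq, coordFrame_coordRep hq]
  exact this _ (coordPoint_coordOf hq)

theorem coordFrame_injective {p q : M} (hq : q ∈ chartDom (m := m) p) :
    Function.Injective (coordFrame (m := m) p q) :=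
  Function.LeftInverse.injective (coordRep_coordFrame hq)

theorem coordRep_injective {p q : M} (hq : q ∈ chartDom (m := m) p) :
    Function.Injective (coordRep (m := m) p q) :=
  Function.LeftInverse.injective (coordFrame_coordRep hq)

theorem isMetricOn_metricCoord (g : RMetric m M) (p : M) :
    IsMetricOn (metricCoord g p) (chartRange p) where
  isOpen := isOpen_chartRange p
  contDiffAt y hy := by
    refine contDiffAt_clm_apply_iff.2 fun u => contDiffAt_clm_apply_iff.2 fun v => ?_
    have hq := coordPoint_mem hy
    have h1 := ContMDiffAt.clm_bundle_apply₂ (F₃ := ℝ) (E₃ := Bundle.Trivial M ℝ)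
      (g.contMDiff (coordPoint p y)) (contMDiffAt_coordFrame hq u) (contMDiffAt_coordFrame hq v)
    exact contMDiffAt_iff_contDiffAt.1
      ((contMDiffAt_scalar_section h1).comp y (contMDiffAt_coordPoint hy))
  symm y _ u v := g.symm _ _ _
  pos y hy u hu := g.pos _ _ fun h0 =>
    hu (coordFrame_injective (coordPoint_mem hy) (h0.trans (map_zero _).symm))

theorem metricCoord_change (g : RMetric m M) {p p' : M} {y : Model m}
    (hy : y ∈ chartRange (m := m) p') (hy' : coordPoint p' y ∈ chartDom (m := m) p)
    (u v : Model m) :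
    metricCoord g p' y u v = metricCoord g p (transition p p' y)
      (fderiv ℝ (transition p p') y u) (fderiv ℝ (transition p p') y v) := by
  rw [metricCoord_apply, inner_eq_metricCoord g hy', coordRep_coordFrame_change hy'
    (coordPoint_mem hy), coordRep_coordFrame_change hy' (coordPoint_mem hy),
    coordOf_coordPoint hy]
  rfl

end Riemannian

/-! ### Covariant differentiation along curves, in any chart -/

section Riemannian

variable {m : ℕ} {M : Type*} [TopologicalSpace M] [ChartedSpace (Model m) M]
  [IsManifold (𝓡 m) ∞ M]

theorem christoffel_eq (g : RMetric m M) (p : M) (y u v : Model m) :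
    christoffel g p y u v = christoffelL (metricCoord g p) y u v := rfl

/-- The coordinates of a curve in the preferred chart around `p`. -/
def coordCurve (p : M) (γ : ℝ → M) (t : ℝ) : Model m := coordOf p (γ t)

/-- The components of a vector field along a curve in the preferred chart around `p`. -/
def coordField (p : M) (γ : ℝ → M) (V : ∀ s, TangentSpace (𝓡 m) (γ s)) (t : ℝ) : Model m :=
  coordRep p (γ t) (V t)

/-- `V` is a vector field along `γ` that is smooth at `s`. -/
def SmoothAlongAt (γ : ℝ → M) (V : ∀ s, TangentSpace (𝓡 m) (γ s)) (s : ℝ) : Prop :=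
  ContMDiffAt 𝓘(ℝ, ℝ) (𝓡 m).tangent ∞ (fun t => (⟨γ t, V t⟩ : TangentBundle (𝓡 m) M)) s

theorem SmoothAlong.smoothAlongAt {J : Set ℝ} {γ : ℝ → M} {V : ∀ s, TangentSpace (𝓡 m) (γ s)}
    (h : SmoothAlong J γ V) (hJ : IsOpen J) {s : ℝ} (hs : s ∈ J) : SmoothAlongAt γ V s :=
  h.contMDiffAt (hJ.mem_nhds hs)

theorem eventually_mem_chartDom {X : Type*} [TopologicalSpace X] {γ : X → M} {s : X} {p : M}
    (h : ContinuousAt γ s) (hp : γ s ∈ chartDom (m := m) p) :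
    ∀ᶠ t in nhds s, γ t ∈ chartDom (m := m) p :=
  h.preimage_mem_nhds ((isOpen_chartDom p).mem_nhds hp)

section

variable {γ : ℝ → M} {V W : ∀ s, TangentSpace (𝓡 m) (γ s)} {s : ℝ} {p : M}

theorem coordCurve_mem (hp : γ s ∈ chartDom (m := m) p) :
    coordCurve p γ s ∈ chartRange (m := m) p :=
  coordOf_mem hp

theorem contDiffAt_coordCurve (h : ContMDiffAt 𝓘(ℝ, ℝ) (𝓡 m) ∞ γ s)
    (hp : γ s ∈ chartDom (m := m) p) : ContDiffAt ℝ ∞ (coordCurve (m := m) p γ) s :=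
  contMDiffAt_iff_contDiffAt.1 ((contMDiffAt_coordOf hp).comp s h)

theorem smoothAlongAt_iff (hp : γ s ∈ chartDom (m := m) p) :
    SmoothAlongAt γ V s ↔ ContMDiffAt 𝓘(ℝ, ℝ) (𝓡 m) ∞ γ s ∧ ContDiffAt ℝ ∞ (coordField p γ V) s := by
  rw [SmoothAlongAt, contMDiffAt_along_iff hp, ← contMDiffAt_iff_contDiffAt]
  rfl

theorem SmoothAlongAt.curve (h : SmoothAlongAt γ V s) : ContMDiffAt 𝓘(ℝ, ℝ) (𝓡 m) ∞ γ s :=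
  ((smoothAlongAt_iff (mem_chartDom (γ s))).1 h).1

theorem SmoothAlongAt.field (h : SmoothAlongAt γ V s) (hp : γ s ∈ chartDom (m := m) p) :
    ContDiffAt ℝ ∞ (coordField p γ V) s :=
  ((smoothAlongAt_iff hp).1 h).2

theorem coordRep_velocity (hd : MDifferentiableAt 𝓘(ℝ, ℝ) (𝓡 m) γ s)
    (hp : γ s ∈ chartDom (m := m) p) :
    coordRep p (γ s) (velocity γ s) = fderiv ℝ (coordCurve (m := m) p γ) s 1 := by
  have h1 : HasMFDerivAt (𝓡 m) 𝓘(ℝ, Model m) (coordOf (m := m) p) (γ s) (coordRep p (γ s)) := by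
    have := ((contMDiffAt_coordOf hp).mdifferentiableAt (by simp)).hasMFDerivAt
    rwa [coordRep, TangentBundle.continuousLinearMapAt_trivializationAt
      (by rwa [chartDom_eq] at hp)]
  have h2 := (h1.comp s hd.hasMFDerivAt).mfderiv
  rw [mfderiv_eq_fderiv] at h2
  exact (congrArg (fun L => L (1 : ℝ)) h2).symm

theorem eventually_transition {γ : ℝ → M} (hc : ContinuousAt γ s) {p p' : M}
    (hp : γ s ∈ chartDom (m := m) p) (hp' : γ s ∈ chartDom (m := m) p') :
    coordCurve (m := m) p' γ =ᶠ[nhds s] fun t => transition p' p (coordCurve p γ t) := by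
  filter_upwards [eventually_mem_chartDom hc hp, eventually_mem_chartDom hc hp'] with t h1 h2
  simp only [coordCurve, transition, coordPoint_coordOf h1]

theorem eventually_fderiv_transition (hc : ContinuousAt γ s) {p p' : M}
    (hp : γ s ∈ chartDom (m := m) p) (hp' : γ s ∈ chartDom (m := m) p') :
    coordField p' γ V =ᶠ[nhds s]
      fun t => fderiv ℝ (transition p' p) (coordCurve p γ t) (coordField p γ V t) := by
  filter_upwards [eventually_mem_chartDom hc hp, eventually_mem_chartDom hc hp'] with t h1 h2
  exact coordRep_change h2 h1 (V t)

theorem covDerivAlong_eq (g : RMetric m M) (γ : ℝ → M) (V : ∀ s, TangentSpace (𝓡 m) (γ s)) (s : ℝ)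
    (hd : MDifferentiableAt 𝓘(ℝ, ℝ) (𝓡 m) γ s) :
    covDerivAlong g γ V s = coordFrame (γ s) (γ s)
      (covD (metricCoord g (γ s)) (coordCurve (γ s) γ) (coordField (γ s) γ V) 1 s) := by
  rw [covDerivAlong, covD, coordRep_velocity hd (mem_chartDom _)]
  rfl

/-- The covariant derivative along a curve can be computed in every chart. -/
theorem coordRep_covDerivAlong (g : RMetric m M) (hd : MDifferentiableAt 𝓘(ℝ, ℝ) (𝓡 m) γ s)
    (hp : γ s ∈ chartDom (m := m) p) (hV : DifferentiableAt ℝ (coordField p γ V) s) :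
    coordRep p (γ s) (covDerivAlong g γ V s)
      = covD (metricCoord g p) (coordCurve p γ) (coordField p γ V) 1 s := by
  have hx := mem_chartDom (m := m) (γ s)
  have hY : DifferentiableAt ℝ (coordCurve (m := m) p γ) s :=
    mdifferentiableAt_iff_differentiableAt.1
      (((contMDiffAt_coordOf hp).mdifferentiableAt (by simp)).comp s hd)
  have hmem : coordCurve p γ s ∈ chartRange (m := m) p := coordOf_mem hp
  have hcp : coordPoint p (coordCurve (m := m) p γ s) = γ s := coordPoint_coordOf hp
  have htr : transition (m := m) (γ s) p (coordCurve p γ s) = coordOf (γ s) (γ s) := by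
    rw [transition, hcp]
  rw [covDerivAlong_eq g γ V s hd, covD_congr _ (eventually_transition hd.continuousAt hp hx)
    (eventually_fderiv_transition hd.continuousAt hp hx),
    (isMetricOn_metricCoord g (γ s)).covD_pullback (isMetricOn_metricCoord g p) hmem
      (by rw [htr]; exact coordOf_mem hx) (contDiffAt_transition hmem (by rw [hcp]; exact hx)) ?_
      (surjective_fderiv_transition hx hp) hY hV]
  · have := coordRep_coordFrame_change hx hp
      (covD (metricCoord g p) (coordCurve p γ) (coordField p γ V) 1 s)
    change coordRep p (γ s) (coordFrame (γ s) (γ s) (fderiv ℝ (transition (γ s) p)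
      (coordOf p (γ s)) _)) = _
    rw [← this, coordFrame_coordRep hx, coordRep_coordFrame hp]
  · have h1 : ContinuousAt (coordPoint (m := m) p) (coordCurve p γ s) :=
      (contMDiffAt_coordPoint hmem).continuousAt
    filter_upwards [(isOpen_chartRange p).mem_nhds hmem,
      eventually_mem_chartDom (p := γ s) h1 (by rw [hcp]; exact hx)] with z hz hz'
    exact metricCoord_change g hz hz'

theorem eventually_mdifferentiableAt (h : ContMDiffAt 𝓘(ℝ, ℝ) (𝓡 m) ∞ γ s) :
    ∀ᶠ t in nhds s, MDifferentiableAt 𝓘(ℝ, ℝ) (𝓡 m) γ t := by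
  filter_upwards [contMDiffAt_iff_contMDiffAt_nhds (by simp) |>.1 (ContMDiffAt.of_le h (m := 1) (by simp))] with t ht
  exact ht.mdifferentiableAt (by simp)

theorem coordField_velocity (h : ContMDiffAt 𝓘(ℝ, ℝ) (𝓡 m) ∞ γ s)
    (hp : γ s ∈ chartDom (m := m) p) :
    coordField p γ (velocity (m := m) γ) =ᶠ[nhds s] fun t => fderiv ℝ (coordCurve (m := m) p γ) t 1 := by
  filter_upwards [eventually_mdifferentiableAt h, eventually_mem_chartDom h.continuousAt hp]
    with t h1 h2 using coordRep_velocity h1 h2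

theorem smoothAlongAt_velocity (h : ContMDiffAt 𝓘(ℝ, ℝ) (𝓡 m) ∞ γ s) :
    SmoothAlongAt (m := m) γ (velocity γ) s := by
  have hp := mem_chartDom (m := m) (γ s)
  refine (smoothAlongAt_iff hp).2 ⟨h, ContDiffAt.congr_of_eventuallyEq ?_ (coordField_velocity h hp)⟩
  exact (contDiffAt_coordCurve h hp).fderiv_infty.clm_apply contDiffAt_const

/-- `covDerivAlong` uses a different chart at each time. Having its components near `s` in one chart
makes it possible to differentiate again. -/
theorem SmoothAlongAt.coordField_covDerivAlong (g : RMetric m M) (h : SmoothAlongAt γ V s)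
    (hp : γ s ∈ chartDom (m := m) p) :
    coordField p γ (covDerivAlong g γ V) =ᶠ[nhds s]
      covD (metricCoord g p) (coordCurve p γ) (coordField p γ V) 1 := by
  filter_upwards [eventually_mdifferentiableAt h.curve,
    eventually_mem_chartDom h.curve.continuousAt hp, (h.field hp).eventually_differentiableAt]
    with t h1 h2 h3 using coordRep_covDerivAlong g h1 h2 h3

theorem SmoothAlongAt.covDerivAlong (g : RMetric m M) (h : SmoothAlongAt γ V s) :
    SmoothAlongAt γ (covDerivAlong g γ V) s := by
  have hp := mem_chartDom (m := m) (γ s)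
  refine (smoothAlongAt_iff hp).2 ⟨h.curve, ContDiffAt.congr_of_eventuallyEq ?_
    (h.coordField_covDerivAlong g hp)⟩
  exact (isMetricOn_metricCoord g _).contDiffAt_covD (coordCurve_mem hp)
    (contDiffAt_coordCurve h.curve hp) (h.field hp) 1

theorem inner_eventuallyEq (g : RMetric m M) (hc : ContinuousAt γ s)
    (hp : γ s ∈ chartDom (m := m) p) :
    (fun t => g.inner (γ t) (V t) (W t)) =ᶠ[nhds s] fun t =>
      metricCoord g p (coordCurve p γ t) (coordField p γ V t) (coordField p γ W t) := by
  filter_upwards [eventually_mem_chartDom hc hp] with t ht using inner_eq_metricCoord g ht _ _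

theorem SmoothAlongAt.contDiffAt_inner (g : RMetric m M) (hV : SmoothAlongAt γ V s)
    (hW : SmoothAlongAt γ W s) : ContDiffAt ℝ ∞ (fun t => g.inner (γ t) (V t) (W t)) s := by
  have hp := mem_chartDom (m := m) (γ s)
  exact ((isMetricOn_metricCoord g _).contDiffAt_apply₂ (coordCurve_mem hp)
    (contDiffAt_coordCurve hV.curve hp) (hV.field hp) (hW.field hp)).congr_of_eventuallyEq
    (inner_eventuallyEq g hV.curve.continuousAt hp)

/-- The Levi-Civita connection is metric. -/
theorem SmoothAlongAt.hasDerivAt_inner (g : RMetric m M) (hV : SmoothAlongAt γ V s)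
    (hW : SmoothAlongAt γ W s) :
    HasDerivAt (fun t => g.inner (γ t) (V t) (W t))
      (g.inner (γ s) (_root_.covDerivAlong g γ V s) (W s)
        + g.inner (γ s) (V s) (_root_.covDerivAlong g γ W s)) s := by
  have hp := mem_chartDom (m := m) (γ s)
  refine (hV.contDiffAt_inner g hW).differentiableAt_infty.hasDerivAt.congr_deriv ?_
  rw [(inner_eventuallyEq g hV.curve.continuousAt hp).deriv_eq, ← fderiv_apply_one_eq_deriv,
    (isMetricOn_metricCoord g _).fderiv_inner (coordCurve_mem hp)
      (contDiffAt_coordCurve hV.curve hp).differentiableAt_infty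
      (hV.field hp).differentiableAt_infty (hW.field hp).differentiableAt_infty,
    inner_eq_metricCoord g hp, inner_eq_metricCoord g hp,
    ← (hV.coordField_covDerivAlong g hp).self_of_nhds,
    ← (hW.coordField_covDerivAlong g hp).self_of_nhds]
  rfl

theorem covDerivAlong_congr (g : RMetric m M) (h : ∀ᶠ t in nhds s, V t = W t) :
    covDerivAlong g γ V s = covDerivAlong g γ W s := by
  have h1 : (fun t => (coordRep (γ s) (γ t) (V t) : Model m))
      =ᶠ[nhds s] fun t => coordRep (γ s) (γ t) (W t) := by
    filter_upwards [h] with t ht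
    rw [ht]
  rw [covDerivAlong, covDerivAlong, h.self_of_nhds]
  congr 2
  exact h1.deriv_eq

theorem SmoothAlongAt.add (hV : SmoothAlongAt γ V s) (hW : SmoothAlongAt γ W s) :
    SmoothAlongAt γ (fun t => V t + W t) s := by
  have hp := mem_chartDom (m := m) (γ s)
  refine (smoothAlongAt_iff hp).2 ⟨hV.curve, ?_⟩
  have : coordField (γ s) γ (fun t => V t + W t)
      = fun t => coordField (γ s) γ V t + coordField (γ s) γ W t := by
    funext t; exact map_add _ _ _
  rw [this]
  exact (hV.field hp).add (hW.field hp)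

theorem SmoothAlongAt.smul {f : ℝ → ℝ} (hf : ContDiffAt ℝ ∞ f s) (hV : SmoothAlongAt γ V s) :
    SmoothAlongAt γ (fun t => f t • V t) s := by
  have hp := mem_chartDom (m := m) (γ s)
  refine (smoothAlongAt_iff hp).2 ⟨hV.curve, ?_⟩
  have : coordField (γ s) γ (fun t => f t • V t) = fun t => f t • coordField (γ s) γ V t := by
    funext t; exact map_smul _ _ _
  rw [this]
  exact hf.smul (hV.field hp)

theorem SmoothAlongAt.covDerivAlong_add (g : RMetric m M) (hV : SmoothAlongAt γ V s)
    (hW : SmoothAlongAt γ W s) :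
    _root_.covDerivAlong g γ (fun t => V t + W t) s
      = _root_.covDerivAlong g γ V s + _root_.covDerivAlong g γ W s := by
  have hp := mem_chartDom (m := m) (γ s)
  have hd := (hV.curve.mdifferentiableAt (by simp))
  have : coordField (γ s) γ (fun t => V t + W t)
      = fun t => coordField (γ s) γ V t + coordField (γ s) γ W t := by
    funext t; exact map_add _ _ _
  rw [covDerivAlong_eq g γ _ s hd, covDerivAlong_eq g γ V s hd, covDerivAlong_eq g γ W s hd,
    ← map_add]
  congr 1
  rw [covD, covD, covD, this, fderiv_fun_add (hV.field hp).differentiableAt_infty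
      (hW.field hp).differentiableAt_infty, add_apply, map_add]
  abel

theorem SmoothAlongAt.covDerivAlong_smul (g : RMetric m M) {f : ℝ → ℝ} (hf : ContDiffAt ℝ ∞ f s)
    (hV : SmoothAlongAt γ V s) :
    _root_.covDerivAlong g γ (fun t => f t • V t) s
      = deriv f s • V s + f s • _root_.covDerivAlong g γ V s := by
  have hp := mem_chartDom (m := m) (γ s)
  have hd := (hV.curve.mdifferentiableAt (by simp))
  have : coordField (γ s) γ (fun t => f t • V t) = fun t => f t • coordField (γ s) γ V t := by
    funext t; exact map_smul _ _ _
  have h2 : covD (metricCoord g (γ s)) (coordCurve (γ s) γ)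
      (fun t => f t • coordField (γ s) γ V t) 1 s = deriv f s • coordField (γ s) γ V s
        + f s • covD (metricCoord g (γ s)) (coordCurve (γ s) γ) (coordField (γ s) γ V) 1 s := by
    rw [covD, covD, fderiv_fun_smul hf.differentiableAt_infty
      (hV.field hp).differentiableAt_infty, map_smul, smul_add]
    simp
    abel
  rw [covDerivAlong_eq g γ _ s hd, covDerivAlong_eq g γ V s hd, this, h2, map_add, map_smul,
    map_smul]
  congr 2
  exact coordFrame_coordRep hp _

end

end Riemannian

/-! ### The energy density in coordinates, for curves and two-parameter maps -/

section Riemannian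

variable {m : ℕ} {M : Type*} [TopologicalSpace M] [ChartedSpace (Model m) M]
  [IsManifold (𝓡 m) ∞ M]

theorem inner_curvature (g : RMetric m M) (x : M) (u v w z : TangentSpace (𝓡 m) x) :
    g.inner x (curvature g x u v w) z
      = metricCoord g x (coordOf x x) (curv (metricCoord g x) (coordOf x x) (coordRep x x u)
          (coordRep x x v) (coordRep x x w)) (coordRep x x z) := by
  have hx := mem_chartDom (m := m) x
  have hy := coordOf_mem hx
  have hC := ((isMetricOn_metricCoord g x).contDiffAt_christoffelL hy).differentiableAt_infty
  have h1 : ∀ a b c : Model m, fderiv ℝ (fun z => christoffel g x z a b) (coordCenter x) c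
      = fderiv ℝ (christoffelL (metricCoord g x)) (coordOf x x) c a b := by
    intro a b c
    have := fderiv_clm_apply₂ hC (differentiableAt_const a) (differentiableAt_const b) c
    simp only [fderiv_fun_const, Pi.zero_apply, zero_apply, map_zero, add_zero] at this
    exact this
  have h2 : coordRep x x (curvature g x u v w) = curv (metricCoord g x) (coordOf x x)
      (coordRep x x u) (coordRep x x v) (coordRep x x w) := by
    simp only [curvature]
    rw [coordRep_coordFrame hx, h1, h1]
    rfl
  rw [inner_eq_metricCoord g hx, h2]

/-- Self-adjointness of the Jacobi operator `u ↦ R(u, v)v`, by pair symmetry and the two skewness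
properties. In the first variation it moves the curvature term from the variation field to `τ`. -/
theorem inner_curvature_symm (g : RMetric m M) (x : M) (u v w : TangentSpace (𝓡 m) x) :
    g.inner x (curvature g x u v v) w = g.inner x u (curvature g x w v v) := by
  have hy := coordOf_mem (mem_chartDom (m := m) x)
  rw [g.symm x u, inner_curvature, inner_curvature,
    (isMetricOn_metricCoord g x).curv_pair_symm hy, IsMetricOn.curv_antisymm, map_neg,
    neg_apply, (isMetricOn_metricCoord g x).curv_skew hy, neg_neg,
    (isMetricOn_metricCoord g x).symm _ hy]

/-- The integrand of `sesquiEnergy`. -/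
def energyDensity (g : RMetric m M) (δ₁ δ₂ : ℝ) (γ : ℝ → M) (s : ℝ) : ℝ :=
  δ₁ * g.inner (γ s) (velocity γ s) (velocity γ s)
    + δ₂ * g.inner (γ s) (tension g γ s) (tension g γ s)

/-- The integrand of `sesquiEnergy` in coordinates. -/
def energyDensityCoord {P : Type*} [NormedAddCommGroup P] [NormedSpace ℝ P]
    (h : Model m → Model m →L[ℝ] Model m →L[ℝ] ℝ) (δ₁ δ₂ : ℝ) (Y : P → Model m) (d q : P) : ℝ :=
  δ₁ * h (Y q) (fderiv ℝ Y q d) (fderiv ℝ Y q d)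
    + δ₂ * h (Y q) (covD h Y (fun z => fderiv ℝ Y z d) d q) (covD h Y (fun z => fderiv ℝ Y z d) d q)

section

variable {γ γ' : ℝ → M} {s : ℝ} {p : M}

theorem coordField_tension (g : RMetric m M) (h : ContMDiffAt 𝓘(ℝ, ℝ) (𝓡 m) ∞ γ s)
    (hp : γ s ∈ chartDom (m := m) p) :
    coordField p γ (tension g γ) =ᶠ[nhds s] covD (metricCoord g p) (coordCurve p γ)
      (fun t => fderiv ℝ (coordCurve p γ) t 1) 1 :=
  ((smoothAlongAt_velocity h).coordField_covDerivAlong g hp).trans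
    (covD_covD_congr _ Filter.EventuallyEq.rfl (coordField_velocity h hp) 1)

theorem energyDensity_eq (g : RMetric m M) (δ₁ δ₂ : ℝ) (h : ContMDiffAt 𝓘(ℝ, ℝ) (𝓡 m) ∞ γ s)
    (hp : γ s ∈ chartDom (m := m) p) :
    energyDensity g δ₁ δ₂ γ s
      = energyDensityCoord (metricCoord g p) δ₁ δ₂ (coordCurve p γ) 1 s := by
  have h1 := (coordField_velocity h hp).self_of_nhds
  have h2 := (coordField_tension g h hp).self_of_nhds
  simp only [coordField] at h1 h2
  rw [energyDensity, energyDensityCoord, inner_eq_metricCoord g hp, inner_eq_metricCoord g hp,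
    h1, h2]
  rfl

/-- The density is a local expression in the curve, so values of a variation outside the open set
`J` are irrelevant. -/
theorem energyDensity_congr (g : RMetric m M) (δ₁ δ₂ : ℝ) (h : ContMDiffAt 𝓘(ℝ, ℝ) (𝓡 m) ∞ γ s)
    (he : γ' =ᶠ[nhds s] γ) : energyDensity g δ₁ δ₂ γ' s = energyDensity g δ₁ δ₂ γ s := by
  have hp := mem_chartDom (m := m) (γ s)
  have hc : coordCurve (m := m) (γ s) γ' =ᶠ[nhds s] coordCurve (γ s) γ := by
    filter_upwards [he] with t ht
    rw [coordCurve, coordCurve, ht]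
  have hc' : (fun t => fderiv ℝ (coordCurve (m := m) (γ s) γ') t 1)
      =ᶠ[nhds s] fun t => fderiv ℝ (coordCurve (γ s) γ) t 1 := by
    filter_upwards [hc.eventuallyEq_nhds] with t ht
    rw [ht.fderiv_eq]
  rw [energyDensity_eq g δ₁ δ₂ h hp, energyDensity_eq g δ₁ δ₂ (h.congr_of_eventuallyEq he)
    (by rw [he.self_of_nhds]; exact hp), energyDensityCoord, energyDensityCoord,
    covD_congr _ hc hc', hc.fderiv_eq, hc.self_of_nhds]

end

section TwoParameters

variable {Γ : ℝ → ℝ → M} {q : ℝ × ℝ} {p : M}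

/-- The coordinates of a two-parameter map. -/
def coordMap (p : M) (Γ : ℝ → ℝ → M) (z : ℝ × ℝ) : Model m := coordOf p (Γ z.1 z.2)

theorem contDiffAt_coordMap
    (h : ContMDiffAt 𝓘(ℝ, ℝ × ℝ) (𝓡 m) ∞ (fun z : ℝ × ℝ => Γ z.1 z.2) q)
    (hp : Γ q.1 q.2 ∈ chartDom (m := m) p) : ContDiffAt ℝ ∞ (coordMap (m := m) p Γ) q :=
  contMDiffAt_iff_contDiffAt.1
    (ContMDiffAt.comp (f := fun z : ℝ × ℝ => Γ z.1 z.2) q (contMDiffAt_coordOf hp) h)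

theorem pair_add_smul (ε t : ℝ) : ((ε, 0) : ℝ × ℝ) + t • (0, 1) = (ε, t) := by simp

theorem contMDiffAt_slice
    (h : ContMDiffAt 𝓘(ℝ, ℝ × ℝ) (𝓡 m) ∞ (fun z : ℝ × ℝ => Γ z.1 z.2) q) :
    ContMDiffAt 𝓘(ℝ, ℝ) (𝓡 m) ∞ (Γ q.1) q.2 := by
  have h1 : ContMDiffAt 𝓘(ℝ, ℝ) 𝓘(ℝ, ℝ × ℝ) ∞ (fun t : ℝ => (q.1, t)) q.2 :=
    contMDiffAt_iff_contDiffAt.2 (contDiffAt_const.prodMk contDiffAt_id)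
  exact ContMDiffAt.comp (g := fun z : ℝ × ℝ => Γ z.1 z.2) q.2 h h1

theorem contMDiffAt_slice'
    (h : ContMDiffAt 𝓘(ℝ, ℝ × ℝ) (𝓡 m) ∞ (fun z : ℝ × ℝ => Γ z.1 z.2) q) :
    ContMDiffAt 𝓘(ℝ, ℝ) (𝓡 m) ∞ (fun ε => Γ ε q.2) q.1 := by
  have h1 : ContMDiffAt 𝓘(ℝ, ℝ) 𝓘(ℝ, ℝ × ℝ) ∞ (fun t : ℝ => (t, q.2)) q.1 :=
    contMDiffAt_iff_contDiffAt.2 (contDiffAt_id.prodMk contDiffAt_const)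
  exact ContMDiffAt.comp (g := fun z : ℝ × ℝ => Γ z.1 z.2) q.1 h h1

theorem covD_slice (h : Model m → Model m →L[ℝ] Model m →L[ℝ] ℝ) {Y X : ℝ × ℝ → Model m}
    {x : ℝ → Model m} {ε t : ℝ} (hY : DifferentiableAt ℝ Y (ε, t))
    (hX : DifferentiableAt ℝ X (ε, t)) (hx : x =ᶠ[nhds t] fun t => X (ε, t)) :
    covD h (fun t => Y (ε, t)) x 1 t = covD h Y X (0, 1) (ε, t) := by
  have h1 : ∀ Z : ℝ × ℝ → Model m, (fun t => Z (ε, t)) = fun s : ℝ => Z ((ε, 0) + s • (0, 1)) :=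
    fun Z => by simp
  rw [covD_congr h (Filter.EventuallyEq.rfl) hx, h1 Y, h1 X,
    covD_line (by rwa [pair_add_smul]) (by rwa [pair_add_smul]), pair_add_smul]

theorem fderiv_slice {H : Type*} [NormedAddCommGroup H] [NormedSpace ℝ H] {Y : ℝ × ℝ → H} {ε t : ℝ}
    (hY : DifferentiableAt ℝ Y (ε, t)) :
    fderiv ℝ (fun t => Y (ε, t)) t 1 = fderiv ℝ Y (ε, t) (0, 1) := by
  have h1 : (fun t => Y (ε, t)) = fun s : ℝ => Y ((ε, 0) + s • (0, 1)) := by simp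
  rw [h1, fderiv_line (by rwa [pair_add_smul]), pair_add_smul]

theorem fderiv_slice' {H : Type*} [NormedAddCommGroup H] [NormedSpace ℝ H] {Y : ℝ × ℝ → H}
    {ε t : ℝ} (hY : DifferentiableAt ℝ Y (ε, t)) :
    fderiv ℝ (fun ε => Y (ε, t)) ε 1 = fderiv ℝ Y (ε, t) (1, 0) := by
  have h1 : (fun ε => Y (ε, t)) = fun s : ℝ => Y ((0, t) + s • (1, 0)) := by simp
  have h2 : ((0, t) : ℝ × ℝ) + ε • (1, 0) = (ε, t) := by simp
  rw [h1, fderiv_line (by rwa [h2]), h2]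

theorem ContDiffAt.eventually_slice {H : Type*} [NormedAddCommGroup H] [NormedSpace ℝ H]
    {Y : ℝ × ℝ → H} {ε t : ℝ} (hY : ContDiffAt ℝ ∞ Y (ε, t)) :
    (fun t => fderiv ℝ (fun t => Y (ε, t)) t 1) =ᶠ[nhds t] fun t => fderiv ℝ Y (ε, t) (0, 1) := by
  have h1 : ContinuousAt (fun t : ℝ => (ε, t)) t := by fun_prop
  filter_upwards [h1.eventually hY.eventually_differentiableAt] with z hz using fderiv_slice hz

theorem energyDensity_eq_coordMap (g : RMetric m M) (δ₁ δ₂ : ℝ)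
    (h : ContMDiffAt 𝓘(ℝ, ℝ × ℝ) (𝓡 m) ∞ (fun z : ℝ × ℝ => Γ z.1 z.2) q)
    (hp : Γ q.1 q.2 ∈ chartDom (m := m) p) :
    energyDensity g δ₁ δ₂ (Γ q.1) q.2
      = energyDensityCoord (metricCoord g p) δ₁ δ₂ (coordMap p Γ) (0, 1) q := by
  obtain ⟨ε, t⟩ := q
  have hY := contDiffAt_coordMap h hp
  rw [energyDensity_eq g δ₁ δ₂ (contMDiffAt_slice h) hp, energyDensityCoord, energyDensityCoord]
  have h1 : coordCurve (m := m) p (Γ ε) = fun t => coordMap p Γ (ε, t) := rfl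
  have hdY : DifferentiableAt ℝ (fun z => fderiv ℝ (coordMap (m := m) p Γ) z (0, 1)) (ε, t) :=
    hY.fderiv_infty.differentiableAt_infty.clm_apply (differentiableAt_const _)
  simp only [h1]
  rw [fderiv_slice hY.differentiableAt_infty,
    covD_slice _ hY.differentiableAt_infty hdY hY.eventually_slice]

end TwoParameters

end Riemannian

/-! ### First variation of the energy density -/

section Riemannian

variable {m : ℕ} {M : Type*} [TopologicalSpace M] [ChartedSpace (Model m) M]
  [IsManifold (𝓡 m) ∞ M]

section TwoParameters

variable {Γ : ℝ → ℝ → M} {ε t : ℝ} {p : M}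

/-- The variation field of a two-parameter map along the curve `Γ ε`. -/
def variationField (Γ : ℝ → ℝ → M) (ε t : ℝ) : TangentSpace (𝓡 m) (Γ ε t) :=
  velocity (fun ε => Γ ε t) ε

/-- Derivatives along the curve `Γ ε` become derivatives of the two-parameter map in direction `(0,
1)`, where they can be commuted with the direction `(1, 0)`. -/
theorem coordField_slice_covDerivAlong (g : RMetric m M) {V : ∀ t, TangentSpace (𝓡 m) (Γ ε t)}
    {X : ℝ × ℝ → Model m}
    (h : ContMDiffAt 𝓘(ℝ, ℝ × ℝ) (𝓡 m) ∞ (fun z : ℝ × ℝ => Γ z.1 z.2) (ε, t))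
    (hp : Γ ε t ∈ chartDom (m := m) p) (hX : ContDiffAt ℝ ∞ X (ε, t))
    (hV : coordField p (Γ ε) V =ᶠ[nhds t] fun t => X (ε, t)) :
    coordField p (Γ ε) (covDerivAlong g (Γ ε) V) =ᶠ[nhds t]
      fun t => covD (metricCoord g p) (coordMap p Γ) X (0, 1) (ε, t) := by
  have hc : ContinuousAt (fun t : ℝ => (ε, t)) t := by fun_prop
  have hs : ContDiffAt ℝ ∞ (fun t : ℝ => (ε, t)) t := contDiffAt_const.prodMk contDiffAt_id
  have hXs : ContDiffAt ℝ ∞ (fun t => X (ε, t)) t := ContDiffAt.comp t hX hs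
  have hVs : SmoothAlongAt (Γ ε) V t :=
    (smoothAlongAt_iff hp).2 ⟨contMDiffAt_slice h, hXs.congr_of_eventuallyEq hV⟩
  have h2 := hc.eventually (contDiffAt_coordMap h hp).eventually_differentiableAt
  have h3 := hc.eventually hX.eventually_differentiableAt
  refine (hVs.coordField_covDerivAlong g hp).trans ?_
  have h1 : coordCurve (m := m) p (Γ ε) = fun t => coordMap p Γ (ε, t) := rfl
  rw [h1]
  filter_upwards [h2, h3, hV.eventuallyEq_nhds] with z h2 h3 h4
  rw [covD_slice (metricCoord g p) h2 h3 h4]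

theorem coordField_variationField
    (h : ∀ᶠ z in nhds (ε, t), ContMDiffAt 𝓘(ℝ, ℝ × ℝ) (𝓡 m) ∞ (fun z : ℝ × ℝ => Γ z.1 z.2) z)
    (hp : Γ ε t ∈ chartDom (m := m) p) :
    coordField p (Γ ε) (variationField Γ ε) =ᶠ[nhds t]
      fun t => fderiv ℝ (coordMap (m := m) p Γ) (ε, t) (1, 0) := by
  have hc : ContinuousAt (fun t : ℝ => (ε, t)) t := by fun_prop
  filter_upwards [hc.eventually h, eventually_mem_chartDom
    (contMDiffAt_slice h.self_of_nhds).continuousAt hp] with t' h1 h2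
  have h3 := coordRep_velocity ((contMDiffAt_slice' h1).mdifferentiableAt (by simp)) h2
  refine h3.trans ?_
  exact fderiv_slice' (contDiffAt_coordMap h1 h2).differentiableAt_infty

theorem smoothAlongAt_variationField
    (h : ∀ᶠ z in nhds (ε, t), ContMDiffAt 𝓘(ℝ, ℝ × ℝ) (𝓡 m) ∞ (fun z : ℝ × ℝ => Γ z.1 z.2) z) :
    SmoothAlongAt (m := m) (Γ ε) (variationField Γ ε) t := by
  have hp := mem_chartDom (m := m) (Γ ε t)
  have hs : ContDiffAt ℝ ∞ (fun t : ℝ => (ε, t)) t := contDiffAt_const.prodMk contDiffAt_id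
  refine (smoothAlongAt_iff hp).2 ⟨contMDiffAt_slice h.self_of_nhds,
    ContDiffAt.congr_of_eventuallyEq ?_ (coordField_variationField h hp)⟩
  exact ((contDiffAt_coordMap h.self_of_nhds hp).fderiv_infty.clm_apply contDiffAt_const).comp t hs

theorem contDiffAt_energyDensityCoord {h : Model m → Model m →L[ℝ] Model m →L[ℝ] ℝ}
    {U : Set (Model m)} (H : IsMetricOn h U) (δ₁ δ₂ : ℝ) {Y : ℝ × ℝ → Model m} {q : ℝ × ℝ}
    (hq : Y q ∈ U) (hY : ContDiffAt ℝ ∞ Y q) (d : ℝ × ℝ) :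
    ContDiffAt ℝ ∞ (energyDensityCoord h δ₁ δ₂ Y d) q := by
  have hS : ContDiffAt ℝ ∞ (fun z => fderiv ℝ Y z d) q := hY.fderiv_infty.clm_apply contDiffAt_const
  have hA := H.contDiffAt_covD hq hY hS d
  exact (contDiffAt_const.mul (H.contDiffAt_apply₂ hq hY hS hS)).add
    (contDiffAt_const.mul (H.contDiffAt_apply₂ hq hY hA hA))

/-- Torsion-freeness replaces `∇_{d'} ∂_d Y` by `∇_d ∂_{d'} Y`; commuting `∇_{d'}` past the second
`∇_d` costs the curvature term. -/
theorem fderiv_energyDensityCoord {h : Model m → Model m →L[ℝ] Model m →L[ℝ] ℝ}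
    {U : Set (Model m)} (H : IsMetricOn h U) (δ₁ δ₂ : ℝ) {Y : ℝ × ℝ → Model m} {q : ℝ × ℝ}
    (hq : Y q ∈ U) (hY : ContDiffAt ℝ ∞ Y q) (d d' : ℝ × ℝ) :
    fderiv ℝ (energyDensityCoord h δ₁ δ₂ Y d) q d'
      = 2 * δ₁ * h (Y q) (covD h Y (fun z => fderiv ℝ Y z d') d q) (fderiv ℝ Y q d)
        + 2 * δ₂ * h (Y q) (covD h Y (covD h Y (fun z => fderiv ℝ Y z d') d) d q
            + curv h (Y q) (fderiv ℝ Y q d') (fderiv ℝ Y q d) (fderiv ℝ Y q d))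
          (covD h Y (fun z => fderiv ℝ Y z d) d q) := by
  have hS : ContDiffAt ℝ ∞ (fun z => fderiv ℝ Y z d) q := hY.fderiv_infty.clm_apply contDiffAt_const
  have hA := H.contDiffAt_covD hq hY hS d
  have hYU : ∀ᶠ z in nhds q, Y z ∈ U := hY.continuousAt.preimage_mem_nhds (H.isOpen.mem_nhds hq)
  -- Torsion-freeness, needed on a neighbourhood because it is differentiated once more.
  have h1 : covD h Y (fun z => fderiv ℝ Y z d) d' =ᶠ[nhds q]
      covD h Y (fun z => fderiv ℝ Y z d') d := by
    have h2 : ∀ᶠ z in nhds q, ContDiffAt ℝ 2 Y z :=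
      (hY.of_le (WithTop.coe_le_coe.2 le_top : ((2 : ℕ∞) : WithTop ℕ∞) ≤ _)).eventually (by simp)
    filter_upwards [hYU, h2] with z hz h2z
    have h3 : ∀ a b : ℝ × ℝ, fderiv ℝ (fun z => fderiv ℝ Y z b) z a
        = fderiv ℝ (fderiv ℝ Y) z a b := fun a b => by
      have := (h2z.fderiv_right (m := 1) (by norm_num)).differentiableAt (by simp)
      rw [(this.hasFDerivAt.clm_apply (hasFDerivAt_const b z)).fderiv]; simp
    have h4 : fderiv ℝ (fderiv ℝ Y) z d d' = fderiv ℝ (fderiv ℝ Y) z d' d :=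
      h2z.isSymmSndFDerivAt (by simp) d d'
    simp only [covD, h3, h4, H.christoffelL_symm hz (fderiv ℝ Y z d)]
  have h5 := H.covD_covD_sub hq hY hS d' d
  rw [sub_eq_iff_eq_add, covD_congr h Filter.EventuallyEq.rfl h1, add_comm] at h5
  have hd := hY.differentiableAt_infty
  have e1 := H.fderiv_inner hq hd hS.differentiableAt_infty hS.differentiableAt_infty d'
  have e2 := H.fderiv_inner hq hd hA.differentiableAt_infty hA.differentiableAt_infty d'
  have f1 := (H.contDiffAt_apply₂ hq hY hS hS).differentiableAt_infty
  have f2 := (H.contDiffAt_apply₂ hq hY hA hA).differentiableAt_infty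
  unfold energyDensityCoord
  rw [fderiv_fun_add (f1.const_mul _) (f2.const_mul _), fderiv_const_mul f1, fderiv_const_mul f2,
    add_apply, smul_apply, smul_apply, e1, e2, ← h5, ← h1.self_of_nhds,
    H.symm _ hq (fderiv ℝ Y q d), H.symm _ hq (covD h Y (fun z => fderiv ℝ Y z d) d q)]
  simp only [smul_eq_mul]
  ring

theorem eventually_energyDensity_eq (g : RMetric m M) (δ₁ δ₂ : ℝ)
    (h : ∀ᶠ z in nhds (ε, t), ContMDiffAt 𝓘(ℝ, ℝ × ℝ) (𝓡 m) ∞ (fun z : ℝ × ℝ => Γ z.1 z.2) z)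
    (hp : Γ ε t ∈ chartDom (m := m) p) :
    (fun z : ℝ × ℝ => energyDensity g δ₁ δ₂ (Γ z.1) z.2) =ᶠ[nhds (ε, t)]
      energyDensityCoord (metricCoord g p) δ₁ δ₂ (coordMap p Γ) (0, 1) := by
  filter_upwards [h, eventually_mem_chartDom (γ := fun z : ℝ × ℝ => Γ z.1 z.2)
    h.self_of_nhds.continuousAt hp] with z h1 h2 using energyDensity_eq_coordMap g δ₁ δ₂ h1 h2

theorem contDiffAt_energyDensity (g : RMetric m M) (δ₁ δ₂ : ℝ)
    (h : ∀ᶠ z in nhds (ε, t), ContMDiffAt 𝓘(ℝ, ℝ × ℝ) (𝓡 m) ∞ (fun z : ℝ × ℝ => Γ z.1 z.2) z) :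
    ContDiffAt ℝ ∞ (fun z : ℝ × ℝ => energyDensity g δ₁ δ₂ (Γ z.1) z.2) (ε, t) := by
  have hp := mem_chartDom (m := m) (Γ ε t)
  exact (contDiffAt_energyDensityCoord (isMetricOn_metricCoord g _) δ₁ δ₂ (coordOf_mem hp)
    (contDiffAt_coordMap h.self_of_nhds hp) _).congr_of_eventuallyEq
      (eventually_energyDensity_eq g δ₁ δ₂ h hp)

/-- The first variation of the energy density. -/
theorem fderiv_energyDensity (g : RMetric m M) (δ₁ δ₂ : ℝ)
    (h : ∀ᶠ z in nhds (ε, t), ContMDiffAt 𝓘(ℝ, ℝ × ℝ) (𝓡 m) ∞ (fun z : ℝ × ℝ => Γ z.1 z.2) z) :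
    fderiv ℝ (fun z : ℝ × ℝ => energyDensity g δ₁ δ₂ (Γ z.1) z.2) (ε, t) (1, 0)
      = 2 * δ₁ * g.inner (Γ ε t) (covDerivAlong g (Γ ε) (variationField Γ ε) t)
          (velocity (Γ ε) t)
        + 2 * δ₂ * g.inner (Γ ε t)
          (covDerivAlong g (Γ ε) (covDerivAlong g (Γ ε) (variationField Γ ε)) t
            + curvature g (Γ ε t) (variationField Γ ε t) (velocity (Γ ε) t) (velocity (Γ ε) t))
          (tension g (Γ ε) t) := by
  have hp := mem_chartDom (m := m) (Γ ε t)
  have hh := h.self_of_nhds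
  have H := isMetricOn_metricCoord g (Γ ε t)
  have hY := contDiffAt_coordMap hh hp
  have hq : coordMap (Γ ε t) Γ (ε, t) ∈ chartRange (m := m) (Γ ε t) := coordOf_mem hp
  have hW : ContDiffAt ℝ ∞ (fun z => fderiv ℝ (coordMap (m := m) (Γ ε t) Γ) z (1, 0)) (ε, t) :=
    hY.fderiv_infty.clm_apply contDiffAt_const
  have hS : ContDiffAt ℝ ∞ (fun z => fderiv ℝ (coordMap (m := m) (Γ ε t) Γ) z (0, 1)) (ε, t) :=
    hY.fderiv_infty.clm_apply contDiffAt_const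
  have v0 := coordField_variationField h hp
  have v1 := coordField_slice_covDerivAlong g hh hp hW v0
  have v2 := coordField_slice_covDerivAlong g hh hp (H.contDiffAt_covD hq hY hW _) v1
  have s0 : coordField (Γ ε t) (Γ ε) (velocity (Γ ε)) =ᶠ[nhds t]
      fun t' => fderiv ℝ (coordMap (m := m) (Γ ε t) Γ) (ε, t') (0, 1) :=
    (coordField_velocity (contMDiffAt_slice hh) hp).trans hY.eventually_slice
  have s1 := coordField_slice_covDerivAlong g hh hp hS s0
  have v0' := v0.self_of_nhds
  have v1' := v1.self_of_nhds
  have v2' := v2.self_of_nhds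
  have s0' := s0.self_of_nhds
  have s1' := s1.self_of_nhds
  simp only [coordField] at v0' v1' v2' s0' s1'
  rw [(eventually_energyDensity_eq g δ₁ δ₂ h hp).fderiv_eq,
    fderiv_energyDensityCoord H δ₁ δ₂ hq hY, map_add, add_apply, map_add, add_apply,
    inner_curvature, inner_eq_metricCoord g hp, inner_eq_metricCoord g hp, tension, v0', v1', v2',
    s0', s1']
  rfl

end TwoParameters

end Riemannian

/-- Differentiation under the integral sign for smooth integrands. -/
theorem hasDerivAt_integral_of_contDiffAt {e : ℝ × ℝ → ℝ} {a b ε₀ : ℝ} (hab : a ≤ b) (hε₀ : 0 < ε₀)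
    (he : ∀ ε ∈ Ioo (-ε₀) ε₀, ∀ s ∈ Icc a b, ContDiffAt ℝ ∞ e (ε, s)) :
    HasDerivAt (fun ε => ∫ s in a..b, e (ε, s)) (∫ s in a..b, fderiv ℝ e (0, s) (1, 0)) 0 := by
  -- The parameter interval is halved to get a compact rectangle, on which the continuous
  -- `ε`-derivative has a uniform bound.
  have hsub : Icc (-(ε₀ / 2)) (ε₀ / 2) ⊆ Ioo (-ε₀) ε₀ := fun x hx =>
    ⟨by linarith [hx.1], by linarith [hx.2]⟩
  have hcont : ContinuousOn (fun z : ℝ × ℝ => fderiv ℝ e z (1, 0))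
      (Icc (-(ε₀ / 2)) (ε₀ / 2) ×ˢ Icc a b) := fun z hz =>
    (((he z.1 (hsub hz.1) z.2 hz.2).fderiv_infty.clm_apply
      contDiffAt_const).continuousAt).continuousWithinAt
  obtain ⟨C, hC⟩ := (isCompact_Icc.prod isCompact_Icc).exists_bound_of_continuousOn hcont
  have hslice : ∀ ε ∈ Ioo (-ε₀) ε₀, ContinuousOn (fun s => e (ε, s)) (Icc a b) := fun ε hε s hs =>
    ((he ε hε s hs).continuousAt.comp (f := fun s : ℝ => (ε, s))
      (by fun_prop : ContinuousAt (fun s : ℝ => (ε, s)) s)).continuousWithinAt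
  have hslice' : ContinuousOn (fun s => fderiv ℝ e (0, s) (1, 0)) (Icc a b) := fun s hs =>
    (((he 0 ⟨by linarith, hε₀⟩ s hs).fderiv_infty.clm_apply
      (contDiffAt_const (c := ((1, 0) : ℝ × ℝ)))).continuousAt.comp (f := fun s : ℝ => ((0 : ℝ), s))
      (by fun_prop : ContinuousAt (fun s : ℝ => ((0 : ℝ), s)) s)).continuousWithinAt
  have hI : ∀ s, s ∈ uIoc a b → s ∈ Icc a b := fun s hs => by
    rw [uIoc_of_le hab] at hs; exact Ioc_subset_Icc_self hs
  refine (intervalIntegral.hasDerivAt_integral_of_dominated_loc_of_deriv_le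
    (F := fun ε s => e (ε, s)) (F' := fun ε s => fderiv ℝ e (ε, s) (1, 0)) (bound := fun _ => C)
    (s := Icc (-(ε₀ / 2)) (ε₀ / 2)) (Icc_mem_nhds (by linarith) (by linarith)) ?_ ?_ ?_ ?_ ?_ ?_).2
  · filter_upwards [Ioo_mem_nhds (by linarith : -ε₀ < 0) hε₀] with ε hε
    exact ((hslice ε hε).mono hI).aestronglyMeasurable measurableSet_uIoc
  · exact ContinuousOn.intervalIntegrable_of_Icc hab (hslice 0 ⟨by linarith, hε₀⟩)
  · exact (hslice'.mono hI).aestronglyMeasurable measurableSet_uIoc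
  · exact Filter.Eventually.of_forall fun s hs ε hε => hC (ε, s) ⟨hε, hI s hs⟩
  · exact intervalIntegrable_const
  · refine Filter.Eventually.of_forall fun s hs ε hε => ?_
    have hd := (he ε (hsub hε) s (hI s hs)).differentiableAt_infty
    have h1 : HasDerivAt (fun ε : ℝ => (ε, s)) ((1 : ℝ), (0 : ℝ)) ε :=
      (hasDerivAt_id ε).prodMk (hasDerivAt_const ε s)
    exact hd.hasFDerivAt.comp_hasDerivAt ε h1

/-! ### The first variation formula and the Euler-Lagrange expression -/

section Riemannian

variable {m : ℕ} {M : Type*} [TopologicalSpace M] [ChartedSpace (Model m) M]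
  [IsManifold (𝓡 m) ∞ M]

/-- The left-hand side of the Euler-Lagrange equation of `sesquiEnergy`. -/
def eulerLagrange (g : RMetric m M) (δ₁ δ₂ : ℝ) (γ : ℝ → M) (s : ℝ) : TangentSpace (𝓡 m) (γ s) :=
  δ₂ • (covDerivAlong g γ (covDerivAlong g γ (tension g γ)) s
      + curvature g (γ s) (tension g γ s) (velocity γ s) (velocity γ s))
    - δ₁ • tension g γ s

/-- The boundary term of the first variation of `sesquiEnergy`. -/
def boundaryTerm (g : RMetric m M) (δ₁ δ₂ : ℝ) (γ : ℝ → M) (V : ∀ s, TangentSpace (𝓡 m) (γ s))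
    (s : ℝ) : ℝ :=
  2 * δ₁ * g.inner (γ s) (V s) (velocity γ s)
    + 2 * δ₂ * (g.inner (γ s) (covDerivAlong g γ V s) (tension g γ s)
      - g.inner (γ s) (V s) (covDerivAlong g γ (tension g γ) s))

theorem smoothAlongAt_tension (g : RMetric m M) {γ : ℝ → M} {s : ℝ}
    (h : ContMDiffAt 𝓘(ℝ, ℝ) (𝓡 m) ∞ γ s) : SmoothAlongAt γ (tension g γ) s :=
  (smoothAlongAt_velocity h).covDerivAlong g

/-- Two integrations by parts in differential form: up to a total derivative, all covariant
derivatives pass from `V` to the curve, and `inner_curvature_symm` does the same for the curvature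
term. -/
theorem hasDerivAt_boundaryTerm (g : RMetric m M) (δ₁ δ₂ : ℝ) {γ : ℝ → M}
    {V : ∀ s, TangentSpace (𝓡 m) (γ s)} {s : ℝ} (hV : SmoothAlongAt γ V s) :
    HasDerivAt (boundaryTerm g δ₁ δ₂ γ V)
      (2 * δ₁ * g.inner (γ s) (covDerivAlong g γ V s) (velocity γ s)
        + 2 * δ₂ * g.inner (γ s) (covDerivAlong g γ (covDerivAlong g γ V) s
            + curvature g (γ s) (V s) (velocity γ s) (velocity γ s)) (tension g γ s)
        - 2 * g.inner (γ s) (V s) (eulerLagrange g δ₁ δ₂ γ s)) s := by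
  have hT := smoothAlongAt_velocity hV.curve
  have hτ := smoothAlongAt_tension g hV.curve
  have h1 := hV.hasDerivAt_inner g hT
  have h2 := (hV.covDerivAlong g).hasDerivAt_inner g hτ
  have h3 := hV.hasDerivAt_inner g (hτ.covDerivAlong g)
  refine ((h1.const_mul (2 * δ₁)).add ((h2.sub h3).const_mul (2 * δ₂))).congr_deriv ?_
  have h4 : covDerivAlong g γ (velocity γ) s = tension g γ s := rfl
  rw [h4, eulerLagrange, map_sub, map_smul, map_smul, map_add, map_add, add_apply,
    inner_curvature_symm]
  simp only [smul_eq_mul]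
  ring

theorem contDiffAt_boundaryTerm (g : RMetric m M) (δ₁ δ₂ : ℝ) {γ : ℝ → M}
    {V : ∀ s, TangentSpace (𝓡 m) (γ s)} {s : ℝ} (hV : SmoothAlongAt γ V s) :
    ContDiffAt ℝ ∞ (boundaryTerm g δ₁ δ₂ γ V) s := by
  have hT := smoothAlongAt_velocity hV.curve
  have hτ := smoothAlongAt_tension g hV.curve
  exact (contDiffAt_const.mul (hV.contDiffAt_inner g hT)).add (contDiffAt_const.mul
    (((hV.covDerivAlong g).contDiffAt_inner g hτ).sub
      (hV.contDiffAt_inner g (hτ.covDerivAlong g))))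

theorem sesquiEnergy_eq_integral (g : RMetric m M) (δ₁ δ₂ : ℝ) {a b : ℝ} (hab : a ≤ b) {γ : ℝ → M}
    (h : ∀ s ∈ Icc a b, ContMDiffAt 𝓘(ℝ, ℝ) (𝓡 m) ∞ γ s) :
    sesquiEnergy g δ₁ δ₂ a b γ = ∫ s in a..b, energyDensity g δ₁ δ₂ γ s := by
  have h1 : IntervalIntegrable (fun s => g.inner (γ s) (velocity γ s) (velocity γ s))
      MeasureTheory.volume a b := ContinuousOn.intervalIntegrable_of_Icc hab fun s hs =>
    ((smoothAlongAt_velocity (h s hs)).contDiffAt_inner g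
      (smoothAlongAt_velocity (h s hs))).continuousAt.continuousWithinAt
  have h2 : IntervalIntegrable (fun s => g.inner (γ s) (tension g γ s) (tension g γ s))
      MeasureTheory.volume a b := ContinuousOn.intervalIntegrable_of_Icc hab fun s hs =>
    ((smoothAlongAt_tension g (h s hs)).contDiffAt_inner g
      (smoothAlongAt_tension g (h s hs))).continuousAt.continuousWithinAt
  rw [sesquiEnergy, ← intervalIntegral.integral_const_mul, ← intervalIntegral.integral_const_mul,
    ← intervalIntegral.integral_add (h1.const_mul _) (h2.const_mul _)]
  rfl

variable {Γ : ℝ → ℝ → M} {J : Set ℝ} {a b ε₀ : ℝ}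

theorem variationField_eq_zero (hε₀ : 0 < ε₀) {s : ℝ}
    (h : ∀ ε ∈ Ioo (-ε₀) ε₀, Γ ε s = Γ 0 s) : variationField (m := m) Γ 0 s = 0 := by
  have h1 : (fun ε => Γ ε s) =ᶠ[nhds 0] fun _ => Γ 0 s := by
    filter_upwards [Ioo_mem_nhds (by linarith : -ε₀ < 0) hε₀] with ε hε using h ε hε
  have h2 := h1.mfderiv_eq (I := 𝓘(ℝ, ℝ)) (I' := 𝓡 m)
  rw [mfderiv_const] at h2
  exact congrArg (fun L : ℝ →L[ℝ] Model m => L (1 : ℝ)) h2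

theorem covDerivAlong_zero (g : RMetric m M) (γ : ℝ → M) (s : ℝ) :
    covDerivAlong g γ (fun _ => 0) s = 0 := by
  rw [covDerivAlong]
  simp [christoffel_eq]

/-- The boundary term vanishes where the variation is trivial, hence at the endpoints. -/
theorem boundaryTerm_variationField_eq_zero (g : RMetric m M) (δ₁ δ₂ : ℝ) (hε₀ : 0 < ε₀)
    (hJ : IsOpen J) (hsupp : ∀ ε ∈ Ioo (-ε₀) ε₀, ∀ s ∈ J \ Icc a b, Γ ε s = Γ 0 s)
    {s : ℝ} (hs : s ∈ J \ Icc a b) :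
    boundaryTerm g δ₁ δ₂ (Γ 0) (variationField Γ 0) s = 0 := by
  have h1 : ∀ t ∈ J \ Icc a b, variationField (m := m) Γ 0 t = 0 := fun t ht =>
    variationField_eq_zero hε₀ fun ε hε => hsupp ε hε t ht
  have h2 : covDerivAlong g (Γ 0) (variationField Γ 0) s = 0 := by
    rw [← covDerivAlong_zero g (Γ 0) s]
    apply covDerivAlong_congr
    filter_upwards [(hJ.sdiff isClosed_Icc).mem_nhds hs] with t ht using h1 t ht
  rw [boundaryTerm, h1 s hs, h2]
  simp

/-- The first variation formula. -/
theorem hasDerivAt_sesquiEnergy (g : RMetric m M) (δ₁ δ₂ : ℝ) (hJ : IsOpen J) (hab : a < b)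
    (habJ : Icc a b ⊆ J) (hε₀ : 0 < ε₀)
    (hΓ : ContMDiffOn 𝓘(ℝ, ℝ × ℝ) (𝓡 m) ∞ (fun q : ℝ × ℝ => Γ q.1 q.2) (Ioo (-ε₀) ε₀ ×ˢ J))
    (hsupp : ∀ ε ∈ Ioo (-ε₀) ε₀, ∀ s ∈ J \ Icc a b, Γ ε s = Γ 0 s) :
    ContinuousOn (fun s => 2 * g.inner (Γ 0 s) (variationField Γ 0 s)
        (eulerLagrange g δ₁ δ₂ (Γ 0) s)) J ∧
      HasDerivAt (fun ε => sesquiEnergy g δ₁ δ₂ a b (Γ ε)) (∫ s in a..b,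
        2 * g.inner (Γ 0 s) (variationField Γ 0 s) (eulerLagrange g δ₁ δ₂ (Γ 0) s)) 0 := by
  have h0 : (0 : ℝ) ∈ Ioo (-ε₀) ε₀ := ⟨by linarith, hε₀⟩
  have hΓat : ∀ ε ∈ Ioo (-ε₀) ε₀, ∀ s ∈ J, ∀ᶠ z in nhds (ε, s),
      ContMDiffAt 𝓘(ℝ, ℝ × ℝ) (𝓡 m) ∞ (fun z : ℝ × ℝ => Γ z.1 z.2) z := by
    intro ε hε s hs
    have ho : IsOpen (Ioo (-ε₀) ε₀ ×ˢ J) := isOpen_Ioo.prod hJ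
    filter_upwards [ho.mem_nhds ⟨hε, hs⟩] with z hz using hΓ.contMDiffAt (ho.mem_nhds hz)
  have hE : (fun ε => sesquiEnergy g δ₁ δ₂ a b (Γ ε)) =ᶠ[nhds 0]
      fun ε => ∫ s in a..b, energyDensity g δ₁ δ₂ (Γ ε) s := by
    filter_upwards [Ioo_mem_nhds h0.1 h0.2] with ε hε
    exact sesquiEnergy_eq_integral g δ₁ δ₂ hab.le fun s hs =>
      contMDiffAt_slice (q := (ε, s)) (hΓat ε hε s (habJ hs)).self_of_nhds
  have hsm : ∀ ε ∈ Ioo (-ε₀) ε₀, ∀ s ∈ J,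
      ContDiffAt ℝ ∞ (fun z : ℝ × ℝ => energyDensity g δ₁ δ₂ (Γ z.1) z.2) (ε, s) :=
    fun ε hε s hs => contDiffAt_energyDensity g δ₁ δ₂ (hΓat ε hε s hs)
  have hV : ∀ s ∈ J, SmoothAlongAt (m := m) (Γ 0) (variationField Γ 0) s := fun s hs =>
    smoothAlongAt_variationField (hΓat 0 h0 s hs)
  have hB : ∀ s ∈ J, HasDerivAt (boundaryTerm g δ₁ δ₂ (Γ 0) (variationField Γ 0))
      (fderiv ℝ (fun z : ℝ × ℝ => energyDensity g δ₁ δ₂ (Γ z.1) z.2) (0, s) (1, 0)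
        - 2 * g.inner (Γ 0 s) (variationField Γ 0 s) (eulerLagrange g δ₁ δ₂ (Γ 0) s)) s := by
    intro s hs
    rw [fderiv_energyDensity g δ₁ δ₂ (hΓat 0 h0 s hs)]
    exact hasDerivAt_boundaryTerm g δ₁ δ₂ (hV s hs)
  -- The boundary term is continuous on `J` and vanishes outside `[a, b]`. Each endpoint is a limit
  -- of such outside points, so it vanishes there too.
  have hB0 : ∀ s ∈ J, (∃ᶠ t in nhds s, t ∉ Icc a b) →
      boundaryTerm g δ₁ δ₂ (Γ 0) (variationField Γ 0) s = 0 := by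
    intro s hs hfr
    by_contra hne
    refine hfr ?_
    filter_upwards [(hB s hs).continuousAt.eventually_ne hne, hJ.mem_nhds hs] with t ht htJ htn
    exact ht (boundaryTerm_variationField_eq_zero g δ₁ δ₂ hε₀ hJ hsupp ⟨htJ, htn⟩)
  have hBa := hB0 a (habJ ⟨le_rfl, hab.le⟩) (by
    have : ∃ᶠ t in nhdsWithin a (Iio a), t ∉ Icc a b :=
      (Filter.Eventually.frequently (by
        filter_upwards [self_mem_nhdsWithin] with t ht hti using absurd hti.1 (not_le.2 ht)))
    exact this.filter_mono nhdsWithin_le_nhds)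
  have hBb := hB0 b (habJ ⟨hab.le, le_rfl⟩) (by
    have : ∃ᶠ t in nhdsWithin b (Ioi b), t ∉ Icc a b :=
      (Filter.Eventually.frequently (by
        filter_upwards [self_mem_nhdsWithin] with t ht hti using absurd hti.2 (not_le.2 ht)))
    exact this.filter_mono nhdsWithin_le_nhds)
  have hF : ∀ s ∈ J, ContinuousAt (fun s =>
      fderiv ℝ (fun z : ℝ × ℝ => energyDensity g δ₁ δ₂ (Γ z.1) z.2) (0, s) (1, 0)) s := fun s hs =>
    ((hsm 0 h0 s hs).fderiv_infty.clm_apply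
      (contDiffAt_const (c := ((1, 0) : ℝ × ℝ)))).continuousAt.comp (f := fun s : ℝ => ((0 : ℝ), s))
      (by fun_prop : ContinuousAt (fun s : ℝ => ((0 : ℝ), s)) s)
  -- Continuity of the pairing with the Euler-Lagrange expression comes from `hB`: it is the
  -- derivative of the energy density minus that of the boundary term, both continuous.
  have hEL : ∀ s ∈ J, ContinuousAt (fun s =>
      2 * g.inner (Γ 0 s) (variationField Γ 0 s) (eulerLagrange g δ₁ δ₂ (Γ 0) s)) s := by
    intro s hs
    have hB' : ContinuousAt
        (fun s => fderiv ℝ (boundaryTerm g δ₁ δ₂ (Γ 0) (variationField Γ 0)) s 1) s :=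
      ((contDiffAt_boundaryTerm g δ₁ δ₂ (hV s hs)).fderiv_infty.clm_apply
        contDiffAt_const).continuousAt
    refine ((hF s hs).sub hB').congr ?_
    filter_upwards [hJ.mem_nhds hs] with t ht
    rw [Pi.sub_apply, fderiv_apply_one_eq_deriv, (hB t ht).deriv]
    ring
  refine ⟨fun s hs => (hEL s hs).continuousWithinAt, ?_⟩
  refine HasDerivAt.congr_of_eventuallyEq ?_ hE
  refine (hasDerivAt_integral_of_contDiffAt
    (e := fun z : ℝ × ℝ => energyDensity g δ₁ δ₂ (Γ z.1) z.2) hab.le hε₀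
    fun ε hε s hs => hsm ε hε s (habJ hs)).congr_deriv ?_
  have i1 := ContinuousOn.intervalIntegrable_of_Icc (μ := MeasureTheory.volume) hab.le
    fun s hs => (hF s (habJ hs)).continuousWithinAt
  have i2 := ContinuousOn.intervalIntegrable_of_Icc (μ := MeasureTheory.volume) hab.le
    fun s hs => (hEL s (habJ hs)).continuousWithinAt
  have hint := intervalIntegral.integral_eq_sub_of_hasDerivAt (a := a) (b := b)
    (fun s hs => hB s (habJ (by rwa [uIcc_of_le hab.le] at hs))) (i1.sub i2)
  rw [hBa, hBb, intervalIntegral.integral_sub i1 i2] at hint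
  linarith

end Riemannian

/-! ### Compactly supported test variations -/

section Riemannian

variable {m : ℕ} {M : Type*} [TopologicalSpace M] [ChartedSpace (Model m) M]
  [IsManifold (𝓡 m) ∞ M]

open Classical in
/-- The variation of `γ` near `s₀` in the constant coordinate direction `w`, cut off by `χ`. -/
def bumpVariation (γ : ℝ → M) (s₀ ρ : ℝ) (w : Model m) (χ : ℝ → ℝ) (ε s : ℝ) : M :=
  if |s - s₀| < ρ then coordPoint (γ s₀) (coordCurve (γ s₀) γ s + (ε * χ s) • w) else γ s

section

variable {γ : ℝ → M} {J : Set ℝ} {s₀ ρ η r : ℝ} {w : Model m} {χ : ℝ → ℝ}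

theorem bumpVariation_zero (hdom : ∀ s, |s - s₀| < ρ → γ s ∈ chartDom (m := m) (γ s₀)) :
    bumpVariation γ s₀ ρ w χ 0 = γ := by
  funext s
  unfold bumpVariation
  split_ifs with h
  · rw [zero_mul, zero_smul, add_zero]
    exact coordPoint_coordOf (hdom s h)
  · rfl

theorem bumpVariation_of_eq_zero (hdom : ∀ s, |s - s₀| < ρ → γ s ∈ chartDom (m := m) (γ s₀))
    {s : ℝ} (hs : χ s = 0) (ε : ℝ) : bumpVariation γ s₀ ρ w χ ε s = γ s := by
  unfold bumpVariation
  split_ifs with h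
  · rw [hs, mul_zero, zero_smul, add_zero]
    exact coordPoint_coordOf (hdom s h)
  · rfl

theorem bump_mem (hη : ∀ s, |s - s₀| < ρ → ∀ v : Model m, ‖v‖ < η →
      coordCurve (γ s₀) γ s + v ∈ chartRange (m := m) (γ s₀))
    (hχ : ∀ s, |χ s| ≤ 1) {ε s : ℝ}
    (hε : ε ∈ Ioo (-(η / (‖w‖ + 1))) (η / (‖w‖ + 1))) (hs : |s - s₀| < ρ) :
    coordCurve (γ s₀) γ s + (ε * χ s) • w ∈ chartRange (m := m) (γ s₀) := by
  refine hη s hs _ ?_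
  -- The `+ 1` keeps the bound on `ε` meaningful for `w = 0`; the displacement still has norm less
  -- than `η`.
  have hw : 0 < ‖w‖ + 1 := by positivity
  have h1 : |ε| < η / (‖w‖ + 1) := abs_lt.2 hε
  rw [lt_div_iff₀ hw] at h1
  rw [norm_smul, Real.norm_eq_abs, abs_mul]
  nlinarith [abs_nonneg ε, abs_nonneg (χ s), norm_nonneg w, hχ s,
    mul_le_of_le_one_right (abs_nonneg ε) (hχ s)]

/-- For `|s - s₀| > r` the map is `γ`, and for `|s - s₀| < ρ` it is a smooth formula in the chart.
As `r < ρ`, these open regions cover everything. -/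
theorem contMDiffOn_bumpVariation (hγ : ∀ s ∈ J, ContMDiffAt 𝓘(ℝ, ℝ) (𝓡 m) ∞ γ s)
    (hdom : ∀ s, |s - s₀| < ρ → γ s ∈ chartDom (m := m) (γ s₀))
    (hη : ∀ s, |s - s₀| < ρ → ∀ v : Model m, ‖v‖ < η →
      coordCurve (γ s₀) γ s + v ∈ chartRange (m := m) (γ s₀))
    (hχ : ∀ s, |χ s| ≤ 1) (hχs : ContDiff ℝ ∞ χ) (hr : r < ρ)
    (hχr : ∀ s, r < |s - s₀| → χ s = 0) :
    ContMDiffOn 𝓘(ℝ, ℝ × ℝ) (𝓡 m) ∞ (fun q : ℝ × ℝ => bumpVariation γ s₀ ρ w χ q.1 q.2)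
      (Ioo (-(η / (‖w‖ + 1))) (η / (‖w‖ + 1)) ×ˢ J) := by
  rintro ⟨ε, s⟩ ⟨hε, hs⟩
  refine ContMDiffAt.contMDiffWithinAt ?_
  have h2 : ContMDiffAt 𝓘(ℝ, ℝ × ℝ) 𝓘(ℝ, ℝ) ∞ (fun q : ℝ × ℝ => q.2) (ε, s) :=
    contMDiffAt_iff_contDiffAt.2 contDiffAt_snd
  by_cases hsr : r < |s - s₀|
  · have h1 : ContMDiffAt 𝓘(ℝ, ℝ × ℝ) (𝓡 m) ∞ (fun q : ℝ × ℝ => γ q.2) (ε, s) :=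
      ContMDiffAt.comp (f := fun q : ℝ × ℝ => q.2) (ε, s) (hγ s hs) h2
    refine h1.congr_of_eventuallyEq ?_
    have hc : ContinuousAt (fun q : ℝ × ℝ => |q.2 - s₀|) (ε, s) := by fun_prop
    filter_upwards [hc.eventually (lt_mem_nhds hsr)] with q hq
    exact bumpVariation_of_eq_zero hdom (hχr _ hq) _
  · have hsρ : |s - s₀| < ρ := lt_of_le_of_lt (not_lt.1 hsr) hr
    have hY : ContDiffAt ℝ ∞
        (fun q : ℝ × ℝ => coordCurve (m := m) (γ s₀) γ q.2 + (q.1 * χ q.2) • w) (ε, s) :=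
      (ContDiffAt.comp (ε, s) (contDiffAt_coordCurve (hγ s hs) (hdom s hsρ)) contDiffAt_snd).add
        ((contDiffAt_fst.mul (hχs.contDiffAt.comp (ε, s) contDiffAt_snd)).smul contDiffAt_const)
    have h1 : ContMDiffAt 𝓘(ℝ, ℝ × ℝ) (𝓡 m) ∞
        (fun q : ℝ × ℝ => coordPoint (m := m) (γ s₀)
          (coordCurve (γ s₀) γ q.2 + (q.1 * χ q.2) • w)) (ε, s) :=
      ContMDiffAt.comp (g := coordPoint (m := m) (γ s₀)) (ε, s)
        (contMDiffAt_coordPoint (bump_mem hη hχ hε hsρ)) (contMDiffAt_iff_contDiffAt.2 hY)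
    refine h1.congr_of_eventuallyEq ?_
    have hc : ContinuousAt (fun q : ℝ × ℝ => |q.2 - s₀|) (ε, s) := by fun_prop
    filter_upwards [hc.eventually (gt_mem_nhds hsρ)] with q hq
    exact if_pos hq

theorem coordRep_variationField_bumpVariation
    (hdom : ∀ s, |s - s₀| < ρ → γ s ∈ chartDom (m := m) (γ s₀))
    (hη : ∀ s, |s - s₀| < ρ → ∀ v : Model m, ‖v‖ < η →
      coordCurve (γ s₀) γ s + v ∈ chartRange (m := m) (γ s₀))
    (hη0 : 0 < η) (hχ : ∀ s, |χ s| ≤ 1) {s : ℝ} (hs : |s - s₀| < ρ) :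
    coordRep (γ s₀) (bumpVariation γ s₀ ρ w χ 0 s) (variationField (bumpVariation γ s₀ ρ w χ) 0 s)
      = χ s • w := by
  have hw : 0 < η / (‖w‖ + 1) := by positivity
  have h0 : (0 : ℝ) ∈ Ioo (-(η / (‖w‖ + 1))) (η / (‖w‖ + 1)) := ⟨by linarith, hw⟩
  have hY : ContDiffAt ℝ ∞
      (fun ε : ℝ => coordCurve (m := m) (γ s₀) γ s + (ε * χ s) • w) 0 := by fun_prop
  have hΓ : (fun ε => bumpVariation γ s₀ ρ w χ ε s)
      = fun ε => coordPoint (γ s₀) (coordCurve (γ s₀) γ s + (ε * χ s) • w) := by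
    funext ε
    exact if_pos hs
  have h1 : ContMDiffAt 𝓘(ℝ, ℝ) (𝓡 m) ∞ (fun ε => bumpVariation γ s₀ ρ w χ ε s) 0 := by
    rw [hΓ]
    exact ContMDiffAt.comp (g := coordPoint (m := m) (γ s₀)) 0
      (contMDiffAt_coordPoint (bump_mem hη hχ h0 hs)) (contMDiffAt_iff_contDiffAt.2 hY)
  have hd : bumpVariation γ s₀ ρ w χ 0 s ∈ chartDom (m := m) (γ s₀) := by
    rw [bumpVariation_zero hdom]; exact hdom s hs
  refine (coordRep_velocity (h1.mdifferentiableAt (by simp)) hd).trans ?_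
  have h2 : coordCurve (m := m) (γ s₀) (fun ε => bumpVariation γ s₀ ρ w χ ε s) =ᶠ[nhds 0]
      fun ε : ℝ => coordCurve (m := m) (γ s₀) γ s + (ε * χ s) • w := by
    filter_upwards [Ioo_mem_nhds h0.1 h0.2] with ε hε
    rw [coordCurve, congrFun hΓ ε]
    exact coordOf_coordPoint (bump_mem hη hχ hε hs)
  have h3 : HasDerivAt (fun ε : ℝ => coordCurve (m := m) (γ s₀) γ s + (ε * χ s) • w)
      ((1 * χ s) • w) 0 :=
    (((hasDerivAt_id (0 : ℝ)).mul_const (χ s)).smul_const w).const_add _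
  rw [h2.fderiv_eq, fderiv_apply_one_eq_deriv, h3.deriv, one_mul]

end

theorem exists_bump_radius {γ : ℝ → M} {J : Set ℝ} (hJ : IsOpen J) {s₀ : ℝ} (hs₀ : s₀ ∈ J)
    (hγ : ContinuousAt γ s₀) : ∃ ρ > 0, ∃ η > 0, (∀ s, |s - s₀| < ρ → s ∈ J) ∧
      (∀ s, |s - s₀| < ρ → γ s ∈ chartDom (m := m) (γ s₀)) ∧
      ∀ s, |s - s₀| < ρ → ∀ v : Model m, ‖v‖ < η →
        coordCurve (γ s₀) γ s + v ∈ chartRange (m := m) (γ s₀) := by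
  have hp := mem_chartDom (m := m) (γ s₀)
  obtain ⟨η, hη, hball⟩ := Metric.isOpen_iff.1 (isOpen_chartRange (m := m) (γ s₀)) _
    (coordOf_mem hp)
  have hc : ContinuousAt (coordCurve (m := m) (γ s₀) γ) s₀ :=
    ContinuousAt.comp (f := γ) (contMDiffAt_coordOf hp).continuousAt hγ
  have he : ∀ᶠ s in nhds s₀, s ∈ J ∧ γ s ∈ chartDom (m := m) (γ s₀) ∧
      coordCurve (m := m) (γ s₀) γ s ∈ Metric.ball (coordCurve (γ s₀) γ s₀) (η / 2) :=
    Filter.Eventually.and (hJ.mem_nhds hs₀) ((eventually_mem_chartDom hγ hp).and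
      (hc.eventually (Metric.ball_mem_nhds _ (by positivity))))
  obtain ⟨ρ, hρ, hρs⟩ := Metric.eventually_nhds_iff.1 he
  -- Half of the radius of the ball in the chart range absorbs the motion of `γ`, the other half the
  -- displacement `v`.
  refine ⟨ρ, hρ, η / 2, by positivity, fun s hs => (hρs hs).1, fun s hs => (hρs hs).2.1,
    fun s hs v hv => hball ?_⟩
  have h1 := (hρs hs).2.2
  rw [Metric.mem_ball] at h1 ⊢
  calc dist (coordCurve (γ s₀) γ s + v) (coordOf (γ s₀) (γ s₀))
      ≤ dist (coordCurve (γ s₀) γ s + v) (coordCurve (γ s₀) γ s)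
        + dist (coordCurve (γ s₀) γ s) (coordCurve (γ s₀) γ s₀) := dist_triangle _ _ _
    _ < η / 2 + η / 2 := by
        refine add_lt_add ?_ h1
        rwa [dist_eq_norm, add_sub_cancel_left]
    _ = η := by ring

end Riemannian

/-! ### Critical points are the solutions of the Euler-Lagrange equation -/

section Riemannian

variable {m : ℕ} {M : Type*} [TopologicalSpace M] [ChartedSpace (Model m) M]
  [IsManifold (𝓡 m) ∞ M]

/-- The pairing of the Euler-Lagrange expression with the coordinate vector field `w`. -/
def eulerLagrangePairing (g : RMetric m M) (δ₁ δ₂ : ℝ) (γ : ℝ → M) (p : M) (w : Model m)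
    (s : ℝ) : ℝ :=
  metricCoord g p (coordCurve p γ s) w (coordField p γ (eulerLagrange g δ₁ δ₂ γ) s)

section

variable {g : RMetric m M} {δ₁ δ₂ : ℝ} {J : Set ℝ} {γ : ℝ → M} {s₀ ρ η : ℝ}

/-- Criticality tested on the variation with field `χ w`. The continuity statement is inherited from
the first variation formula and is what the positivity argument for the integral requires. -/
theorem bump_pairing_of_isInterpolatingSesquiHarmonic (hJ : IsOpen J)
    (hγ : ∀ s ∈ J, ContMDiffAt 𝓘(ℝ, ℝ) (𝓡 m) ∞ γ s)
    (hI : IsInterpolatingSesquiHarmonic g δ₁ δ₂ J γ) (hη0 : 0 < η)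
    (hρJ : ∀ s, |s - s₀| < ρ → s ∈ J)
    (hdom : ∀ s, |s - s₀| < ρ → γ s ∈ chartDom (m := m) (γ s₀))
    (hη : ∀ s, |s - s₀| < ρ → ∀ v : Model m, ‖v‖ < η →
      coordCurve (γ s₀) γ s + v ∈ chartRange (m := m) (γ s₀)) (w : Model m)
    (χ : ContDiffBump s₀) (hχ : χ.rOut < ρ) :
    ContinuousOn (fun s => χ s * eulerLagrangePairing g δ₁ δ₂ γ (γ s₀) w s)
        (Metric.ball s₀ ρ) ∧
      ∫ s in (s₀ - χ.rOut)..(s₀ + χ.rOut),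
        χ s * eulerLagrangePairing g δ₁ δ₂ γ (γ s₀) w s = 0 := by
  have hr := χ.rOut_pos
  have hχ1 : ∀ s, |χ s| ≤ 1 := fun s => by
    rw [abs_of_nonneg χ.nonneg]; exact χ.le_one
  have hχr : ∀ s, χ.rOut < |s - s₀| → χ s = 0 := fun s hs =>
    χ.zero_of_le_dist (by rw [Real.dist_eq]; exact hs.le)
  have h0 := bumpVariation_zero (w := w) (χ := χ) hdom
  have hsm := contMDiffOn_bumpVariation (w := w) hγ hdom hη hχ1 χ.contDiff hχ hχr
  have hε : 0 < η / (‖w‖ + 1) := by positivity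
  have habs : ∀ s, s ∈ Icc (s₀ - χ.rOut) (s₀ + χ.rOut) ↔ |s - s₀| ≤ χ.rOut := fun s => by
    rw [abs_le, mem_Icc]; constructor <;> intro h <;> constructor <;> linarith [h.1, h.2]
  have hsubJ : Icc (s₀ - χ.rOut) (s₀ + χ.rOut) ⊆ J := fun s hs =>
    hρJ s (((habs s).1 hs).trans_lt hχ)
  have hout : ∀ ε, ∀ s ∈ J \ Icc (s₀ - χ.rOut) (s₀ + χ.rOut),
      bumpVariation γ s₀ ρ w χ ε s = γ s := fun ε s hs =>
    bumpVariation_of_eq_zero hdom (hχr s (not_le.1 fun h => hs.2 ((habs s).2 h))) ε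
  have hcrit := hI _ _ (by linarith) hsubJ _ hε (bumpVariation γ s₀ ρ w χ) hsm
    (fun s _ => by rw [h0]) (fun ε _ s hs => hout ε s hs)
  obtain ⟨hc, hd⟩ := hasDerivAt_sesquiEnergy g δ₁ δ₂ hJ (by linarith) hsubJ hε hsm
    (fun ε _ s hs => by rw [hout ε s hs, hout 0 s hs])
  have key : ∀ s, |s - s₀| < ρ →
      2 * g.inner (bumpVariation γ s₀ ρ w χ 0 s) (variationField (bumpVariation γ s₀ ρ w χ) 0 s)
        (eulerLagrange g δ₁ δ₂ (bumpVariation γ s₀ ρ w χ 0) s)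
      = 2 * (χ s * eulerLagrangePairing g δ₁ δ₂ γ (γ s₀) w s) := by
    intro s hs
    rw [inner_eq_metricCoord g (p := γ s₀) (by rw [h0]; exact hdom s hs),
      coordRep_variationField_bumpVariation hdom hη hη0 hχ1 hs, h0, map_smul]
    rfl
  constructor
  · have h2 : ContinuousOn (fun s => (1 / 2 : ℝ) * (2 *
        g.inner (bumpVariation γ s₀ ρ w χ 0 s) (variationField (bumpVariation γ s₀ ρ w χ) 0 s)
        (eulerLagrange g δ₁ δ₂ (bumpVariation γ s₀ ρ w χ 0) s))) (Metric.ball s₀ ρ) :=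
      continuousOn_const.mul (hc.mono fun s hs => hρJ s hs)
    refine h2.congr fun s hs => ?_
    simp only [key s hs]
    ring
  · have h3 := hd.unique hcrit
    rw [intervalIntegral.integral_congr (g := fun s =>
      2 * (χ s * eulerLagrangePairing g δ₁ δ₂ γ (γ s₀) w s)) ?_,
      intervalIntegral.integral_const_mul] at h3
    · linarith
    · intro s hs
      rw [uIcc_of_le (by linarith)] at hs
      exact key s (((habs s).1 hs).trans_lt hχ)

/-- The fundamental lemma of the calculus of variations. With `w` the components of the
Euler-Lagrange expression at `s₀`, the pairing is positive at `s₀`, hence nearby, and a narrow bump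
gives a positive integral. -/
theorem eulerLagrange_eq_zero_of_isInterpolatingSesquiHarmonic (hJ : IsOpen J)
    (hγ : ∀ s ∈ J, ContMDiffAt 𝓘(ℝ, ℝ) (𝓡 m) ∞ γ s)
    (hI : IsInterpolatingSesquiHarmonic g δ₁ δ₂ J γ) (hs₀ : s₀ ∈ J) :
    eulerLagrange g δ₁ δ₂ γ s₀ = 0 := by
  by_contra hne
  obtain ⟨ρ, hρ, η, hη0, hρJ, hdom, hη⟩ := exists_bump_radius (m := m) hJ hs₀ (hγ s₀ hs₀).continuousAt
  have hp := mem_chartDom (m := m) (γ s₀)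
  set w : Model m := coordField (γ s₀) γ (eulerLagrange g δ₁ δ₂ γ) s₀ with hw
  have hw0 : w ≠ 0 := fun h => hne (coordRep_injective hp (h.trans (map_zero _).symm))
  set q := eulerLagrangePairing g δ₁ δ₂ γ (γ s₀) w with hq
  have hq0 : 0 < q s₀ := (isMetricOn_metricCoord g (γ s₀)).pos _ (coordOf_mem hp) w hw0
  have key := fun χ : ContDiffBump s₀ =>
    bump_pairing_of_isInterpolatingSesquiHarmonic hJ hγ hI hη0 hρJ hdom hη w χ
  -- Only `χ q` is known to be continuous. A bump equal to `1` near `s₀` transfers this to `q`.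
  have hqc : ContinuousAt q s₀ := by
    let χ : ContDiffBump s₀ := ⟨ρ / 4, ρ / 2, by positivity, by linarith⟩
    have h1 := (key χ (by change ρ / 2 < ρ; linarith)).1.continuousAt (Metric.ball_mem_nhds _ hρ)
    refine h1.congr ?_
    filter_upwards [χ.eventuallyEq_one] with s hs
    simp only [hs, Pi.one_apply, one_mul, hq]
  obtain ⟨δ, hδ, hδq⟩ := Metric.eventually_nhds_iff.1 (hqc.eventually (lt_mem_nhds hq0))
  have hm : 0 < min δ ρ := lt_min hδ hρ
  let χ : ContDiffBump s₀ := ⟨min δ ρ / 4, min δ ρ / 2, by positivity, by linarith⟩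
  have hχ : χ.rOut = min δ ρ / 2 := rfl
  obtain ⟨hc, hint⟩ := key χ (by rw [hχ]; linarith [min_le_right δ ρ])
  have hsub : ∀ s ∈ Icc (s₀ - χ.rOut) (s₀ + χ.rOut), dist s s₀ < min δ ρ := fun s hs => by
    rw [Real.dist_eq, abs_lt]; rw [hχ] at hs; constructor <;> linarith [hs.1, hs.2]
  refine absurd hint (ne_of_gt (intervalIntegral.integral_pos (by rw [hχ]; linarith)
    (hc.mono fun s hs => (hsub s hs).trans_le (min_le_right _ _)) ?_ ⟨s₀, ?_, ?_⟩))
  · intro s hs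
    exact mul_nonneg χ.nonneg (hδq ((hsub s (Ioc_subset_Icc_self hs)).trans_le (min_le_left _ _))).le
  · rw [hχ]; constructor <;> linarith
  · rw [χ.one_of_mem_closedBall (Metric.mem_closedBall_self χ.rIn_pos.le), one_mul]
    exact hq0

open Classical in
/-- The critical points of `sesquiEnergy` are the solutions of its Euler-Lagrange equation. -/
theorem isInterpolatingSesquiHarmonic_iff (hJ : IsOpen J)
    (hγ : ContMDiffOn 𝓘(ℝ, ℝ) (𝓡 m) ∞ γ J) :
    IsInterpolatingSesquiHarmonic g δ₁ δ₂ J γ ↔ ∀ s ∈ J, eulerLagrange g δ₁ δ₂ γ s = 0 := by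
  have hγ' : ∀ s ∈ J, ContMDiffAt 𝓘(ℝ, ℝ) (𝓡 m) ∞ γ s := fun s hs =>
    hγ.contMDiffAt (hJ.mem_nhds hs)
  refine ⟨fun hI s hs => eulerLagrange_eq_zero_of_isInterpolatingSesquiHarmonic hJ hγ' hI hs, ?_⟩
  intro hEL a b hab habJ ε₀ hε₀ Γ hΓ hΓ0 hsupp
  -- A variation is only constrained on `J`. Redefining it as `γ` elsewhere gives `Γ' 0 = γ` as
  -- functions, so that fields along the two curves have the same type; by locality the energies do
  -- not change.
  obtain ⟨Γ', hΓ'⟩ : ∃ Γ' : ℝ → ℝ → M, Γ' = fun ε s => if s ∈ J then Γ ε s else γ s := ⟨_, rfl⟩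
  have hin : ∀ ε, ∀ s ∈ J, Γ' ε s = Γ ε s := fun ε s hs => by rw [hΓ']; exact if_pos hs
  have h0 : Γ' 0 = γ := by
    funext s
    by_cases hs : s ∈ J
    · rw [hin 0 s hs, hΓ0 s hs]
    · rw [hΓ']; exact if_neg hs
  have hsm : ContMDiffOn 𝓘(ℝ, ℝ × ℝ) (𝓡 m) ∞ (fun q : ℝ × ℝ => Γ' q.1 q.2)
      (Ioo (-ε₀) ε₀ ×ˢ J) := hΓ.congr fun q hq => hin q.1 q.2 hq.2
  have hd := (hasDerivAt_sesquiEnergy g δ₁ δ₂ hJ hab habJ hε₀ hsm fun ε hε s hs => by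
    rw [h0, hin ε s hs.1, hsupp ε hε s hs]).2
  have hzero : ∀ s ∈ uIcc a b, 2 * g.inner (Γ' 0 s) (variationField Γ' 0 s)
      (eulerLagrange g δ₁ δ₂ (Γ' 0) s) = 0 := by
    intro s hs
    rw [uIcc_of_le hab.le] at hs
    have : eulerLagrange g δ₁ δ₂ (Γ' 0) s = 0 := by rw [h0]; exact hEL s (habJ hs)
    rw [this, map_zero, mul_zero]
  rw [intervalIntegral.integral_congr (g := fun _ => (0 : ℝ)) hzero,
    intervalIntegral.integral_zero] at hd
  refine hd.congr_of_eventuallyEq ?_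
  filter_upwards [Ioo_mem_nhds (by linarith : -ε₀ < 0) hε₀] with ε hε
  have hΓat : ∀ s ∈ Icc a b, ContMDiffAt 𝓘(ℝ, ℝ) (𝓡 m) ∞ (Γ ε) s := fun s hs =>
    contMDiffAt_slice (q := (ε, s))
      (hΓ.contMDiffAt ((isOpen_Ioo.prod hJ).mem_nhds ⟨hε, habJ hs⟩))
  have hev : ∀ s ∈ Icc a b, Γ' ε =ᶠ[nhds s] Γ ε := fun s hs => by
    filter_upwards [hJ.mem_nhds (habJ hs)] with t ht using hin ε t ht
  rw [sesquiEnergy_eq_integral g δ₁ δ₂ hab.le hΓat,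
    sesquiEnergy_eq_integral g δ₁ δ₂ hab.le fun s hs =>
      (hΓat s hs).congr_of_eventuallyEq (hev s hs)]
  refine intervalIntegral.integral_congr fun s hs => ?_
  rw [uIcc_of_le hab.le] at hs
  exact (energyDensity_congr g δ₁ δ₂ (hΓat s hs) (hev s hs)).symm

end

end Riemannian

/-- A curvature-like tensor of Kähler type whose holomorphic sectional curvatures vanish has
vanishing sectional curvatures. -/
theorem sectional_eq_zero_of_holomorphic {V : Type*} [AddCommGroup V] {Q : V → V → V → V → ℝ}
    {j : V → V} (jadd : ∀ x y, j (x + y) = j x + j y) (jj : ∀ x, j (j x) = -x)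
    (hadd : ∀ u u' v w z, Q (u + u') v w z = Q u v w z + Q u' v w z)
    (hanti : ∀ u v w z, Q u v w z = -Q v u w z)
    (hpair : ∀ u v w z, Q u v w z = Q w z u v)
    (hbianchi : ∀ u v w z, Q u v w z + Q v w u z + Q w u v z = 0)
    (hj : ∀ u v w z, Q u v (j w) z = -Q u v w (j z))
    (hhol : ∀ x, Q x (j x) (j x) x = 0) (x y : V) : Q x y y x = 0 := by
  have hanti' : ∀ u v w z, Q u v w z = -Q u v z w := fun u v w z => by
    rw [hpair, hanti, hpair z w]
  have hadd2 : ∀ u v v' w z, Q u (v + v') w z = Q u v w z + Q u v' w z := fun u v v' w z => by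
    rw [hanti, hadd, hanti v, hanti v']; ring
  have hadd3 : ∀ u v w w' z, Q u v (w + w') z = Q u v w z + Q u v w' z := fun u v w w' z => by
    rw [hpair, hadd, hpair w, hpair w']
  have hadd4 : ∀ u v w z z', Q u v w (z + z') = Q u v w z + Q u v w z' := fun u v w z z' => by
    rw [hpair, hadd2, hpair w z, hpair w z']
  have hneg : ∀ u v w z, Q (-u) v w z = -Q u v w z := fun u v w z => by
    have h0 := hadd 0 0 v w z
    have h1 := hadd u (-u) v w z
    rw [add_zero] at h0
    rw [add_neg_cancel] at h1
    linarith
  have hneg2 : ∀ u v w z, Q u (-v) w z = -Q u v w z := fun u v w z => by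
    rw [hanti, hneg, hanti v]; ring
  have hneg3 : ∀ u v w z, Q u v (-w) z = -Q u v w z := fun u v w z => by
    rw [hpair, hneg, hpair w]
  have hneg4 : ∀ u v w z, Q u v w (-z) = -Q u v w z := fun u v w z => by
    rw [hpair, hneg2, hpair w]
  have jneg : ∀ x, j (-x) = -j x := fun x => by
    rw [← jj x, jj (j x)]
  have hjj : ∀ u v w z, Q u v (j w) (j z) = Q u v w z := fun u v w z => by
    rw [hj, jj, hneg4, neg_neg]
  have hjj' : ∀ u v w z, Q (j u) (j v) w z = Q u v w z := fun u v w z => by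
    rw [hpair, hjj, hpair]
  -- Adding the hypothesis at `y + t` and `y - t` keeps the part quadratic in both. It equals `2
  -- Q(y, jy, jt, t) + 4 Q(y, jt, jt, y)`, and Bianchi splits the first term into sectional ones.
  have key : ∀ y t, 2 * Q y t t y + 6 * Q y (j t) (j t) y = 0 := by
    intro y t
    have e1 := hhol (y + t)
    have e2 := hhol (y + -t)
    simp only [jadd, jneg, hadd, hadd2, hadd3, hadd4, hneg, hneg2, hneg3, hneg4] at e1 e2
    have e3 := hhol y
    have e4 := hhol t
    have b := hbianchi y (j y) (j t) t
    have b1 : Q (j y) (j t) y t = -Q y t t y := by rw [hjj', hanti']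
    have b2 : Q (j t) y (j y) t = -Q y (j t) (j t) y := by
      rw [hj, hanti (j t), neg_neg, hanti']
    have c1 : Q t (j t) (j y) y = Q y (j y) (j t) t := by rw [hpair, hanti, hanti', neg_neg]
    have c3 : Q t (j y) (j y) t = Q y (j t) (j t) y := by
      rw [← hjj', jj, hneg2, hj, neg_neg, hanti, hanti' y, neg_neg]
    have c2 : Q t (j y) (j t) y = Q y (j t) (j t) y := by
      rw [hj, ← c3, hanti']; ring
    have c4 : Q y (j t) (j y) t = Q y (j t) (j t) y := by
      rw [hj, hanti']; ring
    linarith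
  have k1 := key x y
  -- Replacing `t` by `jt` exchanges the coefficients `2` and `6`; the resulting linear system is
  -- nonsingular.
  have k2 := key x (j y)
  rw [jj, hneg2, hneg3, neg_neg] at k2
  linarith

/-! ### Almost contact metric algebra on one tangent space -/

section Algebra

variable {F : Type*} [NormedAddCommGroup F] [NormedSpace ℝ F]

/-- The algebraic structure of an almost contact metric structure on a tangent space. -/
structure IsContactAlgebra (h : F →L[ℝ] F →L[ℝ] ℝ) (φ : F →L[ℝ] F) (ξ : F) (η : F →L[ℝ] ℝ) :
    Prop where
  symm : ∀ u v, h u v = h v u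
  pos : ∀ u, u ≠ 0 → 0 < h u u
  φ_φ : ∀ v, φ (φ v) = -v + η v • ξ
  η_ξ : η ξ = 1
  compatible : ∀ v w, h (φ v) (φ w) = h v w - η v * η w

namespace IsContactAlgebra

variable {h : F →L[ℝ] F →L[ℝ] ℝ} {φ : F →L[ℝ] F} {ξ : F} {η : F →L[ℝ] ℝ}

/-- Since `φ²ξ = 0`, the formula for `φ²` at `φξ` gives `φξ = λξ` with `λ = η(φξ)`; applying `φ`
again yields `λ² = 0`. -/
theorem φ_ξ (H : IsContactAlgebra h φ ξ η) : φ ξ = 0 := by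
  have h1 : φ (φ ξ) = 0 := by rw [H.φ_φ, H.η_ξ, one_smul, neg_add_cancel]
  have h2 := H.φ_φ (φ ξ)
  rw [h1, map_zero] at h2
  have h3 : φ ξ = η (φ ξ) • ξ := by rw [eq_comm, neg_add_eq_zero] at h2; exact h2
  have h4 : η (φ ξ) * η (φ ξ) = 0 := by
    have h5 : φ (φ ξ) = (η (φ ξ) * η (φ ξ)) • ξ := by
      conv_lhs => rw [h3, map_smul, h3]
      rw [smul_smul]
      congr 2
      rw [map_smul, H.η_ξ, smul_eq_mul, mul_one]
    rw [h1] at h5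
    have h6 := congrArg η h5
    rw [map_zero, map_smul, H.η_ξ, smul_eq_mul, mul_one] at h6
    exact h6.symm
  rw [h3, mul_self_eq_zero.1 h4, zero_smul]

theorem ξ_ne_zero (H : IsContactAlgebra h φ ξ η) : ξ ≠ 0 := fun h0 => by
  have := H.η_ξ
  rw [h0, map_zero] at this
  exact zero_ne_one this

theorem η_φ (H : IsContactAlgebra h φ ξ η) (v : F) : η (φ v) = 0 := by
  have h1 := H.φ_φ (φ v)
  rw [H.φ_φ v, map_add, map_neg, map_smul, H.φ_ξ, smul_zero, add_zero, left_eq_add] at h1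
  exact (smul_eq_zero.1 h1).resolve_right H.ξ_ne_zero

theorem η_eq (H : IsContactAlgebra h φ ξ η) (v : F) : η v = h v ξ := by
  have := H.compatible v ξ
  rw [H.φ_ξ, map_zero, H.η_ξ] at this
  linarith

theorem skew (H : IsContactAlgebra h φ ξ η) (v w : F) : h (φ v) w = -h v (φ w) := by
  have h1 := H.compatible v (φ w)
  rw [H.φ_φ, H.η_φ, map_add, map_neg, map_smul, ← H.η_eq, H.η_φ, smul_zero, mul_zero] at h1
  linarith

theorem eq_of_forall (H : IsContactAlgebra h φ ξ η) {a b : F} (hab : ∀ w, h a w = h b w) :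
    a = b := by
  by_contra hne
  have h1 := H.pos (a - b) (sub_ne_zero.2 hne)
  have h2 : h (a - b) = 0 := by
    rw [map_sub, sub_eq_zero]
    exact ContinuousLinearMap.ext hab
  rw [h2] at h1
  exact lt_irrefl _ h1

/-- The covariant derivatives of `φ` and `ξ` of a Sasakian structure, from the contact condition,
its exterior derivative and normality. -/
theorem sasakian (H : IsContactAlgebra h φ ξ η) {A : F → F → F} {B : F → F}
    (hAadd : ∀ x x' y, A (x + x') y = A x y + A x' y) (hAsmul : ∀ (a : ℝ) x y, A (a • x) y = a • A x y)
    (hcontact : ∀ x y, h (B x) y - h (B y) x = 2 * h x (φ y))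
    (hnormal : ∀ x y, A (φ x) y - A (φ y) x + φ (A y x) - φ (A x y) = -(2 * h x (φ y)) • ξ)
    (hclosed : ∀ x y z, h y (A x z) + h z (A y x) + h x (A z y) = 0)
    (hskew : ∀ x y z, h (A x y) z = -h y (A x z))
    (hφφ : ∀ x y, A x (φ y) + φ (A x y) = h (B x) y • ξ + η y • B x)
    (hBξ : ∀ x, h (B x) ξ = 0) :
    (∀ x y, A x y = h x y • ξ - η y • x) ∧ ∀ x, B x = -φ x := by
  have hsk : ∀ x y z, h (A x y) z = -h (A x z) y := fun x y z => by rw [hskew, H.symm]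
  have hcyc : ∀ x y z, h (A x y) z + h (A y z) x + h (A z x) y = 0 := by
    intro x y z
    have := hclosed x y z
    rw [H.symm y, H.symm z, H.symm x] at this
    linarith [hsk x y z, hsk y z x, hsk z x y]
  -- Normality paired with `z`; the closedness of the fundamental form turns the two terms
  -- containing `φ ∘ A` into derivatives in direction `φz`.
  have hn : ∀ x y z, h (A (φ x) y) z + h (A (φ y) z) x - h (A (φ z) x) y
      = -(2 * h x (φ y)) * η z := by
    intro x y z
    have h1 := congrArg (fun v => h v z) (hnormal x y)
    simp only [map_add, map_sub, map_smul, add_apply, sub_apply, smul_apply, smul_eq_mul,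
      H.skew, H.symm ξ z, ← H.η_eq] at h1
    linarith [hcyc x y (φ z), hsk x y (φ z), hsk (φ y) x z, hsk y x (φ z)]
  -- Adding the previous identity to its cyclic permutation leaves twice one term, so `A` is known
  -- in directions in the image of `φ`, which is `ker η`.
  have himg : ∀ x y z, h (A (φ x) y) z = h (φ x) y * η z - h (φ x) z * η y := by
    intro x y z
    have h1 := hn x y z
    have h2 := hn z x y
    rw [H.skew x y]
    have h3 : h z (φ x) = h (φ x) z := H.symm _ _
    rw [h3] at h2
    linarith
  have hperp : ∀ x, η x = 0 → ∀ y z, h (A x y) z = h x y * η z - h x z * η y := by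
    intro x hx y z
    have h1 := himg (-φ x) y z
    rw [map_neg, H.φ_φ, hx, zero_smul, add_zero, neg_neg] at h1
    exact h1
  -- The remaining direction `ξ` is treated separately: `ξ` is geodesic, and then `A ξ = 0` follows
  -- from the derivative of `φ²` and the cyclic identity.
  have hBξ0 : B ξ = 0 := by
    refine H.eq_of_forall fun y => ?_
    have h1 := hcontact ξ y
    rw [hBξ, H.symm ξ, ← H.η_eq, H.η_φ] at h1
    rw [map_zero, zero_apply]
    linarith
  have hA0 : ∀ x, A x 0 = 0 := fun x => H.eq_of_forall fun z => by
    rw [hsk, map_zero, map_zero, zero_apply, neg_zero]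
  have hAξξ : A ξ ξ = 0 := by
    have h1 := hφφ ξ ξ
    rw [H.φ_ξ, hA0, hBξ0, map_zero, zero_apply, zero_smul, smul_zero, zero_add, add_zero] at h1
    have h2 : η (A ξ ξ) = 0 := by
      rw [H.η_eq]
      linarith [hsk ξ ξ ξ]
    have h3 := H.φ_φ (A ξ ξ)
    rw [h1, map_zero, h2, zero_smul, add_zero, eq_comm, neg_eq_zero] at h3
    exact h3
  have hdec : ∀ x : F, ∃ x₀, η x₀ = 0 ∧ x = x₀ + η x • ξ := fun x =>
    ⟨x - η x • ξ, by rw [map_sub, map_smul, H.η_ξ, smul_eq_mul, mul_one, sub_self], by abel⟩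
  have hAξ₀ : ∀ z, η z = 0 → A ξ z = 0 := by
    intro z hz
    refine H.eq_of_forall fun y => ?_
    obtain ⟨y₀, hy₀, hy⟩ := hdec y
    have h1 := hcyc ξ z y₀
    rw [hperp z hz, hperp y₀ hy₀, H.η_ξ, hy₀, H.symm y₀ z, hz] at h1
    have h2 : h (A ξ z) ξ = 0 := by rw [hsk, hAξξ, map_zero, zero_apply, neg_zero]
    rw [hy, map_add, map_smul, h2, smul_zero, map_zero, zero_apply]
    linarith
  have hAξ : ∀ z, A ξ z = 0 := by
    intro z
    refine H.eq_of_forall fun y => ?_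
    obtain ⟨z₀, hz₀, hz⟩ := hdec z
    have h1 : h (A ξ y) ξ = 0 := by rw [hsk, hAξξ, map_zero, zero_apply, neg_zero]
    have h2 : h (A ξ y) z₀ = 0 := by rw [hsk, hAξ₀ z₀ hz₀, map_zero, zero_apply, neg_zero]
    rw [hsk, hz, map_add, map_smul, h1, h2, map_zero, zero_apply, smul_zero, add_zero, neg_zero]
  have hA : ∀ x y, A x y = h x y • ξ - η y • x := by
    intro x y
    refine H.eq_of_forall fun z => ?_
    obtain ⟨x₀, hx₀, hx⟩ := hdec x
    have h1 : A x y = A x₀ y := by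
      conv_lhs => rw [hx, hAadd, hAsmul, hAξ, smul_zero, add_zero]
    have h2 : ∀ w, h x₀ w = h x w - η x * η w := fun w => by
      conv_rhs => rw [hx]
      simp only [map_add, map_smul, add_apply, smul_apply, hx₀, H.η_ξ, smul_eq_mul, H.symm ξ w,
        ← H.η_eq]
      ring
    rw [h1, hperp x₀ hx₀, h2, h2]
    simp only [map_sub, map_smul, sub_apply, smul_apply, smul_eq_mul, H.symm ξ z, ← H.η_eq]
    ring
  refine ⟨hA, fun x => ?_⟩
  have h1 := hφφ x ξ
  rw [H.φ_ξ, hA0, zero_add, hA, hBξ, H.η_ξ, map_sub, map_smul, H.φ_ξ, smul_zero, zero_sub,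
    one_smul, zero_smul, zero_add, one_smul] at h1
  exact h1.symm

/-- The curvature tensor of a Sasakian space form, on vectors orthogonal to the Reeb field. -/
theorem curvature_eq (H : IsContactAlgebra h φ ξ η) {R : F → F → F → F} {c : ℝ}
    (hadd : ∀ u u' v w, R (u + u') v w = R u v w + R u' v w)
    (hanti : ∀ u v w, R u v w = -R v u w)
    (hskew : ∀ u v w z, h (R u v w) z = -h w (R u v z))
    (hpair : ∀ u v w z, h (R u v w) z = h (R w z u) v)
    (hbianchi : ∀ u v w, R u v w + R v w u + R w u v = 0)
    (hξ : ∀ u v, R u v ξ = η v • u - η u • v)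
    (hφ : ∀ u v w, R u v (φ w) = φ (R u v w) + h (φ u) w • v - h (φ v) w • u
      + h u w • φ v - h v w • φ u)
    (hsec : ∀ x, η x = 0 → h (R x (φ x) (φ x)) x = c * h x x ^ 2)
    {y t : F} (hy : η y = 0) (ht : η t = 0) (htt : h t t = 1) (hyt : h y t = 0) :
    R y t t = ((c + 3) / 4) • y + (3 * (c - 1) / 4 * h y (φ t)) • φ t := by
  -- The expected curvature on `ker η`. `R` violates the Kähler identity by terms independent of
  -- `c`, and `K` by the same terms because `(c+3)/4 - (c-1)/4 = 1`. So `Q = R - K` is of Kähler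
  -- type, and its holomorphic sectional curvatures vanish.
  let K : F → F → F → F → ℝ := fun u v w z =>
    (c + 3) / 4 * (h v w * h u z - h u w * h v z)
      + (c - 1) / 4 * (h u (φ w) * h (φ v) z - h v (φ w) * h (φ u) z + 2 * h u (φ v) * h (φ w) z)
  let Q : LinearMap.ker (η : F →ₗ[ℝ] ℝ) → LinearMap.ker (η : F →ₗ[ℝ] ℝ) →
      LinearMap.ker (η : F →ₗ[ℝ] ℝ) → LinearMap.ker (η : F →ₗ[ℝ] ℝ) → ℝ :=
    fun u v w z => h (R u v w) z - K u v w z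
  let j : LinearMap.ker (η : F →ₗ[ℝ] ℝ) → LinearMap.ker (η : F →ₗ[ℝ] ℝ) := fun u =>
    ⟨φ u, H.η_φ u⟩
  have hker : ∀ u : LinearMap.ker (η : F →ₗ[ℝ] ℝ), η (u : F) = 0 := fun u => u.2
  have hφφ : ∀ u : LinearMap.ker (η : F →ₗ[ℝ] ℝ), φ (φ (u : F)) = -u := fun u => by
    rw [H.φ_φ, hker, zero_smul, add_zero]
  have hφs : ∀ u v : F, h (φ u) v = -h u (φ v) := H.skew
  have hQpair : ∀ u v w z, Q u v w z = Q w z u v := by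
    intro u v w z
    change h (R u v w) z - K u v w z = h (R w z u) v - K w z u v
    simp only [hpair u v w z, K, hφs, H.symm (z : F), H.symm (w : F) v, H.symm (w : F) u,
      H.symm (w : F) (φ u), H.symm (w : F) (φ v)]
    ring
  have key := sectional_eq_zero_of_holomorphic (Q := Q) (j := j)
    (fun x y => Subtype.ext (map_add φ _ _)) (fun x => Subtype.ext (hφφ x))
    (fun u u' v w z => by
      change h (R (u + u') v w) z - K (u + u') v w z
        = h (R u v w) z - K u v w z + (h (R u' v w) z - K u' v w z)
      simp only [hadd, K, map_add, add_apply]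
      ring)
    (fun u v w z => by
      change h (R u v w) z - K u v w z = -(h (R v u w) z - K v u w z)
      simp only [hanti u v, K, map_neg, neg_apply, hφs, H.symm (v : F) (φ u)]
      ring)
    hQpair
    (fun u v w z => by
      change h (R u v w) z - K u v w z + (h (R v w u) z - K v w u z)
        + (h (R w u v) z - K w u v z) = 0
      have hb := congrArg (fun x => h x (z : F)) (hbianchi u v w)
      simp only [map_add, add_apply, map_zero, zero_apply] at hb
      simp only [K, hφs, H.symm (w : F) (φ u), H.symm (w : F) (φ v), H.symm (v : F) (φ u),
        H.symm (w : F) u, H.symm (w : F) v, H.symm (v : F) u]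
      linear_combination hb)
    (fun u v w z => by
      change h (R u v (φ w)) z - K u v (φ w) z = -(h (R u v w) (φ z) - K u v w (φ z))
      simp only [hφ, K, map_add, map_sub, map_smul, add_apply, sub_apply, smul_apply, smul_eq_mul,
        hφs, hφφ, map_neg]
      ring)
    (fun x => by
      change h (R x (φ x) (φ x)) x - K x (φ x) (φ x) x = 0
      have h0 : h (x : F) (φ x) = 0 := by linarith [hφs x x, H.symm (x : F) (φ x)]
      rw [hsec x (hker x)]
      simp only [K, hφs, hφφ, map_neg, h0]
      ring)
  have hadd4 : ∀ u v w z z', Q u v w (z + z') = Q u v w z + Q u v w z' := by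
    intro u v w z z'
    change h (R u v w) (z + z') - K u v w (z + z') = h (R u v w) z - K u v w z
      + (h (R u v w) z' - K u v w z')
    simp only [K, map_add]
    ring
  have hadd1 : ∀ u u' v w z, Q (u + u') v w z = Q u v w z + Q u' v w z := by
    intro u u' v w z
    change h (R (u + u') v w) z - K (u + u') v w z
        = h (R u v w) z - K u v w z + (h (R u' v w) z - K u' v w z)
    simp only [hadd, K, map_add, add_apply]
    ring
  -- Polarization of `Q(u, v, v, u) = 0` in `u`, using the symmetry of `Q(·, v, v, ·)`.
  have hpol : ∀ u v z, Q u v v z = 0 := by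
    intro u v z
    have h1 := key (u + z) v
    rw [hadd1, hadd4, hadd4, key, key] at h1
    have h2 : Q z v v u = Q u v v z := by
      change h (R z v v) u - K z v v u = h (R u v v) z - K u v v z
      have h3 : h (R z v v) u = h (R u v v) z := by
        rw [hpair, hanti, map_neg, neg_apply, hskew, neg_neg, H.symm]
      have h4 : h (v : F) (φ v) = 0 := by linarith [hφs v v, H.symm (v : F) (φ v)]
      rw [h3]
      simp only [K, hφs, H.symm (z : F), H.symm (v : F) u, H.symm (v : F) (φ u), h4]
      ring
    linarith
  refine H.eq_of_forall fun z => ?_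
  -- `Q` only tests vectors of `ker η`; the `ξ`-component of `R(y, t)t` vanishes by the formula for
  -- `R(u, v)ξ`.
  have hz : z = (z - η z • ξ) + η z • ξ := by abel
  have hz0 : η (z - η z • ξ) = 0 := by
    rw [map_sub, map_smul, H.η_ξ, smul_eq_mul, mul_one, sub_self]
  have h1 : h (R y t t) (z - η z • ξ) - K y t t (z - η z • ξ) = 0 :=
    hpol ⟨y, hy⟩ ⟨t, ht⟩ ⟨_, hz0⟩
  have h2 : h (R y t t) ξ = 0 := by
    rw [hskew, hξ, ht, hy, zero_smul, zero_smul, sub_zero, map_zero, neg_zero]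
  have h3 : h y ξ = 0 := by rw [← H.η_eq, hy]
  have h4 : h (φ t) ξ = 0 := by rw [← H.η_eq, H.η_φ]
  have h5 : h t (φ t) = 0 := by linarith [hφs t t, H.symm t (φ t)]
  rw [hz, map_add, map_smul, h2, smul_zero, add_zero, map_add, map_smul]
  simp only [K, htt, hyt, h5] at h1
  simp only [map_add, map_smul, add_apply, smul_apply, smul_eq_mul, h3, h4]
  linarith

end IsContactAlgebra

end Algebra

/-! ### Almost contact metric structures in coordinates -/

section Coordinates

variable {F : Type*} [NormedAddCommGroup F] [NormedSpace ℝ F] [FiniteDimensional ℝ F]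

/-- An almost contact metric structure in coordinates. -/
structure IsContactOn (h : F → F →L[ℝ] F →L[ℝ] ℝ) (φ : F → F →L[ℝ] F) (ξ : F → F)
    (η : F → F →L[ℝ] ℝ) (U : Set F) : Prop where
  metric : IsMetricOn h U
  contDiffAt_φ : ∀ y ∈ U, ContDiffAt ℝ ∞ φ y
  contDiffAt_ξ : ∀ y ∈ U, ContDiffAt ℝ ∞ ξ y
  contDiffAt_η : ∀ y ∈ U, ContDiffAt ℝ ∞ η y
  algebra : ∀ y ∈ U, IsContactAlgebra (h y) (φ y) (ξ y) (η y)

/-- The covariant derivative `(∇_u φ) v` of an endomorphism field in coordinates. -/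
def nablaEnd (h : F → F →L[ℝ] F →L[ℝ] ℝ) (φ : F → F →L[ℝ] F) (y u v : F) : F :=
  fderiv ℝ φ y u v + christoffelL h y u (φ y v) - φ y (christoffelL h y u v)

/-- The covariant derivative `∇_u X` of a vector field in coordinates. -/
def nablaField (h : F → F →L[ℝ] F →L[ℝ] ℝ) (X : F → F) (y u : F) : F :=
  fderiv ℝ X y u + christoffelL h y u (X y)

theorem covD_id (h : F → F →L[ℝ] F →L[ℝ] ℝ) (X : F → F) (u y : F) :
    covD h (fun z => z) X u y = nablaField h X y u := by
  rw [covD, nablaField, fderiv_fun_id, ContinuousLinearMap.id_apply]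

theorem nablaField_congr (h : F → F →L[ℝ] F →L[ℝ] ℝ) {X X' : F → F} {y : F}
    (hX : X =ᶠ[nhds y] X') (u : F) : nablaField h X y u = nablaField h X' y u := by
  rw [nablaField, nablaField, hX.fderiv_eq, hX.self_of_nhds]

theorem nablaField_apply (h : F → F →L[ℝ] F →L[ℝ] ℝ) {φ : F → F →L[ℝ] F} {X : F → F} {y : F}
    (hφ : DifferentiableAt ℝ φ y) (hX : DifferentiableAt ℝ X y) (u : F) :
    nablaField h (fun z => φ z (X z)) y u
      = nablaEnd h φ y u (X y) + φ y (nablaField h X y u) := by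
  rw [nablaField, nablaField, nablaEnd, (hφ.hasFDerivAt.clm_apply hX.hasFDerivAt).fderiv, map_add]
  simp
  abel

theorem nablaField_smul (h : F → F →L[ℝ] F →L[ℝ] ℝ) {f : F → ℝ} {X : F → F} {y : F}
    (hf : DifferentiableAt ℝ f y) (hX : DifferentiableAt ℝ X y) (u : F) :
    nablaField h (fun z => f z • X z) y u = fderiv ℝ f y u • X y + f y • nablaField h X y u := by
  rw [nablaField, nablaField, fderiv_fun_smul hf hX, map_smul]
  simp
  abel

theorem nablaField_add (h : F → F →L[ℝ] F →L[ℝ] ℝ) {X Z : F → F} {y : F}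
    (hX : DifferentiableAt ℝ X y) (hZ : DifferentiableAt ℝ Z y) (u : F) :
    nablaField h (fun z => X z + Z z) y u = nablaField h X y u + nablaField h Z y u := by
  rw [nablaField, nablaField, nablaField, fderiv_fun_add hX hZ, map_add, add_apply]
  abel

theorem nablaField_sub (h : F → F →L[ℝ] F →L[ℝ] ℝ) {X Z : F → F} {y : F}
    (hX : DifferentiableAt ℝ X y) (hZ : DifferentiableAt ℝ Z y) (u : F) :
    nablaField h (fun z => X z - Z z) y u = nablaField h X y u - nablaField h Z y u := by
  rw [nablaField, nablaField, nablaField, fderiv_fun_sub hX hZ, map_sub, sub_apply]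
  abel

theorem nablaField_neg (h : F → F →L[ℝ] F →L[ℝ] ℝ) {X : F → F} {y : F} (u : F) :
    nablaField h (fun z => -X z) y u = -nablaField h X y u := by
  rw [nablaField, nablaField, fderiv_fun_neg, map_neg, neg_apply]
  abel

theorem nablaField_const (h : F → F →L[ℝ] F →L[ℝ] ℝ) (v y u : F) :
    nablaField h (fun _ => v) y u = christoffelL h y u v := by
  rw [nablaField, fderiv_fun_const]
  simp

theorem IsMetricOn.nablaField_inner {h : F → F →L[ℝ] F →L[ℝ] ℝ} {U : Set F}
    (H : IsMetricOn h U) {X Z : F → F} {y : F} (hy : y ∈ U) (hX : DifferentiableAt ℝ X y)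
    (hZ : DifferentiableAt ℝ Z y) (u : F) :
    fderiv ℝ (fun z => h z (X z) (Z z)) y u
      = h y (nablaField h X y u) (Z y) + h y (X y) (nablaField h Z y u) := by
  have := H.fderiv_inner (Y := fun z => z) hy differentiableAt_fun_id hX hZ u
  rwa [covD_id, covD_id] at this

theorem IsMetricOn.nablaField_comm {h : F → F →L[ℝ] F →L[ℝ] ℝ} {U : Set F}
    (H : IsMetricOn h U) {X : F → F} {y : F} (hy : y ∈ U) (hX : ContDiffAt ℝ ∞ X y) (u v : F) :
    nablaField h (fun z => nablaField h X z v) y u - nablaField h (fun z => nablaField h X z u) y v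
      = curv h y u v (X y) := by
  have := H.covD_covD_sub (Y := fun z => z) hy contDiffAt_fun_id hX u v
  rw [fderiv_fun_id] at this
  have e : ∀ w, covD h (fun z => z) X w = fun z => nablaField h X z w := fun w => by
    funext z; exact covD_id h X w z
  rw [e, e, covD_id, covD_id] at this
  exact this

namespace IsContactOn

variable {h : F → F →L[ℝ] F →L[ℝ] ℝ} {φ : F → F →L[ℝ] F} {ξ : F → F} {η : F → F →L[ℝ] ℝ}
  {U : Set F} {y : F}

theorem diff_const (v : F) : DifferentiableAt ℝ (fun _ : F => v) y := differentiableAt_const v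

/-- As `η = g(·, ξ)`, the covariant derivative of `η` is `g(∇ξ, ·)`. -/
theorem fderiv_η (H : IsContactOn h φ ξ η U) (hy : y ∈ U) {X : F → F}
    (hX : DifferentiableAt ℝ X y) (u : F) :
    fderiv ℝ (fun z => η z (X z)) y u
      = η y (nablaField h X y u) + h y (nablaField h ξ y u) (X y) := by
  have e : (fun z => η z (X z)) =ᶠ[nhds y] fun z => h z (X z) (ξ z) := by
    filter_upwards [H.metric.isOpen.mem_nhds hy] with z hz using (H.algebra z hz).η_eq _
  rw [e.fderiv_eq, H.metric.nablaField_inner hy hX (H.contDiffAt_ξ y hy).differentiableAt_infty,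
    (H.algebra y hy).η_eq, (H.algebra y hy).symm (X y)]

theorem fderiv_η_const (H : IsContactOn h φ ξ η U) (hy : y ∈ U) (u v : F) :
    fderiv ℝ η y u v = η y (christoffelL h y u v) + h y (nablaField h ξ y u) v := by
  rw [← nablaField_const h v y u, ← H.fderiv_η hy (diff_const v)]
  have := ((H.contDiffAt_η y hy).differentiableAt_infty.hasFDerivAt.clm_apply
    (hasFDerivAt_const v y)).fderiv
  rw [this]
  simp

/-- `(∇_u φ)` is skew-symmetric. -/
theorem nablaEnd_skew (H : IsContactOn h φ ξ η U) (hy : y ∈ U) (u v w : F) :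
    h y (nablaEnd h φ y u v) w = -h y v (nablaEnd h φ y u w) := by
  have hφ := (H.contDiffAt_φ y hy).differentiableAt_infty
  have hc : ∀ a : F, DifferentiableAt ℝ (fun z => φ z a) y := fun a =>
    hφ.clm_apply (diff_const a)
  have e : (fun z => h z (φ z v) w) =ᶠ[nhds y] fun z => -h z v (φ z w) := by
    filter_upwards [H.metric.isOpen.mem_nhds hy] with z hz using (H.algebra z hz).skew v w
  have h1 := congrArg (fun L : F →L[ℝ] ℝ => L u) e.fderiv_eq
  simp only [fderiv_fun_neg, neg_apply] at h1
  rw [H.metric.nablaField_inner hy (hc v) (diff_const w),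
    H.metric.nablaField_inner hy (diff_const v) (hc w), nablaField_apply h hφ (diff_const v),
    nablaField_apply h hφ (diff_const w), nablaField_const, nablaField_const] at h1
  simp only [map_add, add_apply, (H.algebra y hy).skew] at h1
  linarith

/-- The covariant derivative of the identity `φ² = -1 + η ⊗ ξ`. -/
theorem nablaEnd_φ (H : IsContactOn h φ ξ η U) (hy : y ∈ U) (u v : F) :
    nablaEnd h φ y u (φ y v) + φ y (nablaEnd h φ y u v)
      = h y (nablaField h ξ y u) v • ξ y + η y v • nablaField h ξ y u := by
  have hφ := (H.contDiffAt_φ y hy).differentiableAt_infty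
  have hξ := (H.contDiffAt_ξ y hy).differentiableAt_infty
  have hη : DifferentiableAt ℝ (fun z => η z v) y :=
    (H.contDiffAt_η y hy).differentiableAt_infty.clm_apply (diff_const v)
  have hc : DifferentiableAt ℝ (fun z => φ z v) y := hφ.clm_apply (diff_const v)
  have e : (fun z => φ z (φ z v)) =ᶠ[nhds y] fun z => -v + η z v • ξ z := by
    filter_upwards [H.metric.isOpen.mem_nhds hy] with z hz using (H.algebra z hz).φ_φ v
  have hs : DifferentiableAt ℝ (fun z => η z v • ξ z) y := hη.smul hξ
  have h1 := nablaField_congr h e u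
  rw [nablaField_apply h hφ hc, nablaField_apply h hφ (diff_const v),
    nablaField_add h (diff_const (-v)) hs, nablaField_const, nablaField_const,
    nablaField_smul h hη hξ, H.fderiv_η hy (diff_const v), nablaField_const, map_add,
    (H.algebra y hy).φ_φ, add_smul, map_neg] at h1
  have h2 : nablaEnd h φ y u (φ y v) + φ y (nablaEnd h φ y u v)
      = (nablaEnd h φ y u (φ y v) + (φ y (nablaEnd h φ y u v) + (-christoffelL h y u v
        + η y (christoffelL h y u v) • ξ y))) + christoffelL h y u v
        - η y (christoffelL h y u v) • ξ y := by abel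
  rw [h2, h1]
  abel

theorem inner_nabla_ξ (H : IsContactOn h φ ξ η U) (hy : y ∈ U) (u : F) :
    h y (nablaField h ξ y u) (ξ y) = 0 := by
  have hξ := (H.contDiffAt_ξ y hy).differentiableAt_infty
  have e : (fun z => h z (ξ z) (ξ z)) =ᶠ[nhds y] fun _ => (1 : ℝ) := by
    filter_upwards [H.metric.isOpen.mem_nhds hy] with z hz
    rw [← (H.algebra z hz).η_eq, (H.algebra z hz).η_ξ]
  have h1 := congrArg (fun L : F →L[ℝ] ℝ => L u) e.fderiv_eq
  simp only [fderiv_fun_const, Pi.zero_apply, zero_apply] at h1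
  rw [H.metric.nablaField_inner hy hξ hξ, (H.algebra y hy).symm (ξ y)] at h1
  linarith

/-- The fundamental form of a contact metric structure is closed. -/
theorem nablaEnd_cyclic (H : IsContactOn h φ ξ η U)
    (hcontact : ∀ z ∈ U, ∀ u v, fderiv ℝ η z u v - fderiv ℝ η z v u = 2 * h z u (φ z v))
    (hy : y ∈ U) (u v w : F) :
    h y v (nablaEnd h φ y u w) + h y w (nablaEnd h φ y v u) + h y u (nablaEnd h φ y w v) = 0 := by
  have hφ := (H.contDiffAt_φ y hy).differentiableAt_infty
  have hη := H.contDiffAt_η y hy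
  have hDη := hη.fderiv_infty.differentiableAt_infty
  have key : ∀ a b c : F, fderiv ℝ (fderiv ℝ η) y a b c - fderiv ℝ (fderiv ℝ η) y a c b
      = 2 * (h y (christoffelL h y a b) (φ y c)
        + h y b (nablaEnd h φ y a c + φ y (christoffelL h y a c))) := by
    intro a b c
    have e : (fun z => fderiv ℝ η z b c - fderiv ℝ η z c b) =ᶠ[nhds y]
        fun z => 2 * h z b (φ z c) := by
      filter_upwards [H.metric.isOpen.mem_nhds hy] with z hz using hcontact z hz b c
    have h1 := congrArg (fun L : F →L[ℝ] ℝ => L a) e.fderiv_eq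
    have hd : ∀ p q : F, DifferentiableAt ℝ (fun z => fderiv ℝ η z p q) y := fun p q =>
      (hDη.clm_apply (diff_const p)).clm_apply (differentiableAt_const q)
    have hd' : ∀ p q : F, fderiv ℝ (fun z => fderiv ℝ η z p q) y a
        = fderiv ℝ (fderiv ℝ η) y a p q := fun p q => by
      rw [fderiv_clm_apply₂ hDη (differentiableAt_const p) (differentiableAt_const q)]; simp
    have hc : DifferentiableAt ℝ (fun z => φ z c) y := hφ.clm_apply (diff_const c)
    have hm : DifferentiableAt ℝ (fun z => h z b (φ z c)) y :=
      ((H.metric.contDiffAt y hy).differentiableAt_infty.clm_apply (diff_const b)).clm_apply hc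
    simp only [fderiv_fun_sub (hd b c) (hd c b), fderiv_const_mul hm, sub_apply, hd', smul_apply,
      smul_eq_mul] at h1
    rw [h1, H.metric.nablaField_inner hy (diff_const b) hc, nablaField_const,
      nablaField_apply h hφ (diff_const c), nablaField_const]
  -- This is `d(dη) = 0`: in the cyclic sum of `key` the second derivatives of `η` cancel, and so do
  -- the Christoffel terms by symmetry and skewness of `φ`.
  have hs := hη.fderiv_fderiv_symm
  have k1 := key u v w
  have k2 := key v w u
  have k3 := key w u v
  rw [hs u v, hs u w] at k1
  rw [hs v w] at k2
  simp only [map_add, ← neg_eq_iff_eq_neg.2 ((H.algebra y hy).skew _ _)] at k1 k2 k3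
  have hsy := H.metric.christoffelL_symm hy
  rw [hsy v w, hsy v u] at k2
  rw [hsy w u] at k3
  have hsym := (H.algebra y hy).symm
  rw [hsym (φ y v)] at k1
  rw [hsym (φ y w)] at k2
  rw [hsym (φ y u)] at k3
  have hsk := (H.algebra y hy).skew
  linarith [hsk (christoffelL h y u v) w, hsk (christoffelL h y u w) v,
    hsk (christoffelL h y w v) u]

end IsContactOn

end Coordinates

/-! ### Naturality, and the Sasakian identities for `∇φ`, `∇ξ` and the curvature -/

section Coordinates

variable {F : Type*} [NormedAddCommGroup F] [NormedSpace ℝ F] [FiniteDimensional ℝ F]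

/-- Normality is evaluated only at the centre of each chart, so the formula for `∇φ` is first found
there. Naturality carries it to all points of a fixed chart, where it can be differentiated. -/
theorem IsMetricOn.nablaEnd_pullback {h h' : F → F →L[ℝ] F →L[ℝ] ℝ} {U U' : Set F}
    (H : IsMetricOn h U) (H' : IsMetricOn h' U') {ψ : F → F} {y : F} (hy : y ∈ U')
    (hψy : ψ y ∈ U) (hψ : ContDiffAt ℝ ∞ ψ y)
    (hpull : ∀ᶠ z in nhds y, ∀ u v, h' z u v = h (ψ z) (fderiv ℝ ψ z u) (fderiv ℝ ψ z v))
    (hsurj : Function.Surjective (fderiv ℝ ψ y)) {φ φ' : F → F →L[ℝ] F}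
    (hφ : DifferentiableAt ℝ φ (ψ y)) (hφ' : DifferentiableAt ℝ φ' y)
    (hφpull : ∀ᶠ z in nhds y, ∀ v, fderiv ℝ ψ z (φ' z v) = φ (ψ z) (fderiv ℝ ψ z v)) (u v : F) :
    fderiv ℝ ψ y (nablaEnd h' φ' y u v)
      = nablaEnd h φ (ψ y) (fderiv ℝ ψ y u) (fderiv ℝ ψ y v) := by
  have hψd := hψ.differentiableAt_infty
  have hDψ := hψ.fderiv_infty.differentiableAt_infty
  have e : (fun z => fderiv ℝ ψ z (φ' z v)) =ᶠ[nhds y] fun z => φ (ψ z) (fderiv ℝ ψ z v) := by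
    filter_upwards [hφpull] with z hz using hz v
  have h1 := congrArg (fun L : F →L[ℝ] F => L u) e.fderiv_eq
  have hc : HasFDerivAt (fun z => φ' z v) _ y := hφ'.hasFDerivAt.clm_apply (hasFDerivAt_const v y)
  have hc2 : HasFDerivAt (fun z => fderiv ℝ ψ z v) _ y :=
    hDψ.hasFDerivAt.clm_apply (hasFDerivAt_const v y)
  have hc3 : HasFDerivAt (fun z => φ (ψ z)) _ y := hφ.hasFDerivAt.comp y hψd.hasFDerivAt
  rw [(hDψ.hasFDerivAt.clm_apply hc).fderiv, (hc3.clm_apply hc2).fderiv] at h1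
  simp only [add_apply, ContinuousLinearMap.comp_apply, ContinuousLinearMap.flip_apply,
    zero_apply, map_zero, zero_add] at h1
  have hΓ := H.christoffelL_pullback H' hy hψy hψ hpull hsurj
  have h0 := hφpull.self_of_nhds
  rw [nablaEnd, nablaEnd, map_sub, map_add, hΓ, h0, h0, hΓ, map_add]
  rw [← sub_eq_zero] at h1 ⊢
  rw [← h1]
  abel

/-- Antisymmetrized derivatives of one-forms are natural. -/
theorem fderiv_oneForm_pullback {ψ : F → F} {y : F} (hψ : ContDiffAt ℝ ∞ ψ y)
    {η η' : F → F →L[ℝ] ℝ} (hη : DifferentiableAt ℝ η (ψ y)) (hη' : DifferentiableAt ℝ η' y)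
    (hpull : ∀ᶠ z in nhds y, ∀ v, η' z v = η (ψ z) (fderiv ℝ ψ z v)) (u v : F) :
    fderiv ℝ η' y u v - fderiv ℝ η' y v u
      = fderiv ℝ η (ψ y) (fderiv ℝ ψ y u) (fderiv ℝ ψ y v)
        - fderiv ℝ η (ψ y) (fderiv ℝ ψ y v) (fderiv ℝ ψ y u) := by
  have hψd := hψ.differentiableAt_infty
  have hDψ := hψ.fderiv_infty.differentiableAt_infty
  have key : ∀ a b : F, fderiv ℝ η' y a b
      = fderiv ℝ η (ψ y) (fderiv ℝ ψ y a) (fderiv ℝ ψ y b)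
        + η (ψ y) (fderiv ℝ (fderiv ℝ ψ) y a b) := by
    intro a b
    have e : (fun z => η' z b) =ᶠ[nhds y] fun z => η (ψ z) (fderiv ℝ ψ z b) := by
      filter_upwards [hpull] with z hz using hz b
    have h1 := congrArg (fun L : F →L[ℝ] ℝ => L a) e.fderiv_eq
    have hc2 : HasFDerivAt (fun z => fderiv ℝ ψ z b) _ y :=
      hDψ.hasFDerivAt.clm_apply (hasFDerivAt_const b y)
    have hc3 : HasFDerivAt (fun z => η (ψ z)) _ y := hη.hasFDerivAt.comp y hψd.hasFDerivAt
    rw [(hη'.hasFDerivAt.clm_apply (hasFDerivAt_const b y)).fderiv,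
      (hc3.clm_apply hc2).fderiv] at h1
    simp only [add_apply, ContinuousLinearMap.comp_apply, ContinuousLinearMap.flip_apply,
      zero_apply, map_zero, zero_add] at h1
    rw [h1, add_comm]
  rw [key, key, hψ.fderiv_fderiv_symm u v]
  ring

namespace IsContactOn

variable {h : F → F →L[ℝ] F →L[ℝ] ℝ} {φ : F → F →L[ℝ] F} {ξ : F → F} {η : F → F →L[ℝ] ℝ}
  {U : Set F} {y : F}

/-- Symmetry of the Christoffel symbols lets covariant derivatives replace coordinate derivatives in
`dη` and in the Nijenhuis tensor, which reduces the claim to pointwise algebra. -/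
theorem sasakian (H : IsContactOn h φ ξ η U)
    (hcontact : ∀ z ∈ U, ∀ u v, fderiv ℝ η z u v - fderiv ℝ η z v u = 2 * h z u (φ z v))
    (hy : y ∈ U) (hnormal : ∀ u v, fderiv ℝ φ y (φ y u) v - fderiv ℝ φ y (φ y v) u
      + φ y (fderiv ℝ φ y v u) - φ y (fderiv ℝ φ y u v) = -(2 * h y u (φ y v)) • ξ y) (u v : F) :
    nablaEnd h φ y u v = h y u v • ξ y - η y v • u := by
  have hs := H.metric.christoffelL_symm hy
  refine ((H.algebra y hy).sasakian (A := nablaEnd h φ y) (B := nablaField h ξ y)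
    ?_ ?_ ?_ ?_ (fun x y z => H.nablaEnd_cyclic hcontact hy x y z)
    (fun x y z => H.nablaEnd_skew hy x y z) (fun x y => H.nablaEnd_φ hy x y)
    (fun x => H.inner_nabla_ξ hy x)).1 u v
  · intro x x' z
    simp only [nablaEnd, map_add, add_apply]
    abel
  · intro a x z
    simp only [nablaEnd, map_smul, smul_apply, smul_add, smul_sub]
  · intro x z
    rw [← hcontact y hy, H.fderiv_η_const hy, H.fderiv_η_const hy, hs x z]
    ring
  · intro x z
    rw [← hnormal x z]
    simp only [nablaEnd, map_add, map_sub, hs (φ y z) (φ y x), hs (φ y x) z, hs (φ y z) x, hs z x]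
    abel

theorem nablaField_ξ (H : IsContactOn h φ ξ η U) (hy : y ∈ U)
    (hsas : ∀ u v, nablaEnd h φ y u v = h y u v • ξ y - η y v • u) (u : F) :
    nablaField h ξ y u = -φ y u := by
  have h1 := H.nablaEnd_φ hy u (ξ y)
  have hA := H.algebra y hy
  rw [hA.φ_ξ, hsas, hsas, H.inner_nabla_ξ hy, hA.η_ξ, map_zero, map_zero, map_sub, map_smul,
    hA.φ_ξ] at h1
  simp only [zero_smul, smul_zero, one_smul, zero_sub, sub_zero, zero_add] at h1
  exact h1.symm

/-- The Ricci identity for `ξ`, with `∇ξ = -φ` and the formula for `∇φ`. -/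
theorem curv_ξ (H : IsContactOn h φ ξ η U)
    (hsas : ∀ z ∈ U, ∀ u v, nablaEnd h φ z u v = h z u v • ξ z - η z v • u) (hy : y ∈ U) (u v : F) :
    curv h y u v (ξ y) = η y v • u - η y u • v := by
  have hφ := (H.contDiffAt_φ y hy).differentiableAt_infty
  have e : ∀ w : F, (fun z => nablaField h ξ z w) =ᶠ[nhds y] fun z => -φ z w := fun w => by
    filter_upwards [H.metric.isOpen.mem_nhds hy] with z hz using H.nablaField_ξ hz (hsas z hz) w
  rw [← H.metric.nablaField_comm hy (H.contDiffAt_ξ y hy), nablaField_congr h (e v),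
    nablaField_congr h (e u), nablaField_neg, nablaField_neg,
    nablaField_apply h hφ (diff_const v), nablaField_apply h hφ (diff_const u), nablaField_const,
    nablaField_const, H.metric.christoffelL_symm hy u v, hsas y hy, hsas y hy,
    (H.algebra y hy).symm u v]
  abel

/-- The Ricci identity for the field `φw` with `w` constant in the coordinates. The formula for `∇φ`
is used twice, and `φ` applied to the Ricci identity for `w` supplies the main term. -/
theorem curv_φ (H : IsContactOn h φ ξ η U)
    (hsas : ∀ z ∈ U, ∀ u v, nablaEnd h φ z u v = h z u v • ξ z - η z v • u) (hy : y ∈ U)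
    (u v w : F) :
    curv h y u v (φ y w) = φ y (curv h y u v w) + h y (φ y u) w • v - h y (φ y v) w • u
      + h y u w • φ y v - h y v w • φ y u := by
  have hφs := H.contDiffAt_φ y hy
  have hφ := hφs.differentiableAt_infty
  have hξ := (H.contDiffAt_ξ y hy).differentiableAt_infty
  have hη := (H.contDiffAt_η y hy).differentiableAt_infty
  have hh := (H.metric.contDiffAt y hy).differentiableAt_infty
  have hC := (H.metric.contDiffAt_christoffelL hy).differentiableAt_infty
  have hA := H.algebra y hy
  have e : ∀ b : F, (fun z => nablaField h (fun z => φ z w) z b) =ᶠ[nhds y]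
      fun z => h z b w • ξ z - η z w • b + φ z (christoffelL h z b w) := fun b => by
    filter_upwards [H.metric.isOpen.mem_nhds hy] with z hz
    rw [nablaField_apply h (H.contDiffAt_φ z hz).differentiableAt_infty (diff_const w),
      nablaField_const, hsas z hz]
  have key : ∀ a b : F, nablaField h (fun z => nablaField h (fun z => φ z w) z b) y a
      = (h y (christoffelL h y a b) w + h y b (christoffelL h y a w)) • ξ y
        - h y b w • φ y a
        - ((η y (christoffelL h y a w) - h y (φ y a) w) • b + η y w • christoffelL h y a b)
        + (h y a (christoffelL h y b w) • ξ y - η y (christoffelL h y b w) • a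
          + φ y (nablaField h (fun z => nablaField h (fun _ => w) z b) y a)) := by
    intro a b
    have d1 : DifferentiableAt ℝ (fun z => h z b w) y :=
      (hh.clm_apply (diff_const b)).clm_apply (diff_const w)
    have d2 : DifferentiableAt ℝ (fun z => η z w) y := hη.clm_apply (diff_const w)
    have d3 : DifferentiableAt ℝ (fun z => christoffelL h z b w) y :=
      (hC.clm_apply (diff_const b)).clm_apply (diff_const w)
    have d4 : DifferentiableAt ℝ (fun z => h z b w • ξ z) y := d1.smul hξ
    have d5 : DifferentiableAt ℝ (fun z => η z w • b) y := d2.smul (diff_const b)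
    have d6 : DifferentiableAt ℝ (fun z => φ z (christoffelL h z b w)) y := hφ.clm_apply d3
    have d7 : DifferentiableAt ℝ (fun z => h z b w • ξ z - η z w • b) y := d4.sub d5
    have e2 : (fun z => nablaField h (fun _ => w) z b) = fun z => christoffelL h z b w := by
      funext z; exact nablaField_const h w z b
    rw [nablaField_congr h (e b), nablaField_add h d7 d6, nablaField_sub h d4 d5,
      nablaField_smul h d1 hξ, nablaField_smul h d2 (diff_const b), nablaField_apply h hφ d3,
      H.metric.nablaField_inner hy (diff_const b) (diff_const w), H.fderiv_η hy (diff_const w),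
      H.nablaField_ξ hy (hsas y hy), hsas y hy, e2]
    simp only [nablaField_const, map_neg, neg_apply, smul_neg]
    module
  have hR := H.metric.nablaField_comm (X := fun _ => w) hy contDiffAt_const u v
  rw [← hR, ← H.metric.nablaField_comm (X := fun z => φ z w) hy
    (hφs.clm_apply contDiffAt_const), key, key, map_sub, H.metric.christoffelL_symm hy u v,
    hA.symm u (christoffelL h y v w), hA.symm v (christoffelL h y u w)]
  module

end IsContactOn

end Coordinates

/-! ### Sasakian manifolds and the curvature of Sasakian space forms -/

namespace AlmostContactMetric

variable {n : ℕ} {M : Type*} [TopologicalSpace M] [ChartedSpace (Model (2 * n + 1)) M]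
  [IsManifold (𝓡 (2 * n + 1)) ∞ M] (S : AlmostContactMetric n M)

/-- The vector field `ξ` in the coordinates of the preferred chart around `p`. -/
def ξCoord (p : M) (y : Model (2 * n + 1)) : Model (2 * n + 1) :=
  coordRep p (coordPoint p y) (S.ξ (coordPoint p y))

theorem η_eq_ηCoord {p q : M} (hq : q ∈ chartDom (m := 2 * n + 1) p)
    (v : TangentSpace (𝓡 (2 * n + 1)) q) :
    S.η q v = S.ηCoord p (coordOf p q) (coordRep p q v) := by
  have : ∀ q', q' = q → S.η q v = S.η q' (coordFrame p q' (coordRep p q v)) := by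
    rintro _ rfl
    rw [coordFrame_coordRep hq]
  exact this _ (coordPoint_coordOf hq)

theorem coordRep_φ {p q : M} (hq : q ∈ chartDom (m := 2 * n + 1) p)
    (v : TangentSpace (𝓡 (2 * n + 1)) q) :
    coordRep p q (S.φ q v) = S.φCoord p (coordOf p q) (coordRep p q v) := by
  have : ∀ q', q' = q → coordRep p q (S.φ q v)
      = coordRep p q' (S.φ q' (coordFrame p q' (coordRep p q v))) := by
    rintro _ rfl
    rw [coordFrame_coordRep hq]
  exact this _ (coordPoint_coordOf hq)

theorem coordRep_ξ {p q : M} (hq : q ∈ chartDom (m := 2 * n + 1) p) :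
    coordRep p q (S.ξ q) = S.ξCoord p (coordOf p q) := by
  rw [ξCoord, coordPoint_coordOf hq]

theorem ηCoord_change {p p' : M} {y : Model (2 * n + 1)} (hy : y ∈ chartRange p')
    (hy' : coordPoint p' y ∈ chartDom (m := 2 * n + 1) p) (v : Model (2 * n + 1)) :
    S.ηCoord p' y v = S.ηCoord p (transition p p' y) (fderiv ℝ (transition p p') y v) := by
  have := S.η_eq_ηCoord hy' (coordFrame p' (coordPoint p' y) v)
  rw [coordRep_coordFrame_change hy' (coordPoint_mem hy), coordOf_coordPoint hy] at this
  exact this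

theorem φCoord_change {p p' : M} {y : Model (2 * n + 1)} (hy : y ∈ chartRange p')
    (hy' : coordPoint p' y ∈ chartDom (m := 2 * n + 1) p) (v : Model (2 * n + 1)) :
    fderiv ℝ (transition p p') y (S.φCoord p' y v)
      = S.φCoord p (transition p p' y) (fderiv ℝ (transition p p') y v) := by
  have h1 := S.coordRep_φ hy' (coordFrame p' (coordPoint p' y) v)
  rw [coordRep_change hy' (coordPoint_mem hy), coordRep_coordFrame_change hy' (coordPoint_mem hy),
    coordOf_coordPoint hy] at h1
  exact h1

theorem isContactOn (p : M) :
    IsContactOn (metricCoord S.g p) (S.φCoord p) (S.ξCoord p) (S.ηCoord p) (chartRange p) where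
  metric := isMetricOn_metricCoord S.g p
  contDiffAt_φ y hy := by
    refine contDiffAt_clm_apply_iff.2 fun v => ?_
    have hq := coordPoint_mem hy
    have h1 := ContMDiffAt.clm_bundle_apply (S.smooth_φ (coordPoint p y))
      (contMDiffAt_coordFrame hq v)
    have h2 := ((contMDiffAt_along_iff (Y := fun z : M => z) (p := p) hq).1 h1).2
    exact contMDiffAt_iff_contDiffAt.1
      (ContMDiffAt.comp (I' := 𝓡 (2 * n + 1)) y h2 (contMDiffAt_coordPoint hy))
  contDiffAt_ξ y hy := by
    have hq := coordPoint_mem hy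
    have h2 := ((contMDiffAt_along_iff (Y := fun z : M => z) (p := p) hq).1
      (S.smooth_ξ (coordPoint p y))).2
    exact contMDiffAt_iff_contDiffAt.1
      (ContMDiffAt.comp (I' := 𝓡 (2 * n + 1)) y h2 (contMDiffAt_coordPoint hy))
  contDiffAt_η y hy := by
    refine contDiffAt_clm_apply_iff.2 fun v => ?_
    have hq := coordPoint_mem hy
    have h1 := ContMDiffAt.clm_bundle_apply (F₂ := ℝ) (E₂ := Bundle.Trivial M ℝ)
      (S.smooth_η (coordPoint p y)) (contMDiffAt_coordFrame hq v)
    exact contMDiffAt_iff_contDiffAt.1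
      ((contMDiffAt_scalar_section h1).comp y (contMDiffAt_coordPoint hy))
  algebra y hy := by
    have hq := coordPoint_mem hy
    have H := isMetricOn_metricCoord S.g p
    refine ⟨H.symm y hy, H.pos y hy, fun v => ?_, ?_, fun v w => ?_⟩
    · change coordRep p _ (S.φ _ (coordFrame p _ (coordRep p _ (S.φ _ (coordFrame p _ v))))) = _
      rw [coordFrame_coordRep hq, S.φ_φ, map_add, map_neg, map_smul, coordRep_coordFrame hq]
      rfl
    · change S.η _ (coordFrame p _ (coordRep p _ (S.ξ _))) = _
      rw [coordFrame_coordRep hq, S.η_ξ]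
    · have h1 := S.compatible (coordPoint p y) (coordFrame p _ v) (coordFrame p _ w)
      change S.g.inner _ (coordFrame p _ (coordRep p _ (S.φ _ (coordFrame p _ v))))
        (coordFrame p _ (coordRep p _ (S.φ _ (coordFrame p _ w)))) = _
      rw [coordFrame_coordRep hq, coordFrame_coordRep hq, h1]
      rfl

variable {S}

/-- `dη` is defined in the chart centred at the point. Its value at another point of the chart
around `p` follows by naturality under the transition map. -/
theorem IsContactMetric.fderiv_ηCoord (hS : S.IsContactMetric) (p : M) :
    ∀ y ∈ chartRange p, ∀ u v, fderiv ℝ (S.ηCoord p) y u v - fderiv ℝ (S.ηCoord p) y v u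
      = 2 * metricCoord S.g p y u (S.φCoord p y v) := by
  intro y hy u v
  have hp := coordPoint_mem hy
  have hq := mem_chartDom (m := 2 * n + 1) (coordPoint p y)
  have h0 := hS (coordPoint p y) (coordFrame p _ u) (coordFrame p _ v)
  rw [dη, coordRep_coordFrame_change hq hp, coordRep_coordFrame_change hq hp,
    coordOf_coordPoint hy] at h0
  rw [fderiv_oneForm_pullback (ψ := transition (coordPoint p y) p) (η := S.ηCoord (coordPoint p y))
    (contDiffAt_transition hy hq)
    ((S.isContactOn _).contDiffAt_η _ (coordOf_mem hq)).differentiableAt_infty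
    ((S.isContactOn p).contDiffAt_η y hy).differentiableAt_infty]
  · change _ = 2 * S.g.inner _ (coordFrame p _ u)
      (coordFrame p _ (coordRep p _ (S.φ _ (coordFrame p _ v))))
    rw [coordFrame_coordRep hp, ← h0]
    change _ = 2 * ((1 / 2 : ℝ) * _)
    rw [← mul_assoc]
    norm_num
    rfl
  · filter_upwards [(isOpen_chartRange p).mem_nhds hy, eventually_mem_chartDom
      (contMDiffAt_coordPoint hy).continuousAt hq] with z hz hz' v using S.ηCoord_change hz hz' v

theorem IsSasakian.nablaEnd_center (hS : S.IsSasakian) (x : M) (u v : Model (2 * n + 1)) :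
    nablaEnd (metricCoord S.g x) (S.φCoord x) (coordOf x x) u v
      = metricCoord S.g x (coordOf x x) u v • S.ξCoord x (coordOf x x)
        - S.ηCoord x (coordOf x x) v • u := by
  have hx := mem_chartDom (m := 2 * n + 1) x
  refine (S.isContactOn x).sasakian (hS.1.fderiv_ηCoord x) (coordOf_mem hx) (fun u v => ?_) u v
  have h0 := congrArg (coordRep x x) (hS.2 x (coordFrame x x u) (coordFrame x x v))
  rw [hS.1, map_smul, S.coordRep_ξ hx, inner_eq_metricCoord S.g hx, S.coordRep_φ hx, nijenhuis] at h0
  simp only [coordRep_coordFrame hx] at h0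
  exact h0

theorem IsSasakian.nablaEnd_φCoord (hS : S.IsSasakian) (p : M) :
    ∀ y ∈ chartRange p, ∀ u v, nablaEnd (metricCoord S.g p) (S.φCoord p) y u v
      = metricCoord S.g p y u v • S.ξCoord p y - S.ηCoord p y v • u := by
  intro y hy u v
  have hp := coordPoint_mem hy
  have hq := mem_chartDom (m := 2 * n + 1) (coordPoint p y)
  have hy' : ∀ᶠ z in nhds y, z ∈ chartRange (m := 2 * n + 1) p :=
    (isOpen_chartRange p).mem_nhds hy
  have hev : ∀ᶠ z in nhds y, z ∈ chartRange p ∧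
      coordPoint p z ∈ chartDom (m := 2 * n + 1) (coordPoint p y) :=
    hy'.and (eventually_mem_chartDom
      (contMDiffAt_coordPoint hy).continuousAt hq)
  have hsurj := surjective_fderiv_transition hq hp
  rw [coordOf_coordPoint hy] at hsurj
  have hD : ∀ w, coordRep (coordPoint p y) (coordPoint p y) (coordFrame p (coordPoint p y) w)
      = fderiv ℝ (transition (coordPoint p y) p) y w := fun w => by
    rw [coordRep_coordFrame_change hq hp, coordOf_coordPoint hy]
  have hinj : Function.Injective (fderiv ℝ (transition (coordPoint p y) p) y) := fun a b hab => by
    rw [← hD, ← hD] at hab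
    exact coordFrame_injective hp (coordRep_injective hq hab)
  apply hinj
  rw [(isMetricOn_metricCoord S.g (coordPoint p y)).nablaEnd_pullback
    (isMetricOn_metricCoord S.g p) hy (coordOf_mem hq) (contDiffAt_transition hy hq)
    (hev.mono fun z hz => metricCoord_change S.g hz.1 hz.2) hsurj
    ((S.isContactOn _).contDiffAt_φ _ (coordOf_mem hq)).differentiableAt_infty
    ((S.isContactOn p).contDiffAt_φ y hy).differentiableAt_infty
    (hev.mono fun z hz => S.φCoord_change hz.1 hz.2), map_sub, map_smul, map_smul,
    metricCoord_change S.g hy hq, S.ηCoord_change hy hq]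
  have h1 := hS.nablaEnd_center (coordPoint p y) (fderiv ℝ (transition (coordPoint p y) p) y u)
    (fderiv ℝ (transition (coordPoint p y) p) y v)
  have h2 : fderiv ℝ (transition (coordPoint p y) p) y (S.ξCoord p y)
      = S.ξCoord (coordPoint p y) (coordOf (coordPoint p y) (coordPoint p y)) := by
    rw [ξCoord, ← hD, coordFrame_coordRep hp, S.coordRep_ξ hq]
  rw [h2]
  exact h1

/-- The curvature tensor of a Sasakian space form. -/
theorem IsSasakianSpaceForm.curvature_eq {c : ℝ} (hS : S.IsSasakianSpaceForm c) (x : M)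
    {y t : TangentSpace (𝓡 (2 * n + 1)) x} (hy : S.η x y = 0) (ht : S.η x t = 0)
    (htt : S.g.inner x t t = 1) (hyt : S.g.inner x y t = 0) :
    curvature S.g x y t t = ((c + 3) / 4) • y
      + (3 * (c - 1) / 4 * S.g.inner x y (S.φ x t)) • S.φ x t := by
  have hx := mem_chartDom (m := 2 * n + 1) x
  have hm := coordOf_mem hx
  have H := isMetricOn_metricCoord S.g x
  have HC := S.isContactOn x
  have hA := HC.algebra _ hm
  have hsas := hS.1.nablaEnd_φCoord x
  have hR : ∀ u v w : TangentSpace (𝓡 (2 * n + 1)) x, coordRep x x (curvature S.g x u v w)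
      = curv (metricCoord S.g x) (coordOf x x) (coordRep x x u) (coordRep x x v)
        (coordRep x x w) := by
    intro u v w
    refine hA.eq_of_forall fun z => ?_
    have := inner_curvature S.g x u v w (coordFrame x x z)
    rwa [inner_eq_metricCoord S.g hx, coordRep_coordFrame hx] at this
  apply coordRep_injective hx
  rw [η_eq_ηCoord S hx] at hy ht
  rw [inner_eq_metricCoord S.g hx] at htt hyt
  rw [hR, map_add, map_smul, map_smul, inner_eq_metricCoord S.g hx, S.coordRep_φ hx]
  refine hA.curvature_eq (R := curv (metricCoord S.g x) (coordOf x x)) ?_ ?_ ?_ ?_ ?_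
    (HC.curv_ξ hsas hm) (HC.curv_φ hsas hm) ?_ hy ht htt hyt
  · intro u u' v w
    simp only [curv, map_add, add_apply]
    abel
  · exact fun u v w => IsMetricOn.curv_antisymm _ _ _ _
  · exact fun u v w z => H.curv_skew hm _ _ _ _
  · exact fun u v w z => H.curv_pair_symm hm _ _ _ _
  · exact fun u v w => H.curv_bianchi hm _ _ _
  · intro X hX
    rcases eq_or_ne X 0 with rfl | hX0
    · simp
    have hpos := hA.pos X hX0
    set N := metricCoord S.g x (coordOf x x) X X with hN
    -- The hypothesis concerns unit vectors, so `X` is scaled by `a = N^(-1/2)`. The curvature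
    -- expression is quartic, and `a⁴N² - 1 = (a²N - 1)(a²N + 1)` gives the last coefficient below.
    have ha : (√N)⁻¹ ^ 2 * N = 1 := by
      rw [inv_pow, Real.sq_sqrt hpos.le, inv_mul_cancel₀ hpos.ne']
    set a := (√N)⁻¹
    have h1 := hS.2 x (coordFrame x x (a • X)) (by
      rw [inner_eq_metricCoord S.g hx, coordRep_coordFrame hx, S.coordRep_ξ hx, ← hA.η_eq,
        map_smul, hX, smul_zero]) (by
      rw [inner_eq_metricCoord S.g hx, coordRep_coordFrame hx, map_smul, map_smul, smul_apply,
        smul_eq_mul, smul_eq_mul, ← hN, ← ha]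
      ring)
    have hcs : ∀ u v w, curv (metricCoord S.g x) (coordOf x x) (a • u) (a • v) (a • w)
        = a ^ 3 • curv (metricCoord S.g x) (coordOf x x) u v w := by
      intro u v w
      simp only [curv, map_smul, smul_apply]
      module
    rw [inner_curvature, S.coordRep_φ hx, coordRep_coordFrame hx,
      (S.φCoord x (coordOf x x)).map_smul, hcs, map_smul, map_smul, smul_apply, smul_eq_mul,
      smul_eq_mul] at h1
    linear_combination N ^ 2 * h1 - (metricCoord S.g x (coordOf x x)
      (curv (metricCoord S.g x) (coordOf x x) X (S.φCoord x (coordOf x x) X)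
        (S.φCoord x (coordOf x x) X)) X) * (a ^ 2 * N + 1) * ha

/-- `∇ξ = -φ` along curves. -/
theorem IsSasakian.covDerivAlong_ξ (hS : S.IsSasakian) {γ : ℝ → M} {s : ℝ}
    (hγ : ContMDiffAt 𝓘(ℝ, ℝ) (𝓡 (2 * n + 1)) ∞ γ s) :
    SmoothAlongAt γ (fun t => S.ξ (γ t)) s ∧
    covDerivAlong S.g γ (fun t => S.ξ (γ t)) s = -S.φ (γ s) (velocity γ s) := by
  have hp := mem_chartDom (m := 2 * n + 1) (γ s)
  have hm := coordOf_mem hp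
  have hd := hγ.mdifferentiableAt (by simp)
  have hξ := ((S.isContactOn (γ s)).contDiffAt_ξ _ hm)
  have hY := contDiffAt_coordCurve hγ hp
  have e : coordField (γ s) γ (fun t => S.ξ (γ t))
      =ᶠ[nhds s] fun t => S.ξCoord (γ s) (coordCurve (γ s) γ t) := by
    filter_upwards [eventually_mem_chartDom hγ.continuousAt hp] with t ht using S.coordRep_ξ ht
  have hs : SmoothAlongAt γ (fun t => S.ξ (γ t)) s :=
    (smoothAlongAt_iff hp).2 ⟨hγ, (ContDiffAt.comp (g := S.ξCoord (γ s)) s hξ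
      hY).congr_of_eventuallyEq e⟩
  refine ⟨hs, coordRep_injective hp ?_⟩
  rw [coordRep_covDerivAlong S.g hd hp (hs.field hp).differentiableAt_infty, map_neg,
    S.coordRep_φ hp, coordRep_velocity hd hp, covD, e.fderiv_eq, e.self_of_nhds]
  have h1 := (S.isContactOn (γ s)).nablaField_ξ hm (hS.nablaEnd_φCoord (γ s) _ hm)
    (fderiv ℝ (coordCurve (γ s) γ) s 1)
  rw [← h1, nablaField]
  have h2 := (hξ.differentiableAt_infty.hasFDerivAt.comp s
    hY.differentiableAt_infty.hasFDerivAt).fderiv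
  have h3 : fderiv ℝ (fun t => S.ξCoord (γ s) (coordCurve (γ s) γ t)) s = _ := h2
  rw [h3]
  rfl

end AlmostContactMetric

namespace AlmostContactMetric

variable {n : ℕ} {M : Type*} [TopologicalSpace M] [ChartedSpace (Model (2 * n + 1)) M]
  [IsManifold (𝓡 (2 * n + 1)) ∞ M] (S : AlmostContactMetric n M)

theorem η_eq_inner (x : M) (v : TangentSpace (𝓡 (2 * n + 1)) x) :
    S.η x v = S.g.inner x v (S.ξ x) := by
  have hx := mem_chartDom (m := 2 * n + 1) x
  rw [S.η_eq_ηCoord hx, inner_eq_metricCoord S.g hx, S.coordRep_ξ hx,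
    ((S.isContactOn x).algebra _ (coordOf_mem hx)).η_eq]

theorem inner_φ_self (x : M) (v : TangentSpace (𝓡 (2 * n + 1)) x) :
    S.g.inner x v (S.φ x v) = 0 := by
  have hx := mem_chartDom (m := 2 * n + 1) x
  have hm := coordOf_mem hx
  have h1 := ((S.isContactOn x).algebra _ hm).skew (coordRep x x v) (coordRep x x v)
  rw [(isMetricOn_metricCoord S.g x).symm _ hm] at h1
  rw [inner_eq_metricCoord S.g hx, S.coordRep_φ hx]
  linarith

end AlmostContactMetric

/-! ### Frenet curves: derivatives of the tension field -/

section Frenet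

variable {m : ℕ} {M : Type*} [TopologicalSpace M] [ChartedSpace (Model m) M]
  [IsManifold (𝓡 m) ∞ M] {g : RMetric m M} {J : Set ℝ} {γ : ℝ → M} {r : ℕ}
  {E : ℕ → ∀ s, TangentSpace (𝓡 m) (γ s)} {k : ℕ → ℝ → ℝ}

theorem ContDiffAt.deriv_infty {f : ℝ → ℝ} {s : ℝ} (hf : ContDiffAt ℝ ∞ f s) :
    ContDiffAt ℝ ∞ (deriv f) s := by
  have : deriv f = fun t => fderiv ℝ f t 1 := by
    funext t; exact fderiv_apply_one_eq_deriv.symm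
  rw [this]
  exact hf.fderiv_infty.clm_apply contDiffAt_const

namespace IsFrenetCurve

theorem tension_eq (h : IsFrenetCurve g J γ r E k) (hJ : IsOpen J) (hr : 2 ≤ r) {s : ℝ}
    (hs : s ∈ J) : tension g γ s = k 1 s • E 2 s := by
  rw [tension, ← h.frenet_first hr s hs]
  refine covDerivAlong_congr g ?_
  filter_upwards [hJ.mem_nhds hs] with t ht using (h.frame_one t ht).symm

theorem contDiffAt_curvature (h : IsFrenetCurve g J γ r E k) (hJ : IsOpen J) {i : ℕ} (hi : 1 ≤ i)
    (hi' : i < r) {s : ℝ} (hs : s ∈ J) : ContDiffAt ℝ ∞ (k i) s :=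
  (h.smooth_curvature i hi hi').contDiffAt (hJ.mem_nhds hs)

theorem smoothAlongAt_frame (h : IsFrenetCurve g J γ r E k) (hJ : IsOpen J) {i : ℕ} (hi : 1 ≤ i)
    (hi' : i ≤ r) {s : ℝ} (hs : s ∈ J) : SmoothAlongAt γ (E i) s :=
  (h.smooth_frame i hi hi').smoothAlongAt hJ hs

theorem covDerivAlong_tension (h : IsFrenetCurve g J γ r E k) (hJ : IsOpen J) (hr : 3 ≤ r) {s : ℝ}
    (hs : s ∈ J) : covDerivAlong g γ (tension g γ) s
      = (-(k 1 s * k 1 s)) • E 1 s + (deriv (k 1) s • E 2 s + (k 1 s * k 2 s) • E 3 s) := by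
  have e : ∀ᶠ t in nhds s, tension g γ t = k 1 t • E 2 t := by
    filter_upwards [hJ.mem_nhds hs] with t ht using h.tension_eq hJ (by omega) ht
  rw [covDerivAlong_congr g e, SmoothAlongAt.covDerivAlong_smul g
    (h.contDiffAt_curvature hJ le_rfl (by omega) hs)
    (h.smoothAlongAt_frame hJ (by omega) (by omega) hs), h.frenet_middle 2 le_rfl (by omega) s hs]
  module

theorem covDerivAlong_covDerivAlong_tension (h : IsFrenetCurve g J γ r E k) (hJ : IsOpen J)
    (hr : 4 ≤ r) {s : ℝ} (hs : s ∈ J) :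
    covDerivAlong g γ (covDerivAlong g γ (tension g γ)) s
      = (-(3 * k 1 s * deriv (k 1) s)) • E 1 s
        + (deriv (deriv (k 1)) s - k 1 s ^ 3 - k 1 s * k 2 s ^ 2) • E 2 s
        + (2 * deriv (k 1) s * k 2 s + k 1 s * deriv (k 2) s) • E 3 s
        + (k 1 s * k 2 s * k 3 s) • E 4 s := by
  have e : ∀ᶠ t in nhds s, covDerivAlong g γ (tension g γ) t
      = (-(k 1 t * k 1 t)) • E 1 t + (deriv (k 1) t • E 2 t + (k 1 t * k 2 t) • E 3 t) := by
    filter_upwards [hJ.mem_nhds hs] with t ht using h.covDerivAlong_tension hJ (by omega) ht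
  have k1 := h.contDiffAt_curvature (i := 1) hJ (by omega) (by omega) hs
  have k2 := h.contDiffAt_curvature (i := 2) hJ (by omega) (by omega) hs
  have e1 := h.smoothAlongAt_frame (i := 1) hJ (by omega) (by omega) hs
  have e2 := h.smoothAlongAt_frame (i := 2) hJ (by omega) (by omega) hs
  have e3 := h.smoothAlongAt_frame (i := 3) hJ (by omega) (by omega) hs
  have c1 : ContDiffAt ℝ ∞ (fun t => -(k 1 t * k 1 t)) s := (k1.mul k1).neg
  have c3 : ContDiffAt ℝ ∞ (fun t => k 1 t * k 2 t) s := k1.mul k2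
  have d1 := k1.differentiableAt_infty.hasDerivAt
  have d2 := k2.differentiableAt_infty.hasDerivAt
  have dc1 : deriv (fun t => -(k 1 t * k 1 t)) s
      = -(deriv (k 1) s * k 1 s + k 1 s * deriv (k 1) s) := (d1.mul d1).neg.deriv
  have dc3 : deriv (fun t => k 1 t * k 2 t) s
      = deriv (k 1) s * k 2 s + k 1 s * deriv (k 2) s := (d1.mul d2).deriv
  rw [covDerivAlong_congr g e, SmoothAlongAt.covDerivAlong_add g (e1.smul c1)
      ((e2.smul k1.deriv_infty).add (e3.smul c3)),
    SmoothAlongAt.covDerivAlong_add g (e2.smul k1.deriv_infty) (e3.smul c3),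
    SmoothAlongAt.covDerivAlong_smul g c1 e1,
    SmoothAlongAt.covDerivAlong_smul g k1.deriv_infty e2,
    SmoothAlongAt.covDerivAlong_smul g c3 e3, h.frenet_first (by omega) s hs,
    h.frenet_middle 2 le_rfl (by omega) s hs, h.frenet_middle 3 (by omega) (by omega) s hs, dc1, dc3]
  module

end IsFrenetCurve

/-- A linear combination of four orthonormal vectors and a vector orthogonal to the first one. -/
theorem combination_eq_zero_iff (g : RMetric m M) (x : M) {e₁ e₂ e₃ e₄ P : TangentSpace (𝓡 m) x}
    (h11 : g.inner x e₁ e₁ = 1) (h22 : g.inner x e₂ e₂ = 1) (h33 : g.inner x e₃ e₃ = 1)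
    (h44 : g.inner x e₄ e₄ = 1) (h12 : g.inner x e₁ e₂ = 0) (h13 : g.inner x e₁ e₃ = 0)
    (h14 : g.inner x e₁ e₄ = 0) (h23 : g.inner x e₂ e₃ = 0) (h24 : g.inner x e₂ e₄ = 0)
    (h34 : g.inner x e₃ e₄ = 0) (h1P : g.inner x e₁ P = 0) {A B C D Q : ℝ} (hD : D ≠ 0) :
    A • e₁ + B • e₂ + C • e₃ + D • e₄ + Q • P = 0 ↔
      P ∈ Submodule.span ℝ {e₂, e₃, e₄} ∧ A = 0 ∧ B + Q * g.inner x e₂ P = 0 ∧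
        C + Q * g.inner x e₃ P = 0 ∧ D + Q * g.inner x e₄ P = 0 := by
  have hs := g.symm x
  constructor
  · intro h0
    have p1 := congrArg (g.inner x e₁) h0
    have p2 := congrArg (g.inner x e₂) h0
    have p3 := congrArg (g.inner x e₃) h0
    have p4 := congrArg (g.inner x e₄) h0
    simp only [map_add, map_smul, smul_eq_mul, map_zero, h11, h22, h33, h44, h12, h13, h14, h23,
      h24, h34, h1P, hs e₂ e₁, hs e₃ e₁, hs e₄ e₁, hs e₃ e₂, hs e₄ e₂, hs e₄ e₃, mul_zero, mul_one,
      add_zero, zero_add] at p1 p2 p3 p4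
    refine ⟨?_, p1, p2, p3, p4⟩
    -- The `e₄`-component is `D + Q g(e₄, P) = 0` with `D ≠ 0`. Hence the relation can be solved for
    -- `P`.
    have hQ : Q ≠ 0 := by
      rintro rfl
      rw [zero_mul, add_zero] at p4
      exact hD p4
    rw [p1, zero_smul, zero_add] at h0
    have hP : P = (-(Q⁻¹ * B)) • e₂ + ((-(Q⁻¹ * C)) • e₃ + (-(Q⁻¹ * D)) • e₄) := by
      have h1 : Q⁻¹ • (B • e₂ + C • e₃ + D • e₄ + Q • P) = 0 := by rw [h0, smul_zero]
      rw [smul_add, smul_smul Q⁻¹ Q, inv_mul_cancel₀ hQ, one_smul] at h1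
      rw [← sub_eq_zero, ← h1]
      module
    rw [Submodule.mem_span_triple]
    exact ⟨_, _, _, by rw [hP]; abel⟩
  · rintro ⟨hP, hA, hB, hC, hDQ⟩
    obtain ⟨a, b, d, rfl⟩ := Submodule.mem_span_triple.1 hP
    simp only [map_add, map_smul, smul_eq_mul, h22, h33, h44, h23, h24, h34, hs e₃ e₂, hs e₄ e₂,
      hs e₄ e₃, mul_zero, mul_one, add_zero, zero_add] at hB hC hDQ
    rw [hA]
    have : (0 : ℝ) • e₁ + B • e₂ + C • e₃ + D • e₄ + Q • (a • e₂ + b • e₃ + d • e₄)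
        = (B + Q * a) • e₂ + (C + Q * b) • e₃ + (D + Q * d) • e₄ := by module
    rw [this, hB, hC, hDQ, zero_smul, zero_smul, zero_smul, add_zero, add_zero]

end Frenet

/-! ### The Euler-Lagrange expression of a Legendre Frenet curve -/

namespace AlmostContactMetric

variable {n : ℕ} {M : Type*} [TopologicalSpace M] [ChartedSpace (Model (2 * n + 1)) M]
  [IsManifold (𝓡 (2 * n + 1)) ∞ M] {S : AlmostContactMetric n M} {J : Set ℝ} {γ : ℝ → M} {r : ℕ}
  {E : ℕ → ∀ s, TangentSpace (𝓡 (2 * n + 1)) (γ s)} {k : ℕ → ℝ → ℝ}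

/-- The normal of a Legendre curve is orthogonal to `ξ`. -/
theorem IsLegendre.η_normal (hL : S.IsLegendre J γ) (hS : S.IsSasakian) (hJ : IsOpen J)
    (hγ : IsFrenetCurve S.g J γ r E k) (hr : 2 ≤ r) {s : ℝ} (hs : s ∈ J) :
    S.η (γ s) (E 2 s) = 0 := by
  have hsm : ContMDiffAt 𝓘(ℝ, ℝ) (𝓡 (2 * n + 1)) ∞ γ s := hγ.smooth.contMDiffAt (hJ.mem_nhds hs)
  obtain ⟨h1, h2⟩ := hS.covDerivAlong_ξ hsm
  -- Differentiating `g(T, ξ) = 0` gives `k₁ g(E₂, ξ) - g(T, φT) = 0`, whose second term vanishes.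
  have h3 := (smoothAlongAt_velocity hsm).hasDerivAt_inner S.g h1
  have e : (fun t => S.g.inner (γ t) (velocity γ t) (S.ξ (γ t))) =ᶠ[nhds s] fun _ => (0 : ℝ) := by
    filter_upwards [hJ.mem_nhds hs] with t ht
    rw [← S.η_eq_inner, hL t ht]
  have h4 := h3.deriv
  have h5 := hγ.tension_eq hJ hr hs
  rw [tension] at h5
  rw [e.deriv_eq, deriv_const, h2, map_neg, S.inner_φ_self, h5, map_smul, smul_apply, smul_eq_mul,
    ← S.η_eq_inner, neg_zero, add_zero] at h4
  exact (mul_eq_zero.1 h4.symm).resolve_left (hγ.curvature_pos 1 le_rfl (by omega) s hs).ne'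

/-- The curvature formula applies to `τ = k₁ E₂`, which is orthogonal to `T` and to `ξ`. The term in
`φT` is kept apart because `φT` need not be in the span of the frame. -/
theorem eulerLagrange_eq {c : ℝ} (hS : S.IsSasakianSpaceForm c) (hL : S.IsLegendre J γ)
    (hJ : IsOpen J) (hγ : IsFrenetCurve S.g J γ r E k) (hr : 4 ≤ r) {δ₁ δ₂ : ℝ} (hδ₂ : δ₂ ≠ 0)
    {s : ℝ} (hs : s ∈ J) :
    eulerLagrange S.g δ₁ δ₂ γ s = δ₂ • ((-(3 * k 1 s * deriv (k 1) s)) • E 1 s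
        + (deriv (deriv (k 1)) s
          - k 1 s * (k 1 s ^ 2 + k 2 s ^ 2 - (c + 3) / 4 + δ₁ / δ₂)) • E 2 s
        + (2 * deriv (k 1) s * k 2 s + k 1 s * deriv (k 2) s) • E 3 s
        + (k 1 s * k 2 s * k 3 s) • E 4 s
        + (3 * (c - 1) / 4 * (k 1 s * S.g.inner (γ s) (S.φ (γ s) (velocity γ s)) (E 2 s))) •
          S.φ (γ s) (velocity γ s)) := by
  have hR := hS.curvature_eq (γ s) (y := k 1 s • E 2 s) (t := velocity γ s)
    (by rw [map_smul, hL.η_normal hS.1 hJ hγ (by omega) hs, smul_zero]) (hL s hs)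
    (by rw [← hγ.frame_one s hs, hγ.orthonormal 1 1 le_rfl (by omega) le_rfl (by omega) s hs,
      if_pos rfl])
    (by rw [← hγ.frame_one s hs, map_smul, smul_apply,
      hγ.orthonormal 2 1 (by omega) (by omega) le_rfl (by omega) s hs, if_neg (by omega), smul_zero])
  rw [eulerLagrange, hγ.covDerivAlong_covDerivAlong_tension hJ hr hs,
    hγ.tension_eq hJ (by omega) hs, hR, map_smul, smul_apply, smul_eq_mul,
    S.g.symm (γ s) (E 2 s)]
  have h1 : δ₁ = δ₂ * (δ₁ / δ₂) := by field_simp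
  nth_rewrite 1 [h1]
  module

end AlmostContactMetric

/-! ### The characterization -/

theorem mainTheorem8 (n : ℕ) (hn : 2 ≤ n) {M : Type*} [TopologicalSpace M] [T2Space M]
    [SecondCountableTopology M] [ChartedSpace (Model (2 * n + 1)) M]
    [IsManifold (𝓡 (2 * n + 1)) ∞ M]
    (S : AlmostContactMetric n M) (c : ℝ) (hS : S.IsSasakianSpaceForm c) (hc : c ≠ 1)
    (J : Set ℝ) (hJo : IsOpen J) (hJ : J.OrdConnected)
    (γ : ℝ → M) (r : ℕ) (hr : 4 ≤ r) (hrn : r ≤ 2 * n + 1)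
    (E : ℕ → ∀ s, TangentSpace (𝓡 (2 * n + 1)) (γ s)) (k : ℕ → ℝ → ℝ)
    (hγ : IsFrenetCurve S.g J γ r E k) (hL : S.IsLegendre J γ)
    (f : ℝ → ℝ) (hf : ∀ s, f s = S.g.inner (γ s) (S.φ (γ s) (velocity γ s)) (E 2 s))
    (hf_zero : ¬ ∀ s ∈ J, f s = 0) (hf_one : ¬ ∀ s ∈ J, f s = 1)
    (hf_neg : ¬ ∀ s ∈ J, f s = -1)
    (δ₁ δ₂ : ℝ) (hδ₂ : δ₂ ≠ 0) (hδ : δ₁ / δ₂ ≠ 0) :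
    IsInterpolatingSesquiHarmonic S.g δ₁ δ₂ J γ ↔
      (∀ s ∈ J, S.φ (γ s) (velocity γ s) ∈ Submodule.span ℝ {E 2 s, E 3 s, E 4 s}) ∧
      (∃ κ : ℝ, 0 < κ ∧ ∀ s ∈ J, k 1 s = κ) ∧
      (∀ s ∈ J, k 1 s ^ 2 + k 2 s ^ 2
        = (c + 3) / 4 + 3 * (c - 1) / 4 * f s ^ 2 - δ₁ / δ₂) ∧
      (∀ s ∈ J, deriv (k 2) s
        = -(3 * (c - 1) / 4) * f s * S.g.inner (γ s) (E 3 s) (S.φ (γ s) (velocity γ s))) ∧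
      (∀ s ∈ J, k 2 s * k 3 s
        = -(3 * (c - 1) / 4) * f s * S.g.inner (γ s) (E 4 s) (S.φ (γ s) (velocity γ s))) := by
  have hpos : ∀ i, 1 ≤ i → i < 4 → ∀ s ∈ J, 0 < k i s := fun i hi hi' =>
    hγ.curvature_pos i hi (by omega)
  -- The Euler-Lagrange equation at one point, split into frame components; `k₁ k₂ k₃ > 0` is the
  -- nonzero coefficient that puts `φT` in the span.
  have hEL : ∀ s ∈ J, (eulerLagrange S.g δ₁ δ₂ γ s = 0 ↔
      S.φ (γ s) (velocity γ s) ∈ Submodule.span ℝ {E 2 s, E 3 s, E 4 s} ∧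
      -(3 * k 1 s * deriv (k 1) s) = 0 ∧
      deriv (deriv (k 1)) s - k 1 s * (k 1 s ^ 2 + k 2 s ^ 2 - (c + 3) / 4 + δ₁ / δ₂)
        + 3 * (c - 1) / 4 * (k 1 s * f s) * f s = 0 ∧
      2 * deriv (k 1) s * k 2 s + k 1 s * deriv (k 2) s + 3 * (c - 1) / 4 * (k 1 s * f s)
        * S.g.inner (γ s) (E 3 s) (S.φ (γ s) (velocity γ s)) = 0 ∧
      k 1 s * k 2 s * k 3 s + 3 * (c - 1) / 4 * (k 1 s * f s)
        * S.g.inner (γ s) (E 4 s) (S.φ (γ s) (velocity γ s)) = 0) := by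
    intro s hs
    have ho : ∀ i j, 1 ≤ i → i ≤ 4 → 1 ≤ j → j ≤ 4 →
        S.g.inner (γ s) (E i s) (E j s) = if i = j then 1 else 0 := fun i j h1 h2 h3 h4 =>
      hγ.orthonormal i j h1 (h2.trans hr) h3 (h4.trans hr) s hs
    have hfs : S.g.inner (γ s) (E 2 s) (S.φ (γ s) (velocity γ s)) = f s := by
      rw [hf, S.g.symm]
    rw [AlmostContactMetric.eulerLagrange_eq hS hL hJo hγ hr hδ₂ hs, smul_eq_zero_iff_right hδ₂,
      combination_eq_zero_iff S.g (γ s) (ho 1 1 _ _ _ _) (ho 2 2 _ _ _ _) (ho 3 3 _ _ _ _)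
        (ho 4 4 _ _ _ _) (ho 1 2 _ _ _ _) (ho 1 3 _ _ _ _) (ho 1 4 _ _ _ _) (ho 2 3 _ _ _ _)
        (ho 2 4 _ _ _ _) (ho 3 4 _ _ _ _)
        (by rw [hγ.frame_one s hs, S.inner_φ_self])
        (mul_pos (mul_pos (hpos 1 (by omega) (by omega) s hs) (hpos 2 (by omega) (by omega) s hs))
          (hpos 3 (by omega) (by omega) s hs)).ne', hfs, ← hf] <;> omega
  rw [isInterpolatingSesquiHarmonic_iff hJo hγ.smooth, forall₂_congr hEL]
  have hd2 : (∀ s ∈ J, deriv (k 1) s = 0) → ∀ s ∈ J, deriv (deriv (k 1)) s = 0 := by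
    intro h s hs
    have e : deriv (k 1) =ᶠ[nhds s] fun _ => (0 : ℝ) := by
      filter_upwards [hJo.mem_nhds hs] with t ht using h t ht
    rw [e.deriv_eq, deriv_const]
  constructor
  · intro h
    have hk1 : ∀ s ∈ J, deriv (k 1) s = 0 := fun s hs => by
      have h1 := hpos 1 le_rfl (by omega) s hs
      have h2 := (h s hs).2.1
      rw [neg_eq_zero, mul_eq_zero] at h2
      exact h2.resolve_left (by positivity)
    -- A value for the constant `κ` requires a point of `J`; on an empty `J` the function `f` would
    -- vanish identically.
    obtain ⟨s₀, hs₀⟩ : J.Nonempty := by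
      by_contra hne
      rw [not_nonempty_iff_eq_empty] at hne
      exact hf_zero (by simp [hne])
    refine ⟨fun s hs => (h s hs).1, ⟨k 1 s₀, hpos 1 le_rfl (by omega) s₀ hs₀, fun s hs =>
      hJo.is_const_of_deriv_eq_zero hJ.isPreconnected
        ((hγ.smooth_curvature 1 le_rfl (by omega)).differentiableOn (by simp)) hk1 hs hs₀⟩,
      fun s hs => ?_, fun s hs => ?_, fun s hs => ?_⟩ <;>
    · obtain ⟨-, -, h2, h3, h4⟩ := h s hs
      have h1 := hpos 1 le_rfl (by omega) s hs
      rw [hd2 hk1 s hs] at h2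
      rw [hk1 s hs] at h3
      -- With `k₁' = k₁'' = 0` each remaining component is `k₁` times the required equation.
      apply mul_left_cancel₀ h1.ne'
      linarith
  · rintro ⟨hsp, ⟨κ, -, hκ⟩, h2, h3, h4⟩ s hs
    have hk1 : ∀ s ∈ J, deriv (k 1) s = 0 := fun s hs => by
      have e : k 1 =ᶠ[nhds s] fun _ => κ := by
        filter_upwards [hJo.mem_nhds hs] with t ht using hκ t ht
      rw [e.deriv_eq, deriv_const]
    refine ⟨hsp s hs, ?_, ?_, ?_, ?_⟩
    · rw [hk1 s hs]; ring
    · rw [hd2 hk1 s hs, h2 s hs]; ring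
    · rw [hk1 s hs, h3 s hs]; ring
    · rw [mul_assoc, h4 s hs]; ring

end
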